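/- Let $Z_-\in\mathbb R$, $h>0$ and $E>2|Z_-|$, and put $\gamma_1=Z_- /h^2$, $\gamma_2=E/(2h^2)$. For $\beta\in\mathbb C$ consider the eigenvalue problem $$-\psi''(\eta)+\bigl(\gamma_1\cos\eta+\gamma_2\cos 2\eta+\beta\,(1+\cos 2\eta)\bigr)\psi(\eta)=\lambda\,\psi(\eta),\qquad \eta\in[0,\pi],$$ with either Dirichlet conditions $\psi(0)=\psi(\pi)=0$ or Neumann conditions $\psi'(0)=\psi'(\pi)=0$. For $\beta=0$ let $\lambda_n$ denote the $n$-th (real) eigenvalue in increasing order, numbered by $n\ge 1$ in the Dirichlet case and by $n\ge 0$ in the Neumann case. Then, for each of the two boundary conditions and each such $n$, there is exactly one power series in $\beta$ that is the Taylor series at $\beta=0$ of an analytic function $\lambda_n(\beta)$ with $\lambda_n(0)=\lambda_n$ and $\lambda_n(\beta)$ an eigenvalue of the problem for all complex $\beta$ near $0$; and the convergence radii $\rho_n^{D}$ (Dirichlet) and $\rho_n^{N}$ (Neumann) of these series satisfy $$\liminf_{n\to\infty}\frac{\rho_n^{D}}{n^2}\ \ge\ \frac{6}{13},\qquad \liminf_{n\to\infty}\frac{\rho_n^{N}}{n^2}\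 \ge\ \frac{6}{13}.$$ -/

import Mathlib

open Filter Topology
open scoped ENNReal

namespace AngularHill

/-- The two types of separated boundary conditions on the half period `[0, π]`. -/
inductive BoundaryCondition where
  | dirichlet
  | neumann

/-- The boundary condition for a function `ψ` with derivative `dψ` on `[0, π]`. -/
def BoundaryCondition.Holds : BoundaryCondition → (ℝ → ℂ) → (ℝ → ℂ) → Prop
  | .dirichlet, ψ, _ => ψ 0 = 0 ∧ ψ Real.pi = 0
  | .neumann, _, dψ => dψ 0 = 0 ∧ dψ Real.pi = 0

/-- The eigenvalues are numbered from `1` in the Dirichlet case and from `0` in the Neumann case,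
so that the `n`-th eigenvalue of `-∂²` is `n²` in both cases. -/
def BoundaryCondition.firstIndex : BoundaryCondition → ℕ
  | .dirichlet => 1
  | .neumann => 0

/-- The potential `γ₁ cos η + γ₂ cos 2η + β (1 + cos 2η)`. -/
noncomputable def potential (γ₁ γ₂ : ℝ) (β : ℂ) (η : ℝ) : ℂ :=
  ((γ₁ * Real.cos η + γ₂ * Real.cos (2 * η) : ℝ) : ℂ) + β * ((1 + Real.cos (2 * η) : ℝ) : ℂ)

/-- `lam` is an eigenvalue of
`-ψ'' + (γ₁ cos η + γ₂ cos 2η + β (1 + cos 2η)) ψ = lam ψ` on `[0, π]` with the given boundary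
condition: there is a nonzero classical solution `ψ` (with derivative `dψ`; derivatives at the end
points are one-sided). -/
def IsEigenvalue (bc : BoundaryCondition) (γ₁ γ₂ : ℝ) (β lam : ℂ) : Prop :=
  ∃ ψ dψ : ℝ → ℂ,
    (∀ η ∈ Set.Icc 0 Real.pi, HasDerivWithinAt ψ (dψ η) (Set.Icc 0 Real.pi) η) ∧
    (∀ η ∈ Set.Icc 0 Real.pi,
      HasDerivWithinAt dψ ((potential γ₁ γ₂ β η - lam) * ψ η) (Set.Icc 0 Real.pi) η) ∧
    bc.Holds ψ dψ ∧
    ∃ η ∈ Set.Icc 0 Real.pi, ψ η ≠ 0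

/-- `lam` is the `n`-th eigenvalue, in increasing order, of the unperturbed (`β = 0`) self-adjoint
problem. The eigenvalues of this problem are real and simple. -/
def IsNthEigenvalue (bc : BoundaryCondition) (γ₁ γ₂ : ℝ) (n : ℕ) (lam : ℝ) : Prop :=
  IsEigenvalue bc γ₁ γ₂ 0 (lam : ℂ) ∧
    {ν : ℝ | ν < lam ∧ IsEigenvalue bc γ₁ γ₂ 0 (ν : ℂ)}.encard + (bc.firstIndex : ℕ∞) = (n : ℕ∞)

/-- `p` is the perturbation series in `β` of the `n`-th eigenvalue: the Taylor series at `β = 0` of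
an analytic function `Λ` that starts at the `n`-th eigenvalue of the unperturbed problem, and
whose value at `β` is an eigenvalue of the perturbed problem for all `β ∈ ℂ` near `0`. -/
def IsPerturbationSeries (bc : BoundaryCondition) (γ₁ γ₂ : ℝ) (n : ℕ)
    (p : FormalMultilinearSeries ℂ ℂ ℂ) : Prop :=
  ∃ Λ : ℂ → ℂ, HasFPowerSeriesAt Λ p 0 ∧
    (∃ lam : ℝ, IsNthEigenvalue bc γ₁ γ₂ n lam ∧ Λ 0 = (lam : ℂ)) ∧
    ∀ᶠ β in 𝓝 (0 : ℂ), IsEigenvalue bc γ₁ γ₂ β (Λ β)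

/-- The convergence radius `ρ_n ∈ [0, ∞]` of the perturbation series of the `n`-th eigenvalue.
The supremum is over a single series whenever the series exists and is unique
(it would be `0` if there were none). -/
noncomputable def convergenceRadius (bc : BoundaryCondition) (γ₁ γ₂ : ℝ) (n : ℕ) : ℝ≥0∞ :=
  ⨆ (p : FormalMultilinearSeries ℂ ℂ ℂ) (_ : IsPerturbationSeries bc γ₁ γ₂ n p), p.radius

end AngularHill

/-!
Put `M(e) = π⁻¹ ∫₀^π √(1 - e cos 2x) dx` and parametrize `β = k² e / M(e)²`,
`λ = β + k² / M(e)²`. The equation becomes `-ψ'' + V ψ = (k / M(e))² (1 - e cos 2η) ψ`, where the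
potential `V = γ₁ cos η + γ₂ cos 2η` does not depend on `e`. For `|e| < 0.51` the Liouville
transformation along the complex phase `M(e)⁻¹ ∫₀^x √(1 - e cos 2t) dt`, followed by a contour shift
back to `[0, π]`, turns this into `-y'' = (k² + R_e) y` with `R_e` bounded and holomorphic in `e`.
For large `n` the boundary condition therefore forces `k = n + τ_n(e)` with `τ_n` holomorphic and
small, and `β` determines `e` as the solution of `e = β M(e)² / (n + τ_n(e))²`. The right hand side
is a contraction of the disc `|e| ≤ 0.505` as long as `|β| < 6 n² / 13`, because
`6 / 13 · 1.093 < 0.505`, where `1.093` bounds `|M(e)|² n² / |n + τ_n(e)|²`. This continues the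
eigenvalue holomorphically to the whole disc, and the Prüfer angle shows that the branch starts at
the `n`-th eigenvalue.
-/

namespace AngularHill

open ContinuousMap (IccExtendCM IccExtendCM_of_mem)

/-! ### The initial value problem `u'' = q u` on `[0, ℓ]` -/

section ConjugationByMultiplication

variable {A : Type*} [NormedCommRing A] [NormedAlgebra ℂ A]

open ContinuousLinearMap (mul)

lemma mul_mul_mul (f g : A) : mul ℂ A f * mul ℂ A g = mul ℂ A (f * g) := by
  ext1 u
  simp [mul_assoc]

lemma mul_one_eq_one : mul ℂ A 1 = 1 := by
  ext1 u
  simp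

/-- Multiplication by a unit `w`, as an invertible operator. -/
noncomputable def mulUnit (w : Aˣ) : (A →L[ℂ] A)ˣ where
  val := mul ℂ A w
  inv := mul ℂ A (w⁻¹ : Aˣ)
  val_inv := by rw [mul_mul_mul, w.mul_inv, mul_one_eq_one]
  inv_val := by rw [mul_mul_mul, w.inv_mul, mul_one_eq_one]

/-- The operator `f ↦ w⁻¹ T (w f)`. -/
noncomputable def conjMul (w : Aˣ) (T : A →L[ℂ] A) : A →L[ℂ] A :=
  (mulUnit w)⁻¹.val * T * (mulUnit w).val

lemma isUnit_one_sub_conjMul_iff {w : Aˣ} {T : A →L[ℂ] A} :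
    IsUnit (1 - conjMul w T) ↔ IsUnit (1 - T) := by
  have h : 1 - conjMul w T = (mulUnit w)⁻¹.val * (1 - T) * (mulUnit w).val := by
    rw [conjMul, mul_sub, sub_mul, mul_one, Units.inv_mul]
  rw [h, Units.isUnit_mul_units, Units.isUnit_units_mul]

/-- The operator `f ↦ P (P (q f))`, depending linearly on `q`. For the primitive operator `P` it
turns `u'' = q u` into the equation `(1 - volterra P q) u = u(0) + u'(0) x`. -/
noncomputable def volterra (P : A →L[ℂ] A) : A →L[ℂ] A →L[ℂ] A :=
  (ContinuousLinearMap.compL ℂ A A A (P * P)).comp (mul ℂ A)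

lemma conjMul_volterra (P : A →L[ℂ] A) (w : Aˣ) (q : A) :
    conjMul w (volterra P q) = conjMul w P * conjMul w P * mul ℂ A q := by
  ext1 f
  change (w⁻¹ : Aˣ) * P (P (q * (w * f)))
    = (w⁻¹ : Aˣ) * P (w * ((w⁻¹ : Aˣ) * P (w * (q * f))))
  rw [Units.mul_inv_cancel_left, mul_left_comm q]

lemma isUnit_one_sub_volterra [CompleteSpace A] {P : A →L[ℂ] A}
    (hP : ∀ ε > 0, ∃ w : Aˣ, ‖conjMul w P‖ ≤ ε) (q : A) :
    IsUnit (1 - volterra P q) := by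
  obtain ⟨w, hw⟩ := hP (1 / (‖q‖ + 1)) (by positivity)
  refine (isUnit_one_sub_conjMul_iff (w := w)).1 (isUnit_one_sub_of_norm_lt_one ?_)
  calc ‖conjMul w (volterra P q)‖ ≤ ‖conjMul w P‖ * ‖conjMul w P‖ * ‖mul ℂ A q‖ :=
        conjMul_volterra P w q ▸ norm_mul₃_le
    _ ≤ 1 / (‖q‖ + 1) * (1 / (‖q‖ + 1)) * ‖q‖ := by
        gcongr
        exact ContinuousLinearMap.opNorm_mul_apply_le ℂ A q
    _ < 1 := by
        rw [div_mul_div_comm, div_mul_eq_mul_div, div_lt_one (by positivity)]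
        nlinarith [norm_nonneg q]

end ConjugationByMultiplication

lemma contDiff_inverse_one_sub_apply {B C : Type*} [NormedAddCommGroup B] [NormedSpace ℂ B]
    [NormedAddCommGroup C] [NormedSpace ℂ C] [CompleteSpace C] {T : B →L[ℂ] C →L[ℂ] C}
    (hT : ∀ q, IsUnit (1 - T q)) (f : C) :
    ContDiff ℂ 1 fun q => Ring.inverse (1 - T q) f := by
  rw [contDiff_iff_contDiffAt]
  intro q
  have hsub : ContDiffAt ℂ 1 (fun q => 1 - T q) q :=
    contDiffAt_const.sub T.contDiff.contDiffAt
  have hinv : ContDiffAt ℂ 1 Ring.inverse (1 - T q) :=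
    (hT q).unit_spec ▸ contDiffAt_ringInverse ℂ _
  exact (ContDiffAt.comp (g := Ring.inverse) q hinv hsub).clm_apply contDiffAt_const

/-- Continuous complex functions on `[0, ℓ]`, the coefficients `q` of the equations `u'' = q u`. -/
abbrev Coeff (ℓ : ℝ) : Type := C(Set.Icc (0 : ℝ) ℓ, ℂ)

section InitialValueProblem

variable {ℓ : ℝ}

/-- The exponential weight `e^{cx}`. Conjugation by it makes the primitive operator small. -/
noncomputable def weight (ℓ c : ℝ) : (Coeff ℓ)ˣ where
  val := ⟨fun x => (Real.exp (c * x) : ℂ), by fun_prop⟩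
  inv := ⟨fun x => (Real.exp (-(c * x)) : ℂ), by fun_prop⟩
  val_inv := by ext x; simp [← Complex.exp_add]
  inv_val := by ext x; simp [← Complex.exp_add]

variable [Fact (0 ≤ ℓ)]

lemma norm_IccExtendCM_le (f : Coeff ℓ) (x : ℝ) : ‖IccExtendCM f x‖ ≤ ‖f‖ :=
  f.norm_coe_le_norm _

lemma norm_integral_IccExtendCM_le (f : Coeff ℓ) (x : Set.Icc 0 ℓ) :
    ‖∫ s in (0 : ℝ)..x, IccExtendCM f s‖ ≤ ℓ * ‖f‖ := by
  have hx : |(x : ℝ) - 0| ≤ ℓ := by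
    rw [sub_zero, abs_of_nonneg x.2.1]; exact x.2.2
  calc _ ≤ ‖f‖ * |(x : ℝ) - 0| :=
        intervalIntegral.norm_integral_le_of_norm_le_const fun s _ => norm_IccExtendCM_le f s
    _ ≤ ‖f‖ * ℓ := by gcongr
    _ = ℓ * ‖f‖ := mul_comm _ _

lemma continuous_integral_IccExtendCM (f : Coeff ℓ) :
    Continuous fun x : ℝ => ∫ s in (0 : ℝ)..x, IccExtendCM f s :=
  intervalIntegral.continuous_primitive
    (fun _ _ => (IccExtendCM f).continuous.intervalIntegrable _ _) 0

/-- The primitive that vanishes at `0`, as a bounded operator on `C([0, ℓ])`. -/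
noncomputable def primitiveL : Coeff ℓ →L[ℂ] Coeff ℓ :=
  LinearMap.mkContinuous
    { toFun := fun f => ⟨fun x => ∫ s in (0 : ℝ)..x, IccExtendCM f s,
        (continuous_integral_IccExtendCM f).comp continuous_subtype_val⟩
      map_add' := fun f g => by
        ext x
        exact intervalIntegral.integral_add ((IccExtendCM f).continuous.intervalIntegrable _ _)
          ((IccExtendCM g).continuous.intervalIntegrable _ _)
      map_smul' := fun c f => by
        ext x
        exact intervalIntegral.integral_smul c (IccExtendCM f) }
    ℓ
    (fun f => (ContinuousMap.norm_le _ (mul_nonneg Fact.out (norm_nonneg f))).2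
      (norm_integral_IccExtendCM_le f))

lemma primitiveL_apply (f : Coeff ℓ) (x : Set.Icc 0 ℓ) :
    primitiveL f x = ∫ s in (0 : ℝ)..x, IccExtendCM f s := rfl

lemma norm_weighted_integral_le {c : ℝ} (hc : c ≠ 0) (f : Coeff ℓ) (x : Set.Icc 0 ℓ) :
    ‖∫ s in (0 : ℝ)..x, IccExtendCM ((weight ℓ c).val * f) s‖
      ≤ ‖f‖ * ((Real.exp (c * x) - 1) / c) := by
  have hbound : ∀ s ∈ Set.Ioc 0 (x : ℝ),
      ‖IccExtendCM ((weight ℓ c).val * f) s‖ ≤ ‖f‖ * Real.exp (c * s) := by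
    intro s hs
    rw [IccExtendCM_of_mem ⟨hs.1.le, hs.2.trans x.2.2⟩, ContinuousMap.mul_apply, norm_mul, mul_comm]
    gcongr
    · exact f.norm_coe_le_norm _
    · simp [weight, -Complex.ofReal_exp]
  calc ‖∫ s in (0 : ℝ)..x, IccExtendCM ((weight ℓ c).val * f) s‖
      ≤ ∫ s in (0 : ℝ)..x, ‖f‖ * Real.exp (c * s) :=
        intervalIntegral.norm_integral_le_of_norm_le x.2.1 (Filter.Eventually.of_forall hbound)
          ((by fun_prop : Continuous fun s : ℝ => ‖f‖ * Real.exp (c * s)).intervalIntegrable _ _)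
    _ = ‖f‖ * ((Real.exp (c * x) - 1) / c) := by
        rw [intervalIntegral.integral_const_mul,
          intervalIntegral.integral_comp_mul_left (fun s => Real.exp s) hc, integral_exp]
        simp [div_eq_inv_mul]

lemma norm_conjMul_weight_primitiveL_le {c : ℝ} (hc : 0 < c) :
    ‖conjMul (weight ℓ c) primitiveL‖ ≤ 1 / c := by
  refine ContinuousLinearMap.opNorm_le_bound _ (by positivity) fun f => ?_
  refine (ContinuousMap.norm_le _ (by positivity)).2 fun x => ?_
  have happly : conjMul (weight ℓ c) primitiveL f x
      = Real.exp (-(c * x)) * ∫ s in (0 : ℝ)..x, IccExtendCM ((weight ℓ c).val * f) s := rfl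
  rw [happly, norm_mul, Complex.norm_real, Real.norm_of_nonneg (Real.exp_pos _).le]
  calc Real.exp (-(c * x)) * ‖∫ s in (0 : ℝ)..x, IccExtendCM ((weight ℓ c).val * f) s‖
      ≤ Real.exp (-(c * x)) * (‖f‖ * ((Real.exp (c * x) - 1) / c)) := by
        gcongr; exact norm_weighted_integral_le hc.ne' f x
    _ = ‖f‖ / c * (Real.exp (-(c * x)) * Real.exp (c * x) - Real.exp (-(c * x))) := by ring
    _ = ‖f‖ / c * (1 - Real.exp (-(c * x))) := by rw [← Real.exp_add]; simp
    _ ≤ ‖f‖ / c * 1 := by gcongr; linarith [Real.exp_pos (-(c * x))]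
    _ = 1 / c * ‖f‖ := by ring

lemma isUnit_one_sub_volterra_primitiveL (q : Coeff ℓ) : IsUnit (1 - volterra primitiveL q) := by
  refine isUnit_one_sub_volterra (fun ε hε => ⟨weight ℓ (1 / ε), ?_⟩) q
  simpa using norm_conjMul_weight_primitiveL_le (ℓ := ℓ) (one_div_pos.2 hε)

/-- The coordinate function `x ↦ x` on `[0, ℓ]`. -/
noncomputable def coord : Coeff ℓ := ⟨fun x => ((x : ℝ) : ℂ), by fun_prop⟩

/-- The solution of `u'' = q u`, `u(0) = a`, `u'(0) = b`, as an element of `C([0, ℓ])`. -/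
noncomputable def ivp (a b : ℂ) (q : Coeff ℓ) : Coeff ℓ :=
  Ring.inverse (1 - volterra primitiveL q) (a • 1 + b • coord)

/-- The derivative of the solution `ivp a b q`. -/
noncomputable def ivpDeriv (a b : ℂ) (q : Coeff ℓ) : Coeff ℓ :=
  b • 1 + primitiveL (q * ivp a b q)

lemma contDiff_ivp (a b : ℂ) : ContDiff ℂ 1 (ivp a b : Coeff ℓ → Coeff ℓ) :=
  contDiff_inverse_one_sub_apply isUnit_one_sub_volterra_primitiveL _

lemma contDiff_ivpDeriv (a b : ℂ) : ContDiff ℂ 1 (ivpDeriv a b : Coeff ℓ → Coeff ℓ) :=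
  contDiff_const.add (primitiveL.contDiff.comp (contDiff_id.mul (contDiff_ivp a b)))

lemma primitiveL_smul_one (b : ℂ) : primitiveL (b • (1 : Coeff ℓ)) = b • coord := by
  ext x
  have hconst : ∀ s, IccExtendCM (b • (1 : Coeff ℓ)) s = b := fun s => by
    simp [IccExtendCM]
  rw [primitiveL_apply]
  simp only [hconst]
  simp [coord, mul_comm]

lemma eq_ivp_iff {a b : ℂ} {q u : Coeff ℓ} :
    u = ivp a b q ↔ u = a • 1 + primitiveL (b • 1 + primitiveL (q * u)) := by
  have hequiv : u = ivp a b q ↔ (1 - volterra primitiveL q) u = a • 1 + b • coord := by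
    constructor
    · rintro rfl
      exact DFunLike.congr_fun (Ring.mul_inverse_cancel _ (isUnit_one_sub_volterra_primitiveL q)) _
    · intro h
      rw [ivp, ← h]
      exact (DFunLike.congr_fun
        (Ring.inverse_mul_cancel _ (isUnit_one_sub_volterra_primitiveL q)) u).symm
  rw [hequiv, map_add, primitiveL_smul_one, ← add_assoc]
  exact sub_eq_iff_eq_add

lemma ivp_eq (a b : ℂ) (q : Coeff ℓ) : ivp a b q = a • 1 + primitiveL (ivpDeriv a b q) :=
  eq_ivp_iff.1 rfl

/-- The solution of `u'' = q u`, `u(0) = a`, `u'(0) = b` as a function on the line; only its values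
on `[0, ℓ]` matter. -/
noncomputable def sol (a b : ℂ) (q : Coeff ℓ) (x : ℝ) : ℂ :=
  a + ∫ s in (0 : ℝ)..x, IccExtendCM (ivpDeriv a b q) s

/-- The derivative of `sol` on `[0, ℓ]`. -/
noncomputable def dsol (a b : ℂ) (q : Coeff ℓ) (x : ℝ) : ℂ :=
  b + ∫ s in (0 : ℝ)..x, IccExtendCM (q * ivp a b q) s

lemma sol_coe (a b : ℂ) (q : Coeff ℓ) (x : Set.Icc 0 ℓ) : sol a b q x = ivp a b q x := by
  rw [ivp_eq]; simp [sol, primitiveL_apply]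

lemma dsol_coe (a b : ℂ) (q : Coeff ℓ) (x : Set.Icc 0 ℓ) : dsol a b q x = ivpDeriv a b q x := by
  rw [ivpDeriv]; simp [dsol, primitiveL_apply]

lemma sol_zero (a b : ℂ) (q : Coeff ℓ) : sol a b q 0 = a := by simp [sol]

lemma dsol_zero (a b : ℂ) (q : Coeff ℓ) : dsol a b q 0 = b := by simp [dsol]

lemma hasDerivAt_sol (a b : ℂ) (q : Coeff ℓ) {x : ℝ} (hx : x ∈ Set.Icc 0 ℓ) :
    HasDerivAt (sol a b q) (dsol a b q x) x := by
  have h := ((IccExtendCM (ivpDeriv a b q)).continuous.integral_hasStrictDerivAt 0 x).hasDerivAt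
  rw [IccExtendCM_of_mem hx, ← dsol_coe] at h
  exact h.const_add a

lemma hasDerivAt_dsol (a b : ℂ) (q : Coeff ℓ) {x : ℝ} (hx : x ∈ Set.Icc 0 ℓ) :
    HasDerivAt (dsol a b q) (IccExtendCM q x * sol a b q x) x := by
  have h := ((IccExtendCM (q * ivp a b q)).continuous.integral_hasStrictDerivAt 0 x).hasDerivAt
  rw [IccExtendCM_of_mem hx, ContinuousMap.mul_apply, ← sol_coe, ← IccExtendCM_of_mem hx] at h
  exact h.const_add b

lemma continuous_sol (a b : ℂ) (q : Coeff ℓ) : Continuous (sol a b q) :=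
  continuous_const.add (continuous_integral_IccExtendCM _)

lemma smul_ivp (a b c : ℂ) (q : Coeff ℓ) : c • ivp a b q = ivp (c * a) (c * b) q := by
  rw [ivp, ivp, ← map_smul]
  congr 1
  ext x
  simp [mul_add, mul_assoc]

lemma mul_sol (a b c : ℂ) (q : Coeff ℓ) (x : Set.Icc 0 ℓ) :
    c * sol a b q x = sol (c * a) (c * b) q x := by
  rw [sol_coe, sol_coe, ← smul_ivp]; rfl

lemma mul_dsol (a b c : ℂ) (q : Coeff ℓ) (x : Set.Icc 0 ℓ) :
    c * dsol a b q x = dsol (c * a) (c * b) q x := by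
  rw [dsol_coe, dsol_coe, ivpDeriv, ivpDeriv, ← smul_ivp, mul_smul_comm, map_smul]
  simp [mul_add]

/-- `ψ` is a classical solution of `ψ'' = q ψ` on `[0, ℓ]` with derivative `dψ`; the derivatives at
the end points are one-sided. -/
def IsSolution (q : Coeff ℓ) (ψ dψ : ℝ → ℂ) : Prop :=
  (∀ x ∈ Set.Icc 0 ℓ, HasDerivWithinAt ψ (dψ x) (Set.Icc 0 ℓ) x) ∧
    ∀ x ∈ Set.Icc 0 ℓ, HasDerivWithinAt dψ (IccExtendCM q x * ψ x) (Set.Icc 0 ℓ) x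

lemma isSolution_sol (a b : ℂ) (q : Coeff ℓ) : IsSolution q (sol a b q) (dsol a b q) :=
  ⟨fun _ hx => (hasDerivAt_sol a b q hx).hasDerivWithinAt,
    fun _ hx => (hasDerivAt_dsol a b q hx).hasDerivWithinAt⟩

lemma eq_add_primitiveL_of_hasDerivWithinAt {f f' : ℝ → ℂ}
    (hf : ∀ x ∈ Set.Icc 0 ℓ, HasDerivWithinAt f (f' x) (Set.Icc 0 ℓ) x)
    (g : Coeff ℓ) (hg : ∀ x : Set.Icc 0 ℓ, g x = f' x) (x : Set.Icc 0 ℓ) :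
    f x = f 0 + primitiveL g x := by
  have hsub : Set.Icc (0 : ℝ) x ⊆ Set.Icc 0 ℓ := Set.Icc_subset_Icc_right x.2.2
  have h := intervalIntegral.integral_eq_sub_of_hasDerivAt_of_le (f := f) (f' := IccExtendCM g)
    x.2.1 (fun y hy => ((hf y (hsub hy)).continuousWithinAt).mono hsub)
    (fun y hy => by
      have hy' : y ∈ Set.Icc 0 ℓ := hsub (Set.Ioo_subset_Icc_self hy)
      rw [IccExtendCM_of_mem hy', hg]
      exact (hf y hy').hasDerivAt (Icc_mem_nhds hy.1 (hy.2.trans_le x.2.2)))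
    ((IccExtendCM g).continuous.intervalIntegrable _ _)
  rw [primitiveL_apply, h, add_sub_cancel]

lemma IsSolution.eq_sol {q : Coeff ℓ} {ψ dψ : ℝ → ℂ} (h : IsSolution q ψ dψ) {x : ℝ}
    (hx : x ∈ Set.Icc 0 ℓ) : ψ x = sol (ψ 0) (dψ 0) q x ∧ dψ x = dsol (ψ 0) (dψ 0) q x := by
  let u : Coeff ℓ := ⟨fun x => ψ x, continuousOn_iff_continuous_domRestrict.1
    fun x hx => (h.1 x hx).continuousWithinAt⟩
  let v : Coeff ℓ := ⟨fun x => dψ x, continuousOn_iff_continuous_domRestrict.1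
    fun x hx => (h.2 x hx).continuousWithinAt⟩
  have hu : u = ψ 0 • 1 + primitiveL v := by
    ext x
    change ψ x = ψ 0 * 1 + primitiveL v x
    rw [mul_one]
    exact eq_add_primitiveL_of_hasDerivWithinAt h.1 v (fun _ => rfl) x
  have hv : v = dψ 0 • 1 + primitiveL (q * u) := by
    ext x
    change dψ x = dψ 0 * 1 + primitiveL (q * u) x
    rw [mul_one]
    exact eq_add_primitiveL_of_hasDerivWithinAt h.2 (q * u)
      (fun y => by rw [IccExtendCM_of_mem y.2]; rfl) x
  have hu' : u = ivp (ψ 0) (dψ 0) q := eq_ivp_iff.2 (by rw [← hv, ← hu])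
  constructor
  · rw [sol_coe _ _ _ ⟨x, hx⟩, ← hu']; rfl
  · rw [dsol_coe _ _ _ ⟨x, hx⟩, ivpDeriv, ← hu', ← hv]; rfl

end InitialValueProblem

/-! ### The characteristic function -/

/-- The value at `0` of the normalized solution satisfying the boundary condition there. -/
def BoundaryCondition.initVal : BoundaryCondition → ℂ
  | .dirichlet => 0
  | .neumann => 1

/-- The slope at `0` of the normalized solution satisfying the boundary condition there. -/
def BoundaryCondition.initSlope : BoundaryCondition → ℂ
  | .dirichlet => 1
  | .neumann => 0

section CharacteristicFunction

variable {ℓ : ℝ} [Fact (0 ≤ ℓ)]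

/-- The normalized solution of `u'' = q u` satisfying the boundary condition at `0`. -/
noncomputable abbrev bsol (bc : BoundaryCondition) : Coeff ℓ → ℝ → ℂ :=
  sol bc.initVal bc.initSlope

/-- The derivative of `bsol`. -/
noncomputable abbrev dbsol (bc : BoundaryCondition) : Coeff ℓ → ℝ → ℂ :=
  dsol bc.initVal bc.initSlope

/-- The characteristic function of the boundary value problem `u'' = q u` on `[0, ℓ]`: it measures
the failure of the boundary condition at `ℓ` for the solution satisfying the one at `0`. -/
noncomputable def charFn : BoundaryCondition → Coeff ℓ → ℂ
  | .dirichlet, q => bsol .dirichlet q ℓ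
  | .neumann, q => dbsol .neumann q ℓ

lemma contDiff_charFn (bc : BoundaryCondition) :
    ContDiff ℂ 1 (charFn bc : Coeff ℓ → ℂ) := by
  let evalEnd : Coeff ℓ →L[ℂ] ℂ := ContinuousMap.evalCLM ℂ ⊤
  cases bc with
  | dirichlet =>
    have h : charFn .dirichlet = fun q : Coeff ℓ => evalEnd (ivp 0 1 q) :=
      funext fun q => sol_coe 0 1 q ⊤
    exact h ▸ evalEnd.contDiff.comp (contDiff_ivp 0 1)
  | neumann =>
    have h : charFn .neumann = fun q : Coeff ℓ => evalEnd (ivpDeriv 1 0 q) :=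
      funext fun q => dsol_coe 1 0 q ⊤
    exact h ▸ evalEnd.contDiff.comp (contDiff_ivpDeriv 1 0)

lemma differentiable_charFn (bc : BoundaryCondition) :
    Differentiable ℂ (charFn bc : Coeff ℓ → ℂ) :=
  (contDiff_charFn bc).differentiable one_ne_zero

end CharacteristicFunction

instance fact_zero_le_pi : Fact ((0 : ℝ) ≤ Real.pi) := ⟨Real.pi_pos.le⟩

lemma exists_bsol_ne_zero (bc : BoundaryCondition) (q : Coeff Real.pi) :
    ∃ η ∈ Set.Icc 0 Real.pi, bsol bc q η ≠ 0 := by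
  by_contra! hz
  have hi : ivp bc.initVal bc.initSlope q = 0 := by
    ext x; rw [← sol_coe]; exact hz x x.2
  have hval : bc.initVal = 0 := by
    rw [← sol_zero bc.initVal bc.initSlope q]; exact hz 0 ⟨le_rfl, Real.pi_pos.le⟩
  have hslope : bc.initSlope = 0 := by
    have hcoord := ivp_eq bc.initVal bc.initSlope q
    rw [ivpDeriv, hi, hval, mul_zero, map_zero, add_zero, primitiveL_smul_one] at hcoord
    simpa [coord, Real.pi_ne_zero] using (DFunLike.congr_fun hcoord ⊤).symm
  cases bc with
  | dirichlet => exact one_ne_zero hslope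
  | neumann => exact one_ne_zero hval

lemma IsSolution.eq_const_mul_bsol {bc : BoundaryCondition} {q : Coeff Real.pi} {ψ dψ : ℝ → ℂ}
    (h : IsSolution q ψ dψ) (hbc : bc.Holds ψ dψ) :
    ∃ c : ℂ, ∀ x ∈ Set.Icc 0 Real.pi, ψ x = c * bsol bc q x ∧ dψ x = c * dbsol bc q x := by
  obtain ⟨c, hval, hslope⟩ : ∃ c, ψ 0 = c * bc.initVal ∧ dψ 0 = c * bc.initSlope := by
    cases bc with
    | dirichlet => exact ⟨dψ 0, by simpa [BoundaryCondition.initVal] using hbc.1,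
        (mul_one _).symm⟩
    | neumann => exact ⟨ψ 0, (mul_one _).symm,
        by simpa [BoundaryCondition.initSlope] using hbc.1⟩
  refine ⟨c, fun x hx => ?_⟩
  rw [mul_sol _ _ _ q ⟨x, hx⟩, mul_dsol _ _ _ q ⟨x, hx⟩, ← hval, ← hslope]
  exact h.eq_sol hx

lemma holds_bsol_iff {bc : BoundaryCondition} {q : Coeff Real.pi} :
    bc.Holds (bsol bc q) (dbsol bc q) ↔ charFn bc q = 0 := by
  cases bc with
  | dirichlet => exact and_iff_right (sol_zero _ _ _)
  | neumann => exact and_iff_right (dsol_zero _ _ _)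

lemma holds_const_mul_iff {bc : BoundaryCondition} {c : ℂ} (hc : c ≠ 0) {ψ dψ : ℝ → ℂ} :
    bc.Holds (fun x => c * ψ x) (fun x => c * dψ x) ↔ bc.Holds ψ dψ := by
  cases bc <;> simp [BoundaryCondition.Holds, hc]

lemma holds_congr {bc : BoundaryCondition} {ψ dψ φ dφ : ℝ → ℂ}
    (h : ∀ x ∈ Set.Icc 0 Real.pi, ψ x = φ x ∧ dψ x = dφ x) :
    bc.Holds ψ dψ ↔ bc.Holds φ dφ := by
  have h0 := h 0 ⟨le_rfl, Real.pi_pos.le⟩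
  have hpi := h Real.pi ⟨Real.pi_pos.le, le_rfl⟩
  cases bc <;> simp [BoundaryCondition.Holds, h0, hpi]

lemma charFn_eq_zero_iff (bc : BoundaryCondition) (q : Coeff Real.pi) :
    charFn bc q = 0 ↔ ∃ ψ dψ : ℝ → ℂ,
      IsSolution q ψ dψ ∧ bc.Holds ψ dψ ∧ ∃ η ∈ Set.Icc 0 Real.pi, ψ η ≠ 0 := by
  constructor
  · intro h
    exact ⟨bsol bc q, dbsol bc q, isSolution_sol _ _ q, holds_bsol_iff.2 h,
      exists_bsol_ne_zero bc q⟩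
  · rintro ⟨ψ, dψ, hψ, hbc, η, hη, hne⟩
    obtain ⟨c, hc⟩ := hψ.eq_const_mul_bsol hbc
    have hc0 : c ≠ 0 := by
      rintro rfl
      exact hne (by rw [(hc η hη).1, zero_mul])
    exact holds_bsol_iff.1 ((holds_const_mul_iff hc0).1 ((holds_congr hc).1 hbc))

/-- The unperturbed potential `γ₁ cos η + γ₂ cos 2η` on `[0, π]`. -/
noncomputable def basePot (γ₁ γ₂ : ℝ) : Coeff Real.pi :=
  ⟨fun x => ((γ₁ * Real.cos x + γ₂ * Real.cos (2 * x) : ℝ) : ℂ), by fun_prop⟩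

/-- The perturbing potential `1 + cos 2η` on `[0, π]`. -/
noncomputable def pertPot : Coeff Real.pi :=
  ⟨fun x => ((1 + Real.cos (2 * x) : ℝ) : ℂ), by fun_prop⟩

/-- The coefficient of `ψ` in the eigenvalue equation written as `ψ'' = (V + β W - λ) ψ`. -/
noncomputable def hillCoeff (γ₁ γ₂ : ℝ) (β lam : ℂ) : Coeff Real.pi :=
  basePot γ₁ γ₂ + β • pertPot - lam • 1

lemma IccExtendCM_hillCoeff (γ₁ γ₂ : ℝ) (β lam : ℂ) {x : ℝ} (hx : x ∈ Set.Icc 0 Real.pi) :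
    IccExtendCM (hillCoeff γ₁ γ₂ β lam) x = potential γ₁ γ₂ β x - lam := by
  rw [IccExtendCM_of_mem hx]
  simp [hillCoeff, basePot, pertPot, potential]

lemma isEigenvalue_iff (bc : BoundaryCondition) (γ₁ γ₂ : ℝ) (β lam : ℂ) :
    IsEigenvalue bc γ₁ γ₂ β lam ↔ charFn bc (hillCoeff γ₁ γ₂ β lam) = 0 := by
  have hderiv : ∀ ψ dψ : ℝ → ℂ, IsSolution (hillCoeff γ₁ γ₂ β lam) ψ dψ ↔
      (∀ η ∈ Set.Icc 0 Real.pi, HasDerivWithinAt ψ (dψ η) (Set.Icc 0 Real.pi) η) ∧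
      ∀ η ∈ Set.Icc 0 Real.pi,
        HasDerivWithinAt dψ ((potential γ₁ γ₂ β η - lam) * ψ η) (Set.Icc 0 Real.pi) η :=
    fun ψ dψ => and_congr_right fun _ => forall₂_congr fun η hη => by
      rw [IccExtendCM_hillCoeff γ₁ γ₂ β lam hη]
  simp only [charFn_eq_zero_iff, IsEigenvalue, hderiv, and_assoc]

/-! ### Holomorphic families of functions and of fixed points -/

lemma map_wedgeIntegral {E F : Type*} [NormedAddCommGroup E] [NormedSpace ℂ E] [CompleteSpace E]
    [NormedAddCommGroup F] [NormedSpace ℂ F] [CompleteSpace F] (L : E →L[ℂ] F) {f : ℂ → E}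
    {z w : ℂ} (hf : ContinuousOn f (Complex.Rectangle z w)) :
    L (Complex.wedgeIntegral z w f) = Complex.wedgeIntegral z w (L ∘ f) := by
  have hre : IntervalIntegrable (fun x : ℝ => f (x + z.im * Complex.I)) MeasureTheory.volume
      z.re w.re :=
    (hf.comp (by fun_prop) fun x hx => ⟨by simpa using hx, by simp⟩).intervalIntegrable
  have him : IntervalIntegrable (fun y : ℝ => f (w.re + y * Complex.I)) MeasureTheory.volume
      z.im w.im :=
    (hf.comp (by fun_prop) fun y hy => ⟨by simp, by simpa using hy⟩).intervalIntegrable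
  rw [Complex.wedgeIntegral, map_add, map_smul, ← L.intervalIntegral_comp_comm hre,
    ← L.intervalIntegral_comp_comm him]
  rfl

lemma differentiableOn_continuousMap {K : Type*} [TopologicalSpace K] [CompactSpace K] {U : Set ℂ}
    (hU : IsOpen U) {F : ℂ → C(K, ℂ)}
    (hcont : ContinuousOn F U) (hd : ∀ t, DifferentiableOn ℂ (fun e => F e t) U) :
    DifferentiableOn ℂ F U := by
  -- Morera: the integrals of `F` over rectangles vanish because they do after evaluation at `t`.
  refine (Complex.isConservativeOn_and_continuousOn_iff_isDifferentiableOn hU).1 ⟨?_, hcont⟩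
  intro z w hzw
  have hwz : Complex.Rectangle w z ⊆ U := by
    rwa [Complex.Rectangle, Set.uIcc_comm, Set.uIcc_comm w.im]
  ext t
  have heval := (hd t).isConservativeOn z w hzw
  have hzw' := map_wedgeIntegral (ContinuousMap.evalCLM ℂ t) (hcont.mono hzw)
  have hwz' := map_wedgeIntegral (ContinuousMap.evalCLM ℂ t) (hcont.mono hwz)
  exact hzw'.trans (heval.trans (congrArg Neg.neg hwz'.symm))

section Substitution

variable {K : Type*} [TopologicalSpace K] {φ : ℂ → ℂ → ℂ} {U S : Set ℂ}

/-- Substitution of a continuous function `c` into a family `φ e` of functions: `t ↦ φ e (c t)`.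
The junk value is `0` if this is not continuous. -/
noncomputable def subst (φ : ℂ → ℂ → ℂ) (e : ℂ) (c : C(K, ℂ)) : C(K, ℂ) :=
  ContinuousMap.mkD (fun t => φ e (c t)) 0

lemma subst_apply (hφ : ContinuousOn (Function.uncurry φ) (U ×ˢ S)) {e : ℂ} (he : e ∈ U)
    {c : C(K, ℂ)} (hc : ∀ t, c t ∈ S) (t : K) : subst φ e c t = φ e (c t) :=
  ContinuousMap.mkD_apply_of_continuous <|
    hφ.comp_continuous (f := fun t => (e, c t)) (by fun_prop) fun t => ⟨he, hc t⟩

variable [CompactSpace K]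

lemma continuousOn_subst {X : Type*} [TopologicalSpace X] {s : Set X} {e : X → ℂ} {c : X → C(K, ℂ)}
    (hφ : ContinuousOn (Function.uncurry φ) (U ×ˢ S)) (he : ContinuousOn e s)
    (hc : ContinuousOn c s) (heU : Set.MapsTo e s U) (hcS : ∀ x ∈ s, ∀ t, c x t ∈ S) :
    ContinuousOn (fun x => subst φ (e x) (c x)) s := by
  rw [continuousOn_iff_continuous_domRestrict] at he hc ⊢
  refine ContinuousMap.continuous_of_continuous_uncurry _ ?_
  have heval : Continuous fun p : s × K => c p.1 p.2 :=
    (hc.comp continuous_fst).eval continuous_snd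
  refine (hφ.comp_continuous (f := fun p : s × K => (e p.1, c p.1 p.2))
    ((he.comp continuous_fst).prodMk heval) fun p => ⟨heU p.1.2, hcS _ p.1.2 _⟩).congr fun p => ?_
  exact (subst_apply hφ (heU p.1.2) (hcS _ p.1.2) p.2).symm

lemma differentiableOn_subst {V : Set ℂ} (hV : IsOpen V) {e : ℂ → ℂ} {c : ℂ → C(K, ℂ)}
    (hφ : ContinuousOn (Function.uncurry φ) (U ×ˢ S)) (he : ContinuousOn e V)
    (hc : ContinuousOn c V) (heU : Set.MapsTo e V U) (hcS : ∀ w ∈ V, ∀ t, c w t ∈ S)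
    (hd : ∀ t, DifferentiableOn ℂ (fun w => φ (e w) (c w t)) V) :
    DifferentiableOn ℂ (fun w => subst φ (e w) (c w)) V :=
  differentiableOn_continuousMap hV (continuousOn_subst hφ he hc heU hcS) fun t =>
    (hd t).congr fun w hw => subst_apply hφ (heU hw) (hcS w hw) t

end Substitution

lemma eq_of_lipschitzOnWith_lt_one {α : Type*} [MetricSpace α] {s : Set α} {f : α → α} {K : NNReal}
    (hK : K < 1) (hf : LipschitzOnWith K f s) {x y : α} (hx : x ∈ s) (hy : y ∈ s)
    (hfx : f x = x) (hfy : f y = y) : x = y := by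
  have h := hf.dist_le_mul x hx y hy
  rw [hfx, hfy] at h
  exact dist_le_zero.1 (by nlinarith [dist_nonneg (x := x) (y := y), NNReal.coe_lt_one.2 hK])

lemma differentiableOn_iterate_apply {E : Type*} [NormedAddCommGroup E] [NormedSpace ℂ E]
    {U : Set ℂ} {T : ℂ → E → E} {s : Set E} {x : E} (hx : x ∈ s)
    (hmaps : ∀ u ∈ U, Set.MapsTo (T u) s s)
    (hhol : ∀ g : ℂ → E, DifferentiableOn ℂ g U → Set.MapsTo g U s →
      DifferentiableOn ℂ (fun u => T u (g u)) U) (n : ℕ) :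
    DifferentiableOn ℂ (fun u => (T u)^[n] x) U := by
  induction n with
  | zero => exact differentiableOn_const x
  | succ n ih =>
    simp only [Function.iterate_succ_apply']
    exact hhol _ ih fun u hu => (hmaps u hu).iterate n hx

lemma exists_differentiableOn_fixedPoint {E : Type*} [NormedAddCommGroup E] [NormedSpace ℂ E]
    [CompleteSpace E] {U : Set ℂ} (hU : IsOpen U) {T : ℂ → E → E} {s : Set E} {K : NNReal}
    (hK : K < 1) (hs : IsClosed s) (hbdd : Bornology.IsBounded s) (hne : s.Nonempty)
    (hmaps : ∀ u ∈ U, Set.MapsTo (T u) s s) (hlip : ∀ u ∈ U, LipschitzOnWith K (T u) s)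
    (hhol : ∀ g : ℂ → E, DifferentiableOn ℂ g U → Set.MapsTo g U s →
      DifferentiableOn ℂ (fun u => T u (g u)) U) :
    ∃ g : ℂ → E, DifferentiableOn ℂ g U ∧ Set.MapsTo g U s ∧
      ∀ u ∈ U, ∀ x ∈ s, T u x = x ↔ x = g u := by
  obtain ⟨x₀, hx₀⟩ := hne
  have hfix : ∀ u, ∃ y, u ∈ U → y ∈ s ∧ T u y = y ∧
      ∀ n, edist ((T u)^[n] x₀) y ≤ edist x₀ (T u x₀) * (K : ℝ≥0∞) ^ n / (1 - K) := by
    intro u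
    by_cases hu : u ∈ U
    · obtain ⟨y, hy, hTy, -, hdist⟩ := ContractingWith.exists_fixedPoint' hs.isComplete
        (hmaps u hu) ⟨hK, (hlip u hu).mapsToRestrict (hmaps u hu)⟩ hx₀ (edist_ne_top _ _)
      exact ⟨y, fun _ => ⟨hy, hTy, hdist⟩⟩
    · exact ⟨x₀, fun h => absurd h hu⟩
  choose g hg using hfix
  have hunif : TendstoUniformlyOn (fun n u => (T u)^[n] x₀) g atTop U := by
    have hlim : Tendsto (fun n : ℕ => Metric.ediam s * (K : ℝ≥0∞) ^ n / (1 - K)) atTop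
        (𝓝 0) := by
      have hpow := ENNReal.tendsto_pow_atTop_nhds_zero_of_lt_one (ENNReal.coe_lt_one_iff.2 hK)
      simpa using ENNReal.Tendsto.div_const
        (ENNReal.Tendsto.const_mul hpow (Or.inr hbdd.ediam_ne_top))
        (Or.inr (tsub_pos_iff_lt.2 (ENNReal.coe_lt_one_iff.2 hK)).ne')
    rw [EMetric.tendstoUniformlyOn_iff]
    intro ε hε
    filter_upwards [hlim.eventually_lt_const hε] with n hn u hu
    rw [edist_comm]
    refine ((hg u hu).2.2 n).trans_lt (lt_of_le_of_lt ?_ hn)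
    gcongr
    exact Metric.edist_le_ediam_of_mem hx₀ (hmaps u hu hx₀)
  refine ⟨g, ?_, fun u hu => (hg u hu).1, fun u hu x hx => ⟨fun h => ?_, ?_⟩⟩
  · exact hunif.tendstoLocallyUniformlyOn.differentiableOn
      (Eventually.of_forall (differentiableOn_iterate_apply hx₀ hmaps hhol)) hU
  · exact eq_of_lipschitzOnWith_lt_one hK (hlip u hu) hx (hg u hu).1 h (hg u hu).2.1
  · rintro rfl
    exact (hg u hu).2.1

lemma lipschitzOnWith_closedBall {f : ℂ → ℂ} {c : ℂ} {r R : ℝ} {C K : NNReal} (hrR : r < R)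
    (hf : DifferentiableOn ℂ f (Metric.ball c R)) (hC : ∀ z ∈ Metric.ball c R, ‖f z‖ ≤ C)
    (hK : 2 * C / (R - r) ≤ K) : LipschitzOnWith K f (Metric.closedBall c r) := by
  have hsub : ∀ z ∈ Metric.closedBall c r, Metric.ball z (R - r) ⊆ Metric.ball c R :=
    fun z hz => Metric.ball_subset_ball' (by linarith [Metric.mem_closedBall.1 hz])
  refine (convex_closedBall c r).lipschitzOnWith_of_nnnorm_deriv_le (𝕜 := ℂ) ?_ ?_
  · exact fun z hz => hf.differentiableAt
      (Metric.isOpen_ball.mem_nhds (Metric.closedBall_subset_ball hrR hz))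
  · intro z hz
    refine (Complex.norm_deriv_le_div_of_mapsTo_ball (hf.mono (hsub z hz)) (R₂ := 2 * C) ?_
      (sub_pos.2 hrR)).trans hK
    intro y hy
    rw [Metric.mem_closedBall, dist_eq_norm]
    calc ‖f y - f z‖ ≤ ‖f y‖ + ‖f z‖ := norm_sub_le _ _
      _ ≤ 2 * C := by
        linarith [hC y (hsub z hz hy), hC z (Metric.closedBall_subset_ball hrR hz)]

/-! ### Sturm theory for real coefficients -/

/-- The spectral shift `q - λ`. -/
noncomputable def shift {ℓ : ℝ} (q : Coeff ℓ) (lam : ℂ) : Coeff ℓ := q - lam • 1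

/-- The coefficient takes real values. -/
def IsRealCoeff {ℓ : ℝ} (q : Coeff ℓ) : Prop := ∀ x, (q x).im = 0

lemma continuous_shift {ℓ : ℝ} (q : Coeff ℓ) : Continuous (shift q) := by unfold shift; fun_prop

lemma isRealCoeff_shift {ℓ : ℝ} {q : Coeff ℓ} (hq : IsRealCoeff q) (lam : ℝ) :
    IsRealCoeff (shift q lam) := fun x => by simp [shift, hq x]

lemma BoundaryCondition.initVal_im (bc : BoundaryCondition) : bc.initVal.im = 0 := by
  cases bc <;> simp [initVal]

lemma BoundaryCondition.initSlope_im (bc : BoundaryCondition) : bc.initSlope.im = 0 := by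
  cases bc <;> simp [initSlope]

/-- The initial point of the Prüfer plane curve. -/
noncomputable def BoundaryCondition.start (bc : BoundaryCondition) : ℂ :=
  bc.initSlope + Complex.I * bc.initVal

lemma BoundaryCondition.norm_start (bc : BoundaryCondition) : ‖bc.start‖ = 1 := by
  cases bc <;> simp [start, initSlope, initVal]

section Prufer

variable {ℓ : ℝ} [Fact (0 ≤ ℓ)]

lemma wronskian (a₁ b₁ a₂ b₂ : ℂ) (q₁ q₂ : Coeff ℓ) (x : Set.Icc 0 ℓ) :
    sol a₁ b₁ q₁ x * dsol a₂ b₂ q₂ x - dsol a₁ b₁ q₁ x * sol a₂ b₂ q₂ x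
      = (a₁ * b₂ - b₁ * a₂) + primitiveL ((q₂ - q₁) * ivp a₁ b₁ q₁ * ivp a₂ b₂ q₂) x := by
  have h := eq_add_primitiveL_of_hasDerivWithinAt
    (f := fun x => sol a₁ b₁ q₁ x * dsol a₂ b₂ q₂ x - dsol a₁ b₁ q₁ x * sol a₂ b₂ q₂ x)
    (fun y hy => (((hasDerivAt_sol a₁ b₁ q₁ hy).mul (hasDerivAt_dsol a₂ b₂ q₂ hy)).sub
      ((hasDerivAt_dsol a₁ b₁ q₁ hy).mul (hasDerivAt_sol a₂ b₂ q₂ hy))).hasDerivWithinAt)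
    ((q₂ - q₁) * ivp a₁ b₁ q₁ * ivp a₂ b₂ q₂)
    (fun y => by
      simp only [ContinuousMap.mul_apply, ContinuousMap.sub_apply, IccExtendCM_of_mem y.2, sol_coe]
      ring) x
  simpa only [sol_zero, dsol_zero] using h

lemma bsol_ne_zero_or_dbsol_ne_zero (bc : BoundaryCondition) (q : Coeff ℓ) (x : Set.Icc 0 ℓ) :
    bsol bc q x ≠ 0 ∨ dbsol bc q x ≠ 0 := by
  by_contra! h
  have hw := wronskian bc.initVal bc.initSlope (-bc.initSlope) bc.initVal q q x
  rw [show sol bc.initVal bc.initSlope q x = 0 from h.1,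
    show dsol bc.initVal bc.initSlope q x = 0 from h.2, sub_self] at hw
  simp only [zero_mul, map_zero, ContinuousMap.zero_apply] at hw
  cases bc <;> simp [BoundaryCondition.initVal, BoundaryCondition.initSlope] at hw

lemma IsSolution.conj {q : Coeff ℓ} (hq : IsRealCoeff q) {ψ dψ : ℝ → ℂ} (h : IsSolution q ψ dψ) :
    IsSolution q (fun x => star (ψ x)) fun x => star (dψ x) := by
  refine ⟨fun x hx => (h.1 x hx).star, fun x hx => ?_⟩
  have hreal : star (IccExtendCM q x) = IccExtendCM q x := by
    rw [IccExtendCM_of_mem hx]; exact Complex.conj_eq_iff_im.2 (hq _)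
  simpa only [star_mul', hreal] using (h.2 x hx).star

lemma IsRealCoeff.bsol_im {q : Coeff ℓ} (hq : IsRealCoeff q) (bc : BoundaryCondition) {x : ℝ}
    (hx : x ∈ Set.Icc 0 ℓ) : (bsol bc q x).im = 0 ∧ (dbsol bc q x).im = 0 := by
  have h := ((isSolution_sol bc.initVal bc.initSlope q).conj hq).eq_sol hx
  simp only [sol_zero, dsol_zero, Complex.star_def, Complex.conj_eq_iff_im.2 bc.initVal_im,
    Complex.conj_eq_iff_im.2 bc.initSlope_im, Complex.conj_eq_iff_im] at h
  exact h

/-- The Prüfer plane curve `u' + i u`. -/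
noncomputable def prufer (bc : BoundaryCondition) (q : Coeff ℓ) : Coeff ℓ :=
  ivpDeriv bc.initVal bc.initSlope q + Complex.I • ivp bc.initVal bc.initSlope q

/-- The derivative of the Prüfer plane curve. -/
noncomputable def pruferDeriv (bc : BoundaryCondition) (q : Coeff ℓ) : Coeff ℓ :=
  q * ivp bc.initVal bc.initSlope q + Complex.I • ivpDeriv bc.initVal bc.initSlope q

lemma prufer_apply (bc : BoundaryCondition) (q : Coeff ℓ) (x : Set.Icc 0 ℓ) :
    prufer bc q x = dbsol bc q x + Complex.I * bsol bc q x := by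
  simp [prufer, sol_coe, dsol_coe]

lemma continuous_prufer (bc : BoundaryCondition) :
    Continuous (prufer bc : Coeff ℓ → Coeff ℓ) :=
  (contDiff_ivpDeriv _ _).continuous.add ((contDiff_ivp _ _).continuous.const_smul Complex.I)

lemma continuous_pruferDeriv (bc : BoundaryCondition) :
    Continuous (pruferDeriv bc : Coeff ℓ → Coeff ℓ) :=
  (continuous_id.mul (contDiff_ivp _ _).continuous).add
    ((contDiff_ivpDeriv _ _).continuous.const_smul Complex.I)

lemma hasDerivAt_prufer (bc : BoundaryCondition) (q : Coeff ℓ) {x : ℝ} (hx : x ∈ Set.Icc 0 ℓ) :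
    HasDerivAt (fun x => dbsol bc q x + Complex.I * bsol bc q x) (pruferDeriv bc q ⟨x, hx⟩) x := by
  refine ((hasDerivAt_dsol bc.initVal bc.initSlope q hx).add
    ((hasDerivAt_sol bc.initVal bc.initSlope q hx).const_mul Complex.I)).congr_deriv ?_
  simp [pruferDeriv, IccExtendCM_of_mem hx, sol_coe _ _ _ ⟨x, hx⟩, dsol_coe _ _ _ ⟨x, hx⟩]

lemma IsRealCoeff.prufer_re {q : Coeff ℓ} (hq : IsRealCoeff q) (bc : BoundaryCondition)
    (x : Set.Icc 0 ℓ) : (prufer bc q x).re = (dbsol bc q x).re := by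
  simp [prufer_apply, (hq.bsol_im bc x.2).1]

lemma IsRealCoeff.prufer_im {q : Coeff ℓ} (hq : IsRealCoeff q) (bc : BoundaryCondition)
    (x : Set.Icc 0 ℓ) : (prufer bc q x).im = (bsol bc q x).re := by
  simp [prufer_apply, (hq.bsol_im bc x.2).2]

lemma IsRealCoeff.re_bsol_ne_zero_or {q : Coeff ℓ} (hq : IsRealCoeff q) (bc : BoundaryCondition)
    (x : Set.Icc 0 ℓ) : (bsol bc q x).re ≠ 0 ∨ (dbsol bc q x).re ≠ 0 := by
  have him := hq.bsol_im bc x.2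
  exact (bsol_ne_zero_or_dbsol_ne_zero bc q x).imp (mt fun h => Complex.ext h him.1)
    (mt fun h => Complex.ext h him.2)

lemma IsRealCoeff.prufer_ne_zero {q : Coeff ℓ} (hq : IsRealCoeff q) (bc : BoundaryCondition)
    (x : Set.Icc 0 ℓ) : prufer bc q x ≠ 0 := by
  intro h
  rcases hq.re_bsol_ne_zero_or bc x with hne | hne
  · exact hne (by rw [← hq.prufer_im, h, Complex.zero_im])
  · exact hne (by rw [← hq.prufer_re, h, Complex.zero_re])

/-- The logarithmic derivative of the Prüfer plane curve. -/
noncomputable def pruferRate (bc : BoundaryCondition) (q : Coeff ℓ) (x : ℝ) : ℂ :=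
  IccExtendCM (pruferDeriv bc q) x / IccExtendCM (prufer bc q) x

/-- A logarithm, vanishing at `0`, of the quotient of the Prüfer plane curve by its initial
point. -/
noncomputable def pruferLog (bc : BoundaryCondition) (q : Coeff ℓ) (x : ℝ) : ℂ :=
  ∫ s in (0 : ℝ)..x, pruferRate bc q s

/-- The number of half turns of the Prüfer plane curve on `[0, ℓ]`. -/
noncomputable def rot (bc : BoundaryCondition) (q : Coeff ℓ) : ℝ :=
  (pruferLog bc q ℓ).im / Real.pi

lemma pruferLog_end_im (bc : BoundaryCondition) (q : Coeff ℓ) :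
    (pruferLog bc q ℓ).im = rot bc q * Real.pi := by
  rw [rot, div_mul_cancel₀ _ Real.pi_ne_zero]

lemma continuous_IccExtendCM_uncurry {X : Type*} [TopologicalSpace X] {f : X → Coeff ℓ}
    (hf : Continuous f) : Continuous fun p : X × ℝ => IccExtendCM (f p.1) p.2 :=
  (hf.comp continuous_fst).eval ((continuous_projIcc (h := Fact.out)).comp continuous_snd)

lemma continuous_pruferRate_uncurry {X : Type*} [TopologicalSpace X] (bc : BoundaryCondition)
    {q : X → Coeff ℓ} (hq : Continuous q) (hr : ∀ t, IsRealCoeff (q t)) :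
    Continuous fun p : X × ℝ => pruferRate bc (q p.1) p.2 :=
  (continuous_IccExtendCM_uncurry ((continuous_pruferDeriv bc).comp hq)).div
    (continuous_IccExtendCM_uncurry ((continuous_prufer bc).comp hq))
    fun p => (hr p.1).prufer_ne_zero bc _

lemma continuous_rot {X : Type*} [TopologicalSpace X] (bc : BoundaryCondition) {q : X → Coeff ℓ}
    (hq : Continuous q) (hr : ∀ t, IsRealCoeff (q t)) : Continuous fun t => rot bc (q t) :=
  (Complex.continuous_im.comp
    (intervalIntegral.continuous_parametric_intervalIntegral_of_continuous'
      (continuous_pruferRate_uncurry bc hq hr) 0 ℓ)).div_const _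

lemma IsRealCoeff.hasDerivAt_pruferLog {q : Coeff ℓ} (hq : IsRealCoeff q)
    (bc : BoundaryCondition) (x : ℝ) : HasDerivAt (pruferLog bc q) (pruferRate bc q x) x :=
  (((continuous_pruferRate_uncurry bc continuous_const fun _ : Unit => hq).comp
    (Continuous.prodMk_right ())).integral_hasStrictDerivAt 0 x).hasDerivAt

lemma IsRealCoeff.prufer_eq_exp {q : Coeff ℓ} (hq : IsRealCoeff q) (bc : BoundaryCondition)
    (x : Set.Icc 0 ℓ) : prufer bc q x = bc.start * Complex.exp (pruferLog bc q x) := by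
  let f : ℝ → ℂ := fun y =>
    (dbsol bc q y + Complex.I * bsol bc q y) * Complex.exp (-pruferLog bc q y)
  have hf : ∀ y ∈ Set.Icc 0 ℓ, HasDerivAt f 0 y := by
    intro y hy
    refine ((hasDerivAt_prufer bc q hy).mul
      (hq.hasDerivAt_pruferLog bc y).neg.cexp).congr_deriv ?_
    have hne : prufer bc q ⟨y, hy⟩ ≠ 0 := hq.prufer_ne_zero bc ⟨y, hy⟩
    rw [← prufer_apply bc q ⟨y, hy⟩, pruferRate, IccExtendCM_of_mem hy, IccExtendCM_of_mem hy]
    simp only [Pi.neg_apply]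
    field_simp
    ring
  have hconst : f x = f 0 := constant_of_has_deriv_right_zero
    (fun y hy => (hf y hy).continuousAt.continuousWithinAt)
    (fun y hy => (hf y ⟨hy.1, hy.2.le⟩).hasDerivWithinAt) x x.2
  have hstart : f 0 = bc.start := by
    simp [f, pruferLog, sol_zero, dsol_zero, BoundaryCondition.start]
  rw [← hstart, ← hconst, prufer_apply, mul_assoc, ← Complex.exp_add, neg_add_cancel,
    Complex.exp_zero, mul_one]

lemma IsRealCoeff.charFn_eq {q : Coeff ℓ} (hq : IsRealCoeff q) (bc : BoundaryCondition) :
    ∃ c : ℝ, c ≠ 0 ∧ charFn bc q = ((c * Real.sin (rot bc q * Real.pi) : ℝ) : ℂ) := by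
  have hexp : prufer bc q ⊤ = bc.start * Complex.exp (pruferLog bc q ℓ) := hq.prufer_eq_exp bc ⊤
  have hre := hq.prufer_re bc ⊤
  have him := hq.prufer_im bc ⊤
  have hreal := hq.bsol_im bc (⊤ : Set.Icc 0 ℓ).2
  rw [hexp] at hre him
  cases bc with
  | dirichlet =>
    refine ⟨Real.exp (pruferLog .dirichlet q ℓ).re, (Real.exp_pos _).ne', ?_⟩
    refine Complex.ext ?_ hreal.1
    simp only [BoundaryCondition.start, BoundaryCondition.initSlope, BoundaryCondition.initVal,
      mul_zero, add_zero, one_mul, Complex.exp_im, pruferLog_end_im] at him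
    rw [Complex.ofReal_re, him]; rfl
  | neumann =>
    refine ⟨-Real.exp (pruferLog .neumann q ℓ).re, neg_ne_zero.2 (Real.exp_pos _).ne', ?_⟩
    refine Complex.ext ?_ hreal.2
    simp only [BoundaryCondition.start, BoundaryCondition.initSlope, BoundaryCondition.initVal,
      mul_one, zero_add, Complex.I_mul_re, Complex.exp_im, pruferLog_end_im] at hre
    rw [Complex.ofReal_re, neg_mul, hre]; rfl

lemma IsRealCoeff.charFn_eq_zero_iff {q : Coeff ℓ} (hq : IsRealCoeff q) (bc : BoundaryCondition) :
    charFn bc q = 0 ↔ ∃ j : ℤ, rot bc q = j := by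
  obtain ⟨c, hc, h⟩ := hq.charFn_eq bc
  rw [h, Complex.ofReal_eq_zero, mul_eq_zero, or_iff_right hc, Real.sin_eq_zero_iff]
  refine exists_congr fun j => ?_
  rw [eq_comm, mul_left_inj' Real.pi_ne_zero]

/-- The integral over `[0, ℓ]` of the product of the normalized solutions with spectral parameters
`lam` and `mu`. -/
noncomputable def solPairing (bc : BoundaryCondition) (q : Coeff ℓ) (lam mu : ℂ) : ℂ :=
  primitiveL (ivp bc.initVal bc.initSlope (shift q lam) *
    ivp bc.initVal bc.initSlope (shift q mu)) ⊤

lemma continuous_solPairing (bc : BoundaryCondition) (q : Coeff ℓ) :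
    Continuous fun p : ℂ × ℂ => solPairing bc q p.1 p.2 := by
  have hivp : Continuous fun lam => ivp bc.initVal bc.initSlope (shift q lam) :=
    (contDiff_ivp _ _).continuous.comp (continuous_shift q)
  exact (ContinuousMap.evalCLM ℂ ⊤).continuous.comp (primitiveL.continuous.comp
    ((hivp.comp continuous_fst).mul (hivp.comp continuous_snd)))

lemma wronskian_shift (bc : BoundaryCondition) (q : Coeff ℓ) (lam mu : ℂ) :
    bsol bc (shift q lam) ℓ * dbsol bc (shift q mu) ℓ
        - dbsol bc (shift q lam) ℓ * bsol bc (shift q mu) ℓ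
      = (lam - mu) * solPairing bc q lam mu := by
  have h := wronskian bc.initVal bc.initSlope bc.initVal bc.initSlope (shift q lam) (shift q mu) ⊤
  have hdiff : shift q mu - shift q lam = (lam - mu) • 1 := by
    ext x; simp [shift]
  rw [hdiff, smul_one_mul, smul_mul_assoc, map_smul, mul_comm bc.initVal, sub_self, zero_add] at h
  exact h

lemma IsRealCoeff.im_prufer_mul_star {q₁ q₂ : Coeff ℓ} (h₁ : IsRealCoeff q₁) (h₂ : IsRealCoeff q₂)
    (bc : BoundaryCondition) (x : Set.Icc 0 ℓ) :
    (prufer bc q₁ x * star (prufer bc q₂ x)).im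
      = (bsol bc q₁ x * dbsol bc q₂ x - dbsol bc q₁ x * bsol bc q₂ x).re := by
  simp only [Complex.mul_im, Complex.star_def, Complex.conj_re, Complex.conj_im, h₁.prufer_re,
    h₁.prufer_im, h₂.prufer_re, h₂.prufer_im, Complex.sub_re, Complex.mul_re,
    (h₁.bsol_im bc x.2).1, (h₁.bsol_im bc x.2).2]
  ring

lemma IsRealCoeff.im_prufer_mul_star_eq_sin {q₁ q₂ : Coeff ℓ} (h₁ : IsRealCoeff q₁)
    (h₂ : IsRealCoeff q₂) (bc : BoundaryCondition) (x : Set.Icc 0 ℓ) :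
    (prufer bc q₁ x * star (prufer bc q₂ x)).im = ‖prufer bc q₁ x‖ * ‖prufer bc q₂ x‖ *
      Real.sin ((pruferLog bc q₁ x).im - (pruferLog bc q₂ x).im) := by
  have hstart : bc.start * star bc.start = 1 := by
    rw [Complex.star_def, Complex.mul_conj, Complex.normSq_eq_norm_sq, bc.norm_start]; simp
  have hexp : prufer bc q₁ x * star (prufer bc q₂ x)
      = Complex.exp (pruferLog bc q₁ x + star (pruferLog bc q₂ x)) := by
    rw [h₁.prufer_eq_exp, h₂.prufer_eq_exp, star_mul', mul_mul_mul_comm, hstart, one_mul,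
      Complex.exp_add, Complex.star_def, Complex.exp_conj]
  rw [hexp, Complex.exp_im, h₁.prufer_eq_exp, h₂.prufer_eq_exp]
  simp [bc.norm_start, Complex.norm_exp, Real.exp_add, sub_eq_add_neg]

end Prufer

lemma IsRealCoeff.exists_solPairing_self {q : Coeff Real.pi} (hq : IsRealCoeff q)
    (bc : BoundaryCondition) (lam : ℝ) : ∃ c : ℝ, 0 < c ∧ solPairing bc q lam lam = c := by
  obtain ⟨x₀, hx₀, hne⟩ := exists_bsol_ne_zero bc (shift q lam)
  have hreal : ∀ x ∈ Set.Icc 0 Real.pi,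
      bsol bc (shift q lam) x = ((bsol bc (shift q lam) x).re : ℂ) := fun x hx =>
    Complex.ext rfl ((isRealCoeff_shift hq lam).bsol_im bc hx).1
  refine ⟨∫ x in (0 : ℝ)..Real.pi, (bsol bc (shift q lam) x).re ^ 2, ?_, ?_⟩
  · have hne' : (bsol bc (shift q lam) x₀).re ≠ 0 := fun h => hne (by rw [hreal x₀ hx₀, h]; rfl)
    exact intervalIntegral.integral_pos Real.pi_pos
      ((Complex.continuous_re.comp (continuous_sol _ _ _)).pow 2).continuousOn
      (fun x _ => sq_nonneg _) ⟨x₀, hx₀, by positivity⟩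
  · rw [solPairing, primitiveL_apply, ← intervalIntegral.integral_ofReal]
    refine intervalIntegral.integral_congr fun x hx => ?_
    have hx' : x ∈ Set.Icc 0 Real.pi := Set.uIcc_of_le Real.pi_pos.le ▸ hx
    simp only [IccExtendCM_of_mem hx', ContinuousMap.mul_apply, ← sol_coe]
    rw [Complex.ofReal_pow, ← hreal x hx', sq]

lemma hasDerivAt_of_sub_eq_mul {𝕜 : Type*} [NontriviallyNormedField 𝕜] {f C : 𝕜 → 𝕜} {a : 𝕜}
    (hC : ContinuousAt C a) (h : ∀ x, f x - f a = (x - a) * C x) : HasDerivAt f (C a) a := by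
  rw [hasDerivAt_iff_tendsto_slope]
  refine (hC.tendsto.mono_left nhdsWithin_le_nhds).congr' ?_
  filter_upwards [self_mem_nhdsWithin] with x hx
  rw [slope_def_field, h, mul_div_cancel_left₀ _ (sub_ne_zero.2 hx)]

lemma IsRealCoeff.exists_hasDerivAt_charFn {q : Coeff Real.pi} (hq : IsRealCoeff q)
    (bc : BoundaryCondition) {lam : ℝ} (h : charFn bc (shift q lam) = 0) :
    ∃ d : ℂ, d ≠ 0 ∧ HasDerivAt (fun mu : ℂ => charFn bc (shift q mu)) d lam := by
  obtain ⟨k, hk, hW⟩ : ∃ k : ℂ, k ≠ 0 ∧ ∀ mu : ℂ,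
      k * charFn bc (shift q mu) = (mu - lam) * solPairing bc q lam mu := by
    have hne := bsol_ne_zero_or_dbsol_ne_zero bc (shift q lam) ⊤
    have hwronskian := wronskian_shift bc q lam
    cases bc with
    | dirichlet =>
      have hsol : bsol .dirichlet (shift q lam) Real.pi = 0 := h
      refine ⟨dbsol .dirichlet (shift q lam) Real.pi, hne.resolve_left (not_not.2 h), fun mu => ?_⟩
      simp only [hsol] at hwronskian
      simp only [charFn]
      linear_combination -hwronskian mu
    | neumann =>
      have hsol : dbsol .neumann (shift q lam) Real.pi = 0 := h
      refine ⟨-bsol .neumann (shift q lam) Real.pi,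
        neg_ne_zero.2 (hne.resolve_right (not_not.2 h)), fun mu => ?_⟩
      simp only [hsol] at hwronskian
      simp only [charFn]
      linear_combination -hwronskian mu
  obtain ⟨c, hc, hself⟩ := hq.exists_solPairing_self bc lam
  refine ⟨solPairing bc q lam lam / k, div_ne_zero (by rw [hself]; exact_mod_cast hc.ne') hk, ?_⟩
  refine hasDerivAt_of_sub_eq_mul (C := fun mu => solPairing bc q lam mu / k)
    (((continuous_solPairing bc q).comp (Continuous.prodMk_right _)).div_const k).continuousAt
    fun mu => ?_
  rw [h, sub_zero, ← mul_div_assoc, ← hW mu, mul_div_cancel_left₀ _ hk]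

lemma hasDerivAt_of_sin_sub_eq_mul {f C : ℝ → ℝ} {a : ℝ} (hf : ContinuousAt f a)
    (hC : ContinuousAt C a) (h : ∀ x, Real.sin (f x - f a) = (x - a) * C x) :
    HasDerivAt f (C a) a := by
  have hsin : HasDerivAt (fun x => Real.sin (f x - f a)) (C a) a :=
    hasDerivAt_of_sub_eq_mul hC fun x => by simp [h]
  have harcsin : HasDerivAt (fun x => Real.arcsin (Real.sin (f x - f a)) + f a) (C a) a := by
    have hout : HasDerivAt Real.arcsin 1 (Real.sin (f a - f a)) := by
      simpa using Real.hasDerivAt_arcsin (x := 0) (by simp) (by simp)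
    simpa using (hout.comp a hsin).add_const (f a)
  have hsmall : Tendsto (fun x => f x - f a) (𝓝 a) (𝓝 0) := by
    simpa using hf.tendsto.sub_const (f a)
  refine harcsin.congr_of_eventuallyEq ?_
  filter_upwards [hsmall.eventually (Icc_mem_nhds (neg_lt_zero.2 Real.pi_div_two_pos)
    Real.pi_div_two_pos)] with x hx
  rw [Real.arcsin_sin hx.1 hx.2, sub_add_cancel]

lemma IsRealCoeff.sin_rot_sub_rot {q : Coeff Real.pi} (hq : IsRealCoeff q)
    (bc : BoundaryCondition) (lam mu : ℝ) :
    Real.sin (rot bc (shift q lam) * Real.pi - rot bc (shift q mu) * Real.pi)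
      = (lam - mu) * ((solPairing bc q lam mu).re /
        (‖prufer bc (shift q lam) ⊤‖ * ‖prufer bc (shift q mu) ⊤‖)) := by
  have hlam := isRealCoeff_shift hq lam
  have hmu := isRealCoeff_shift hq mu
  have hW := congrArg Complex.re (wronskian_shift bc q lam mu)
  have him := hlam.im_prufer_mul_star_eq_sin hmu bc ⊤
  rw [hlam.im_prufer_mul_star hmu, Set.Icc.coe_top, hW, ← Complex.ofReal_sub,
    Complex.re_ofReal_mul, pruferLog_end_im, pruferLog_end_im] at him
  have hpos : ‖prufer bc (shift q lam) ⊤‖ * ‖prufer bc (shift q mu) ⊤‖ ≠ 0 :=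
    mul_ne_zero (norm_ne_zero_iff.2 (hlam.prufer_ne_zero bc _))
      (norm_ne_zero_iff.2 (hmu.prufer_ne_zero bc _))
  rw [← mul_div_assoc, him, mul_div_cancel_left₀ _ hpos]

lemma IsRealCoeff.continuous_rot_shift {q : Coeff Real.pi} (hq : IsRealCoeff q)
    (bc : BoundaryCondition) : Continuous fun lam : ℝ => rot bc (shift q lam) :=
  continuous_rot bc ((continuous_shift q).comp Complex.continuous_ofReal) (isRealCoeff_shift hq)

lemma IsRealCoeff.strictMono_rot {q : Coeff Real.pi} (hq : IsRealCoeff q)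
    (bc : BoundaryCondition) : StrictMono fun lam : ℝ => rot bc (shift q lam) := by
  have hne : ∀ lam : ℝ, ‖prufer bc (shift q lam) ⊤‖ ≠ 0 := fun lam =>
    norm_ne_zero_iff.2 ((isRealCoeff_shift hq lam).prufer_ne_zero bc _)
  have hprufer : Continuous fun lam : ℝ => prufer bc (shift q lam) ⊤ :=
    (ContinuousMap.evalCLM ℂ ⊤).continuous.comp ((continuous_prufer bc).comp
      ((continuous_shift q).comp Complex.continuous_ofReal))
  have hmono : StrictMono fun lam : ℝ => rot bc (shift q lam) * Real.pi := by
    refine strictMono_of_deriv_pos fun mu => ?_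
    have hcoeff : Continuous fun lam : ℝ => (solPairing bc q lam mu).re /
        (‖prufer bc (shift q lam) ⊤‖ * ‖prufer bc (shift q mu) ⊤‖) :=
      (Complex.continuous_re.comp ((continuous_solPairing bc q).comp
        (Complex.continuous_ofReal.prodMk continuous_const))).div
        (hprufer.norm.mul continuous_const) fun lam => mul_ne_zero (hne lam) (hne mu)
    rw [(hasDerivAt_of_sin_sub_eq_mul
      ((hq.continuous_rot_shift bc).mul_const Real.pi).continuousAt hcoeff.continuousAt
      fun lam => hq.sin_rot_sub_rot bc lam mu).deriv]
    obtain ⟨c, hc, hself⟩ := hq.exists_solPairing_self bc mu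
    rw [hself, Complex.ofReal_re]
    have := hne mu
    positivity
  exact fun lam mu h => lt_of_mul_lt_mul_right (hmono h) Real.pi_pos.le

lemma mem_Ioo_zero_pi_div_two_of_sin_two_mul_pos {y : ℝ → ℝ} {b : ℝ} (hb : 0 < b)
    (hy : ContinuousOn y (Set.Icc 0 b)) (hy0 : y 0 = 0)
    (hsin : ∀ x ∈ Set.Ioc 0 b, 0 < Real.sin (2 * y x)) : y b ∈ Set.Ioo 0 (Real.pi / 2) := by
  have hnot : ∀ c ≠ 0, Real.sin (2 * c) = 0 → c ∉ y '' Set.Icc 0 b := by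
    rintro c hc hs ⟨x, hx, rfl⟩
    have hx0 : 0 < x := hx.1.lt_of_ne fun h => hc (by rw [← h, hy0])
    exact (hsin x ⟨hx0, hx.2⟩).ne' hs
  have hpi := Real.pi_div_two_pos
  have hupper : y b < Real.pi / 2 := by
    by_contra! h
    exact hnot (Real.pi / 2) hpi.ne' (by rw [mul_div_cancel₀ _ two_ne_zero, Real.sin_pi])
      (intermediate_value_Icc hb.le hy ⟨hy0.trans_le hpi.le, h⟩)
  have hlower : -(Real.pi / 2) < y b := by
    by_contra! h
    exact hnot (-(Real.pi / 2)) (neg_ne_zero.2 hpi.ne')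
      (by rw [mul_neg, mul_div_cancel₀ _ two_ne_zero, Real.sin_neg, Real.sin_pi, neg_zero])
      (intermediate_value_Icc' hb.le hy ⟨h, by rw [hy0]; linarith⟩)
  refine ⟨?_, hupper⟩
  by_contra! h
  exact (hsin b ⟨hb, le_rfl⟩).not_ge
    (Real.sin_nonpos_of_nonpos_of_neg_pi_le (by linarith) (by linarith))

lemma IsRealCoeff.re_bsol_mul_re_dbsol_pos {q : Coeff Real.pi} (hq : IsRealCoeff q)
    (hpos : ∀ x, 0 < (q x).re) (bc : BoundaryCondition)
    {x : ℝ} (hx : x ∈ Set.Ioc 0 Real.pi) :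
    0 < (bsol bc q x).re * (dbsol bc q x).re := by
  let u : ℝ → ℝ := fun x => (bsol bc q x).re
  let v : ℝ → ℝ := fun x => (dbsol bc q x).re
  have hu : ∀ x ∈ Set.Icc 0 Real.pi, HasDerivAt u (v x) x := fun x hx =>
    Complex.reCLM.hasFDerivAt.comp_hasDerivAt x (hasDerivAt_sol _ _ q hx)
  have hv : ∀ x (hx : x ∈ Set.Icc 0 Real.pi), HasDerivAt v ((q ⟨x, hx⟩).re * u x) x := by
    intro x hx
    refine (Complex.reCLM.hasFDerivAt.comp_hasDerivAt x
      (hasDerivAt_dsol bc.initVal bc.initSlope q hx)).congr_deriv ?_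
    rw [IccExtendCM_of_mem hx, Complex.reCLM_apply, Complex.mul_re, hq, zero_mul, sub_zero]
  have hderiv_pos : ∀ x (hx : x ∈ Set.Icc 0 Real.pi),
      0 < v x * v x + u x * ((q ⟨x, hx⟩).re * u x) := by
    intro x hx
    have hqx := hpos ⟨x, hx⟩
    rcases hq.re_bsol_ne_zero_or bc ⟨x, hx⟩ with h | h
    · nlinarith [mul_self_nonneg (v x), mul_pos hqx (mul_self_pos.2 h)]
    · nlinarith [mul_self_pos.2 h, mul_nonneg hqx.le (mul_self_nonneg (u x))]
  have hmono : StrictMonoOn (fun x => u x * v x) (Set.Icc 0 Real.pi) := by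
    have hderiv : ∀ x (hx : x ∈ Set.Icc 0 Real.pi), HasDerivAt (fun x => u x * v x)
        (v x * v x + u x * ((q ⟨x, hx⟩).re * u x)) x := fun x hx => (hu x hx).mul (hv x hx)
    refine strictMonoOn_of_deriv_pos (convex_Icc _ _)
      (fun x hx => (hderiv x hx).continuousAt.continuousWithinAt) fun x hx => ?_
    have hx' : x ∈ Set.Icc 0 Real.pi := interior_subset hx
    rw [(hderiv x hx').deriv]
    exact hderiv_pos x hx'
  have hzero : u 0 * v 0 = 0 := by
    simp only [u, v, sol_zero, dsol_zero]
    cases bc <;> simp [BoundaryCondition.initVal, BoundaryCondition.initSlope]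
  simpa only [hzero] using hmono ⟨le_rfl, Real.pi_pos.le⟩ ⟨hx.1.le, hx.2⟩ hx.1

lemma IsRealCoeff.re_start_sq_mul_sin_pos {q : Coeff Real.pi} (hq : IsRealCoeff q)
    (hpos : ∀ x, 0 < (q x).re) (bc : BoundaryCondition)
    {x : ℝ} (hx : x ∈ Set.Ioc 0 Real.pi) :
    0 < (bc.start ^ 2).re * Real.sin (2 * (pruferLog bc q x).im) := by
  have hx' : x ∈ Set.Icc 0 Real.pi := ⟨hx.1.le, hx.2⟩
  have hstart : (bc.start ^ 2).im = 0 := by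
    cases bc <;> simp [BoundaryCondition.start, BoundaryCondition.initVal,
      BoundaryCondition.initSlope]
  have hsq : (prufer bc q ⟨x, hx'⟩ ^ 2).im = 2 * ((bsol bc q x).re * (dbsol bc q x).re) := by
    rw [sq, Complex.mul_im, hq.prufer_re, hq.prufer_im]; ring
  rw [hq.prufer_eq_exp, mul_pow, ← Complex.exp_nat_mul, Complex.mul_im, hstart, zero_mul, add_zero,
    Complex.exp_im] at hsq
  have him : ((2 : ℕ) * pruferLog bc q x).im = 2 * (pruferLog bc q x).im := by simp
  rw [him, mul_left_comm] at hsq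
  refine pos_of_mul_pos_right (hsq.symm ▸ mul_pos two_pos ?_) (Real.exp_pos _).le
  exact hq.re_bsol_mul_re_dbsol_pos hpos bc hx

lemma IsRealCoeff.rot_of_pos {q : Coeff Real.pi} (hq : IsRealCoeff q)
    (hpos : ∀ x, 0 < (q x).re) (bc : BoundaryCondition) :
    (bc.firstIndex : ℝ) - 1 < rot bc q ∧ rot bc q < bc.firstIndex := by
  have hsin := fun x hx => hq.re_start_sq_mul_sin_pos hpos bc (x := x) hx
  have hcont : Continuous fun x => (pruferLog bc q x).im :=
    Complex.continuous_im.comp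
      (continuous_iff_continuousAt.2 fun x => (hq.hasDerivAt_pruferLog bc x).continuousAt)
  have hzero : (pruferLog bc q 0).im = 0 := by simp [pruferLog]
  have hpi := Real.pi_pos
  cases bc with
  | dirichlet =>
    have h := mem_Ioo_zero_pi_div_two_of_sin_two_mul_pos Real.pi_pos hcont.continuousOn hzero
      fun x hx => by
        simpa [BoundaryCondition.start, BoundaryCondition.initVal, BoundaryCondition.initSlope]
          using hsin x hx
    rw [pruferLog_end_im] at h
    simp only [BoundaryCondition.firstIndex, Nat.cast_one, sub_self]
    constructor <;> nlinarith [h.1, h.2]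
  | neumann =>
    have h := mem_Ioo_zero_pi_div_two_of_sin_two_mul_pos
      (y := fun x => -(pruferLog .neumann q x).im) Real.pi_pos hcont.neg.continuousOn
      (by rw [hzero, neg_zero]) fun x hx => by
        simpa [BoundaryCondition.start, BoundaryCondition.initVal, BoundaryCondition.initSlope]
          using hsin x hx
    rw [pruferLog_end_im] at h
    simp only [BoundaryCondition.firstIndex, Nat.cast_zero, zero_sub]
    constructor <;> nlinarith [h.1, h.2]

/-! ### Large spectral parameter -/

section Asymptotics

lemma norm_cexp_add_norm_cexp_le {z : ℂ} {c : ℝ} (hz : |z.im| ≤ c) :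
    ‖Complex.exp (z * Complex.I)‖ + ‖Complex.exp (-z * Complex.I)‖ ≤ 2 * Real.cosh c := by
  simp only [Complex.norm_exp, Complex.mul_I_re, Complex.neg_im, neg_neg]
  have hcosh := Real.cosh_le_cosh.2 (hz.trans (le_abs_self c))
  rw [Real.cosh_eq z.im] at hcosh
  linarith

lemma norm_cos_le_cosh {z : ℂ} {c : ℝ} (hz : |z.im| ≤ c) : ‖Complex.cos z‖ ≤ Real.cosh c := by
  rw [Complex.cos, norm_div, Complex.norm_two]
  linarith [norm_add_le (Complex.exp (z * Complex.I)) (Complex.exp (-z * Complex.I)),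
    norm_cexp_add_norm_cexp_le hz]

lemma norm_sin_le_cosh {z : ℂ} {c : ℝ} (hz : |z.im| ≤ c) : ‖Complex.sin z‖ ≤ Real.cosh c := by
  rw [Complex.sin, norm_div, Complex.norm_two, norm_mul, Complex.norm_I, mul_one]
  linarith [norm_sub_le (Complex.exp (-z * Complex.I)) (Complex.exp (z * Complex.I)),
    norm_cexp_add_norm_cexp_le hz]

lemma hasDerivAt_sin_mul_sub (k x : ℂ) (t : ℝ) :
    HasDerivAt (fun t : ℝ => Complex.sin (k * (x - t))) (-k * Complex.cos (k * (x - t))) t := by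
  have hlin : HasDerivAt (fun w : ℂ => k * (x - w)) (k * -1) t :=
    ((hasDerivAt_id (t : ℂ)).const_sub x).const_mul k
  exact hlin.csin.comp_ofReal.congr_deriv (by ring)

lemma hasDerivAt_cos_mul_sub (k x : ℂ) (t : ℝ) :
    HasDerivAt (fun t : ℝ => Complex.cos (k * (x - t))) (k * Complex.sin (k * (x - t))) t := by
  have hlin : HasDerivAt (fun w : ℂ => k * (x - w)) (k * -1) t :=
    ((hasDerivAt_id (t : ℂ)).const_sub x).const_mul k
  exact hlin.ccos.comp_ofReal.congr_deriv (by ring)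

variable {ℓ : ℝ}

lemma abs_im_mul_sub_le {k : ℂ} (hk : |k.im| ≤ 1) {x t : ℝ} (hx : x ∈ Set.Icc 0 ℓ)
    (ht : t ∈ Set.Icc 0 ℓ) : |(k * ((x : ℂ) - t)).im| ≤ ℓ := by
  rw [← Complex.ofReal_sub, Complex.im_mul_ofReal, abs_mul]
  have hxt : |x - t| ≤ ℓ := by
    rw [abs_le]; constructor <;> linarith [hx.1, hx.2, ht.1, ht.2]
  calc |k.im| * |x - t| ≤ 1 * ℓ := by gcongr
    _ = ℓ := one_mul _

/-- The coefficient of the model equation `u'' = -(k² + R) u`, a perturbation of the free equation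
`u'' = -k² u`. -/
noncomputable def modelCoeff (k : ℂ) (R : Coeff ℓ) : Coeff ℓ := -(k ^ 2 • 1 + R)

lemma modelCoeff_apply (k : ℂ) (R : Coeff ℓ) (t : Set.Icc 0 ℓ) :
    modelCoeff k R t = -(k ^ 2 + R t) := by
  simp [modelCoeff]

lemma shift_eq_modelCoeff (V : Coeff ℓ) (k : ℂ) : shift V (k ^ 2) = modelCoeff k (-V) := by
  simp only [shift, modelCoeff]; abel

/-- The kernel `t ↦ sin (k (x - t))` of the variation of constants formula for the solution. -/
noncomputable def sinKer (k : ℂ) (x : Set.Icc 0 ℓ) : Coeff ℓ :=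
  ⟨fun t => Complex.sin (k * ((x : ℝ) - (t : ℝ))), by fun_prop⟩

/-- The kernel `t ↦ cos (k (x - t))` of the variation of constants formula for the derivative. -/
noncomputable def cosKer (k : ℂ) (x : Set.Icc 0 ℓ) : Coeff ℓ :=
  ⟨fun t => Complex.cos (k * ((x : ℝ) - (t : ℝ))), by fun_prop⟩

lemma norm_sinKer_le {k : ℂ} (hk : |k.im| ≤ 1) (x : Set.Icc 0 ℓ) : ‖sinKer k x‖ ≤ Real.cosh ℓ :=
  (ContinuousMap.norm_le _ (Real.cosh_pos _).le).2 fun t =>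
    norm_sin_le_cosh (abs_im_mul_sub_le hk x.2 t.2)

lemma norm_cosKer_le {k : ℂ} (hk : |k.im| ≤ 1) (x : Set.Icc 0 ℓ) : ‖cosKer k x‖ ≤ Real.cosh ℓ :=
  (ContinuousMap.norm_le _ (Real.cosh_pos _).le).2 fun t =>
    norm_cos_le_cosh (abs_im_mul_sub_le hk x.2 t.2)

variable [Fact (0 ≤ ℓ)]

lemma norm_primitiveL_apply_le (f : Coeff ℓ) (x : Set.Icc 0 ℓ) : ‖primitiveL f x‖ ≤ ℓ * ‖f‖ :=
  norm_integral_IccExtendCM_le f x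

lemma wronskian_modelCoeff (a b k : ℂ) (R : Coeff ℓ) (x : Set.Icc 0 ℓ) {s s' : ℝ → ℂ}
    (hs : ∀ t, HasDerivAt s (s' t) t) (hs' : ∀ t, HasDerivAt s' (-k ^ 2 * s t) t)
    {g : Coeff ℓ} (hg : ∀ t : Set.Icc 0 ℓ, g t = R t * ivp a b (modelCoeff k R) t * s t) :
    ivp a b (modelCoeff k R) x * s' x - ivpDeriv a b (modelCoeff k R) x * s x
      = (a * s' 0 - b * s 0) + primitiveL g x := by
  have h := eq_add_primitiveL_of_hasDerivWithinAt
    (f := fun t => sol a b (modelCoeff k R) t * s' t - dsol a b (modelCoeff k R) t * s t)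
    (fun y hy => (((hasDerivAt_sol a b _ hy).mul (hs' y)).sub
      ((hasDerivAt_dsol a b _ hy).mul (hs y))).hasDerivWithinAt) g
    (fun y => by
      rw [hg, IccExtendCM_of_mem y.2, sol_coe, modelCoeff_apply]
      ring) x
  simpa only [sol_zero, dsol_zero, sol_coe, dsol_coe] using h

lemma mul_ivp_modelCoeff (a b k : ℂ) (R : Coeff ℓ) (x : Set.Icc 0 ℓ) :
    k * ivp a b (modelCoeff k R) x = a * k * Complex.cos (k * x) + b * Complex.sin (k * x)
      - primitiveL (R * ivp a b (modelCoeff k R) * sinKer k x) x := by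
  have h := wronskian_modelCoeff a b k R x (s := fun t => Complex.sin (k * ((x : ℝ) - t)))
    (s' := fun t => -k * Complex.cos (k * ((x : ℝ) - t)))
    (fun t => hasDerivAt_sin_mul_sub k _ t)
    (fun t => ((hasDerivAt_cos_mul_sub k _ t).const_mul (-k)).congr_deriv (by ring))
    (g := R * ivp a b (modelCoeff k R) * sinKer k x) (fun t => rfl)
  simp only [sub_self, mul_zero, Complex.sin_zero, Complex.cos_zero, Complex.ofReal_zero,
    sub_zero] at h
  linear_combination -h

lemma neg_ivpDeriv_modelCoeff (a b k : ℂ) (R : Coeff ℓ) (x : Set.Icc 0 ℓ) :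
    -ivpDeriv a b (modelCoeff k R) x = a * k * Complex.sin (k * x) - b * Complex.cos (k * x)
      + primitiveL (R * ivp a b (modelCoeff k R) * cosKer k x) x := by
  have h := wronskian_modelCoeff a b k R x (s := fun t => Complex.cos (k * ((x : ℝ) - t)))
    (s' := fun t => k * Complex.sin (k * ((x : ℝ) - t)))
    (fun t => hasDerivAt_cos_mul_sub k _ t)
    (fun t => ((hasDerivAt_sin_mul_sub k _ t).const_mul k).congr_deriv (by ring))
    (g := R * ivp a b (modelCoeff k R) * cosKer k x) (fun t => rfl)
  simp only [sub_self, mul_zero, Complex.sin_zero, Complex.cos_zero, Complex.ofReal_zero,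
    sub_zero] at h
  linear_combination h

lemma norm_primitiveL_mul_mul_le (f g : Coeff ℓ) {s : Coeff ℓ} {c : ℝ} (hs : ‖s‖ ≤ c)
    (x : Set.Icc 0 ℓ) : ‖primitiveL (f * g * s) x‖ ≤ ℓ * ‖f‖ * c * ‖g‖ := by
  have hℓ : 0 ≤ ℓ := Fact.out
  calc _ ≤ ℓ * ‖f * g * s‖ := norm_primitiveL_apply_le _ _
    _ ≤ ℓ * (‖f‖ * ‖g‖ * c) := by
        gcongr
        exact (norm_mul_le _ _).trans
          (mul_le_mul (norm_mul_le _ _) hs (norm_nonneg _) (by positivity))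
    _ = ℓ * ‖f‖ * c * ‖g‖ := by ring

lemma norm_ivp_modelCoeff_le (a b : ℂ) {k : ℂ} {R : Coeff ℓ} (hk : |k.im| ≤ 1) (hk0 : k ≠ 0)
    (hkR : 2 * ℓ * ‖R‖ * Real.cosh ℓ ≤ ‖k‖) :
    ‖ivp a b (modelCoeff k R)‖ ≤ 2 * Real.cosh ℓ * (‖a‖ + ‖b‖ / ‖k‖) := by
  set u := ivp a b (modelCoeff k R)
  have hkn : 0 < ‖k‖ := norm_pos_iff.2 hk0
  have hpt (x : Set.Icc 0 ℓ) : ‖u x‖ ≤ Real.cosh ℓ * (‖a‖ + ‖b‖ / ‖k‖) + ‖u‖ / 2 := by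
    have him : |(k * (x : ℝ)).im| ≤ ℓ := by
      simpa using abs_im_mul_sub_le hk x.2 (Set.left_mem_Icc.2 Fact.out)
    have hintegral : ‖primitiveL (R * u * sinKer k x) x‖ ≤ ‖k‖ * (‖u‖ / 2) := by
      refine (norm_primitiveL_mul_mul_le R u (norm_sinKer_le hk x) x).trans ?_
      nlinarith [norm_nonneg u]
    have hmul : ‖k‖ * ‖u x‖ ≤
        ‖a‖ * ‖k‖ * Real.cosh ℓ + ‖b‖ * Real.cosh ℓ + ‖k‖ * (‖u‖ / 2) := by
      rw [← norm_mul, mul_ivp_modelCoeff a b k R x]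
      refine (norm_sub_le _ _).trans (add_le_add ((norm_add_le _ _).trans ?_) hintegral)
      rw [norm_mul, norm_mul, norm_mul]
      gcongr
      exacts [norm_cos_le_cosh him, norm_sin_le_cosh him]
    refine le_of_mul_le_mul_left (hmul.trans_eq ?_) hkn
    field_simp
  have hu : ‖u‖ ≤ Real.cosh ℓ * (‖a‖ + ‖b‖ / ‖k‖) + ‖u‖ / 2 :=
    (ContinuousMap.norm_le _ (by positivity)).2 hpt
  linarith

/-- The characteristic function of the model equation, normalized to be close to `sin (k ℓ)`. -/
noncomputable def normChar : BoundaryCondition → ℂ → Coeff ℓ → ℂ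
  | .dirichlet, k, R => k * charFn .dirichlet (modelCoeff k R)
  | .neumann, k, R => -charFn .neumann (modelCoeff k R) / k

lemma normChar_eq_zero_iff (bc : BoundaryCondition) {k : ℂ} (hk : k ≠ 0) (R : Coeff ℓ) :
    normChar bc k R = 0 ↔ charFn bc (modelCoeff k R) = 0 := by
  cases bc <;> simp [normChar, hk]

lemma normChar_dirichlet_sub_sin (k : ℂ) (R : Coeff ℓ) :
    normChar .dirichlet k R - Complex.sin (k * ℓ)
      = -primitiveL (R * ivp 0 1 (modelCoeff k R) * sinKer k ⊤) ⊤ := by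
  have hchar : charFn .dirichlet (modelCoeff k R) = ivp 0 1 (modelCoeff k R) ⊤ := sol_coe 0 1 _ ⊤
  rw [normChar, hchar, mul_ivp_modelCoeff 0 1 k R ⊤, Set.Icc.coe_top]
  ring

lemma normChar_neumann_sub_sin {k : ℂ} (hk : k ≠ 0) (R : Coeff ℓ) :
    normChar .neumann k R - Complex.sin (k * ℓ)
      = primitiveL (R * ivp 1 0 (modelCoeff k R) * cosKer k ⊤) ⊤ / k := by
  have hchar : charFn .neumann (modelCoeff k R) = ivpDeriv 1 0 (modelCoeff k R) ⊤ :=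
    dsol_coe 1 0 _ ⊤
  rw [normChar, hchar, neg_ivpDeriv_modelCoeff 1 0 k R ⊤, Set.Icc.coe_top]
  field_simp
  ring

lemma norm_normChar_sub_sin_le (bc : BoundaryCondition) {k : ℂ} {R : Coeff ℓ} (hk : |k.im| ≤ 1)
    (hk0 : k ≠ 0) (hkR : 2 * ℓ * ‖R‖ * Real.cosh ℓ ≤ ‖k‖) :
    ‖normChar bc k R - Complex.sin (k * ℓ)‖ ≤ 2 * ℓ * ‖R‖ * Real.cosh ℓ ^ 2 / ‖k‖ := by
  have hℓ : 0 ≤ ℓ := Fact.out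
  have hu (a b : ℂ) : ℓ * ‖R‖ * Real.cosh ℓ * ‖ivp a b (modelCoeff k R)‖
      ≤ 2 * ℓ * ‖R‖ * Real.cosh ℓ ^ 2 * (‖a‖ + ‖b‖ / ‖k‖) :=
    calc _ ≤ ℓ * ‖R‖ * Real.cosh ℓ * (2 * Real.cosh ℓ * (‖a‖ + ‖b‖ / ‖k‖)) := by
          gcongr; exact norm_ivp_modelCoeff_le a b hk hk0 hkR
      _ = _ := by ring
  cases bc with
  | dirichlet =>
    rw [normChar_dirichlet_sub_sin, norm_neg]
    refine (norm_primitiveL_mul_mul_le R _ (norm_sinKer_le hk ⊤) ⊤).trans ((hu 0 1).trans_eq ?_)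
    rw [norm_zero, norm_one, zero_add, mul_one_div]
  | neumann =>
    rw [normChar_neumann_sub_sin hk0, norm_div]
    gcongr
    refine (norm_primitiveL_mul_mul_le R _ (norm_cosKer_le hk ⊤) ⊤).trans ((hu 1 0).trans_eq ?_)
    rw [norm_zero, norm_one, zero_div, add_zero, mul_one]

lemma normChar_zero (bc : BoundaryCondition) {k : ℂ} (hk : k ≠ 0) :
    normChar bc k (0 : Coeff ℓ) = Complex.sin (k * ℓ) := by
  refine sub_eq_zero.1 ?_
  cases bc with
  | dirichlet =>
    rw [normChar_dirichlet_sub_sin]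
    simp only [zero_mul, map_zero, neg_zero, ContinuousMap.zero_apply]
  | neumann =>
    rw [normChar_neumann_sub_sin hk]
    simp only [zero_mul, map_zero, zero_div, ContinuousMap.zero_apply]

end Asymptotics

/-! ### Enumeration of the unperturbed eigenvalues -/

lemma apply_add_one_of_int_iff {f : ℝ → ℝ} {m : ℤ} (hc : ContinuousOn f (Set.Icc m (m + 1)))
    (hm : StrictMonoOn f (Set.Icc m (m + 1))) (h0 : f m ∈ Set.Ico (m : ℝ) (m + 1))
    (hinteger : ∀ k ∈ Set.Ioc (m : ℝ) (m + 1), (∃ j : ℤ, f k = j) ↔ ∃ j : ℤ, (j : ℝ) = k) :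
    f (m + 1) = m + 1 := by
  have hlt : (m : ℝ) < m + 1 := lt_add_one _
  obtain ⟨j, hj⟩ := (hinteger (m + 1) (Set.right_mem_Ioc.2 hlt)).2 ⟨m + 1, by push_cast; rfl⟩
  have hmj : m < j := by
    have h := h0.1.trans_lt (hm (Set.left_mem_Icc.2 hlt.le) (Set.right_mem_Icc.2 hlt.le) hlt)
    rw [hj] at h
    exact_mod_cast h
  have hjm : j ≤ m + 1 := by
    by_contra! h
    obtain ⟨k, hk, hfk⟩ := intermediate_value_Ioo hlt.le hc
      (show (m : ℝ) + 1 ∈ Set.Ioo _ _ from ⟨h0.2, by rw [hj]; exact_mod_cast h⟩)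
    obtain ⟨i, rfl⟩ := (hinteger k (Set.Ioo_subset_Ioc_self hk)).1
      ⟨m + 1, by push_cast; exact hfk⟩
    have hmi : m < i := by exact_mod_cast hk.1
    have him : i < m + 1 := by exact_mod_cast hk.2
    omega
  rw [hj, le_antisymm hjm hmj]
  push_cast
  rfl

lemma mem_Ioo_of_forall_ne_int {f : ℝ → ℝ} (hf : Continuous f)
    (hne : ∀ t ∈ Set.Icc (0 : ℝ) 1, ∀ j : ℤ, f t ≠ j) {m : ℤ}
    (h0 : f 0 ∈ Set.Ioo (m : ℝ) (m + 1)) : f 1 ∈ Set.Ioo (m : ℝ) (m + 1) := by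
  constructor
  · by_contra! h
    obtain ⟨t, ht, htm⟩ := intermediate_value_Icc' zero_le_one hf.continuousOn ⟨h, h0.1.le⟩
    exact hne t ht m htm
  · by_contra! h
    obtain ⟨t, ht, htm⟩ := intermediate_value_Icc zero_le_one hf.continuousOn ⟨h0.2.le, h⟩
    exact hne t ht (m + 1) (by push_cast; exact htm)

lemma encard_int_values_lt {f : ℝ → ℝ} (hf : StrictMono f) {a : ℕ} (hlow : ∀ x, (a : ℝ) - 1 < f x)
    (hsurj : ∀ i : ℕ, a ≤ i → ∃ x, f x = i) {m : ℕ} (ham : a ≤ m) {x : ℝ} (hx : f x = m) :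
    {y : ℝ | y < x ∧ ∃ j : ℤ, f y = j}.encard + (a : ℕ∞) = m := by
  choose! e he using hsurj
  have himage : {y : ℝ | y < x ∧ ∃ j : ℤ, f y = j} = e '' (Finset.Ico a m : Set ℕ) := by
    ext y
    simp only [Set.mem_ofPred_eq, Set.mem_image, Finset.coe_Ico, Set.mem_Ico]
    constructor
    · rintro ⟨hy, j, hj⟩
      have hja := hlow y
      have hjm := hf hy
      rw [hj] at hja hjm
      rw [hx] at hjm
      have hja' : (a : ℤ) - 1 < j := by exact_mod_cast hja
      have hjm' : j < m := by exact_mod_cast hjm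
      lift j to ℕ using by omega
      exact ⟨j, ⟨by omega, by omega⟩, hf.injective (by rw [he j (by omega), hj, Int.cast_natCast])⟩
    · rintro ⟨i, ⟨hai, him⟩, rfl⟩
      refine ⟨hf.lt_iff_lt.1 ?_, i, by rw [he i hai, Int.cast_natCast]⟩
      rw [he i hai, hx]
      exact_mod_cast him
  have hinj : Set.InjOn e (Finset.Ico a m : Set ℕ) := by
    intro i hi j hj hij
    rw [Finset.coe_Ico, Set.mem_Ico] at hi hj
    have h := he i hi.1
    rw [hij, he j hj.1] at h
    exact_mod_cast h.symm
  rw [himage, hinj.encard_image, Set.encard_coe_eq_coe_finsetCard, Nat.card_Ico]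
  norm_cast
  omega

lemma IsRealCoeff.rot_shift_of_lt {V : Coeff Real.pi} (hV : IsRealCoeff V)
    (bc : BoundaryCondition) {lam : ℝ} (h : lam < -‖V‖) :
    (bc.firstIndex : ℝ) - 1 < rot bc (shift V lam) ∧ rot bc (shift V lam) < bc.firstIndex := by
  refine (isRealCoeff_shift hV lam).rot_of_pos (fun x => ?_) bc
  have hVx : -‖V‖ ≤ (V x).re :=
    (abs_le.1 ((Complex.abs_re_le_norm _).trans (V.norm_coe_le_norm x))).1
  have hre : (shift V lam x).re = (V x).re - lam := by simp [shift]
  linarith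

lemma IsRealCoeff.lt_rot_shift {V : Coeff Real.pi} (hV : IsRealCoeff V) (bc : BoundaryCondition)
    (lam : ℝ) : (bc.firstIndex : ℝ) - 1 < rot bc (shift V lam) := by
  rcases lt_or_ge lam (-‖V‖) with h | h
  · exact (hV.rot_shift_of_lt bc h).1
  · exact (hV.rot_shift_of_lt bc (lam := -‖V‖ - 1) (by linarith)).1.trans
      (hV.strictMono_rot bc (by linarith))

lemma isRealCoeff_zero : IsRealCoeff (0 : Coeff Real.pi) := fun _ => rfl

/-- The rotation number of the free equation `u'' = -k² u`. -/
noncomputable def freeRot (bc : BoundaryCondition) (k : ℝ) : ℝ :=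
  rot bc (shift (0 : Coeff Real.pi) ((k ^ 2 : ℝ) : ℂ))

lemma continuous_freeRot (bc : BoundaryCondition) : Continuous (freeRot bc) :=
  (isRealCoeff_zero.continuous_rot_shift bc).comp (continuous_pow 2)

lemma strictMonoOn_freeRot (bc : BoundaryCondition) : StrictMonoOn (freeRot bc) (Set.Ici 0) :=
  fun _ hk _ _ hlt => isRealCoeff_zero.strictMono_rot bc (pow_lt_pow_left₀ hlt hk two_ne_zero)

lemma freeRot_int_iff (bc : BoundaryCondition) {k : ℝ} (hk : 0 < k) :
    (∃ j : ℤ, freeRot bc k = j) ↔ ∃ j : ℤ, (j : ℝ) = k := by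
  have hk0 : (k : ℂ) ≠ 0 := by exact_mod_cast hk.ne'
  rw [freeRot, ← (isRealCoeff_shift isRealCoeff_zero (k ^ 2)).charFn_eq_zero_iff,
    Complex.ofReal_pow, shift_eq_modelCoeff, neg_zero, ← normChar_eq_zero_iff bc hk0,
    normChar_zero bc hk0, ← Complex.ofReal_mul, ← Complex.ofReal_sin,
    Complex.ofReal_eq_zero, Real.sin_eq_zero_iff]
  exact exists_congr fun j => mul_left_inj' Real.pi_ne_zero

lemma charFn_dirichlet_zero : charFn .dirichlet (0 : Coeff Real.pi) = Real.pi := by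
  have hsol : IsSolution (0 : Coeff Real.pi) (fun x => (x : ℂ)) fun _ => 1 :=
    ⟨fun x _ => Complex.ofRealCLM.hasDerivAt.hasDerivWithinAt, fun x hx => by
      rw [IccExtendCM_of_mem hx]
      simpa using (hasDerivAt_const x (1 : ℂ)).hasDerivWithinAt⟩
  have h := (hsol.eq_sol (Set.right_mem_Icc.2 Real.pi_pos.le)).1
  rw [Complex.ofReal_zero] at h
  exact h.symm

lemma charFn_neumann_zero : charFn .neumann (0 : Coeff Real.pi) = 0 := by
  have hsol : IsSolution (0 : Coeff Real.pi) (fun _ => 1) fun _ => 0 :=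
    ⟨fun x _ => (hasDerivAt_const x (1 : ℂ)).hasDerivWithinAt, fun x hx => by
      rw [IccExtendCM_of_mem hx]
      simpa using (hasDerivAt_const x (0 : ℂ)).hasDerivWithinAt⟩
  exact (hsol.eq_sol (Set.right_mem_Icc.2 Real.pi_pos.le)).2.symm

lemma freeRot_zero_le (bc : BoundaryCondition) : freeRot bc 0 ≤ bc.firstIndex := by
  have hc := isRealCoeff_zero.continuous_rot_shift bc
  rw [freeRot, zero_pow two_ne_zero]
  refine le_of_tendsto ((hc.tendsto 0).mono_left (nhdsWithin_le_nhds (s := Set.Iio 0))) ?_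
  filter_upwards [self_mem_nhdsWithin] with lam hlam
  exact (isRealCoeff_zero.rot_shift_of_lt bc (by simpa using hlam)).2.le

lemma freeRot_zero_mem (bc : BoundaryCondition) : freeRot bc 0 ∈ Set.Ico (0 : ℝ) 1 := by
  have hrot : freeRot bc 0 = rot bc (0 : Coeff Real.pi) := by
    rw [freeRot, shift]
    congr 1
    ext x
    simp
  have hlow : (bc.firstIndex : ℝ) - 1 < freeRot bc 0 := isRealCoeff_zero.lt_rot_shift bc _
  have hupp := freeRot_zero_le bc
  have hinteger := isRealCoeff_zero.charFn_eq_zero_iff bc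
  rw [hrot] at hlow hupp ⊢
  cases bc with
  | dirichlet =>
    simp only [BoundaryCondition.firstIndex, Nat.cast_one, sub_self] at hlow hupp
    have hne : rot .dirichlet (0 : Coeff Real.pi) ≠ 1 := fun h => by
      have hzero := hinteger.2 ⟨1, by exact_mod_cast h⟩
      rw [charFn_dirichlet_zero] at hzero
      exact Real.pi_ne_zero (by exact_mod_cast hzero)
    exact ⟨hlow.le, lt_of_le_of_ne hupp hne⟩
  | neumann =>
    simp only [BoundaryCondition.firstIndex, Nat.cast_zero, zero_sub] at hlow hupp
    obtain ⟨j, hj⟩ := hinteger.1 charFn_neumann_zero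
    rw [hj] at hlow ⊢
    have hj0 : (-1 : ℤ) < j := by exact_mod_cast hlow
    have hj1 : j < 1 := by exact_mod_cast (hj.symm.le.trans hupp).trans_lt one_pos
    exact ⟨by exact_mod_cast Int.add_one_le_of_lt hj0, by exact_mod_cast hj1⟩

lemma freeRot_natCast_succ (bc : BoundaryCondition) (n : ℕ) :
    freeRot bc (n + 1) = n + 1 := by
  have hstep (m : ℕ) (hm : freeRot bc m ∈ Set.Ico (m : ℝ) (m + 1)) :
      freeRot bc (m + 1) = m + 1 := by
    have h := apply_add_one_of_int_iff (f := freeRot bc) (m := m)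
      (continuous_freeRot bc).continuousOn
      ((strictMonoOn_freeRot bc).mono fun k hk => (Int.cast_nonneg (by omega)).trans hk.1)
      (by exact_mod_cast hm)
      fun k hk => freeRot_int_iff bc (lt_of_le_of_lt (Int.cast_nonneg (by omega)) hk.1)
    exact_mod_cast h
  induction n with
  | zero => exact hstep 0 (by simpa using freeRot_zero_mem bc)
  | succ n ih =>
    refine hstep (n + 1) ?_
    push_cast
    rw [ih]
    exact ⟨le_rfl, lt_add_one _⟩

lemma freeRot_mem_Ioo (bc : BoundaryCondition) (n : ℕ) {k : ℝ}
    (hk : k ∈ Set.Ioo ((n : ℝ) + 1) (n + 2)) :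
    freeRot bc k ∈ Set.Ioo ((n : ℝ) + 1) (n + 2) := by
  have hn1 : 0 ≤ (n : ℝ) + 1 := by positivity
  have hk0 : 0 ≤ k := hn1.trans hk.1.le
  have hleft := strictMonoOn_freeRot bc hn1 hk0 hk.1
  have hright := strictMonoOn_freeRot bc hk0 (show 0 ≤ (n : ℝ) + 2 by positivity) hk.2
  rw [freeRot_natCast_succ] at hleft
  rw [show (n : ℝ) + 2 = (n + 1 : ℕ) + 1 by push_cast; ring, freeRot_natCast_succ] at hright
  exact ⟨hleft, by rwa [show (n : ℝ) + 2 = (n + 1 : ℕ) + 1 by push_cast; ring]⟩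

/-- Along the homotopy `t V`, `t ∈ [0, 1]`, the characteristic function at `k²` has no zero, so the
rotation number cannot cross an integer. -/
lemma IsRealCoeff.rot_shift_mem_of_freeRot_mem {V : Coeff Real.pi} (hV : IsRealCoeff V)
    (bc : BoundaryCondition) {k : ℝ} (hk : 0 < k)
    (hkV : 2 * Real.pi * ‖V‖ * Real.cosh Real.pi ≤ k)
    (hsin : 2 * Real.pi * ‖V‖ * Real.cosh Real.pi ^ 2 / k < |Real.sin (k * Real.pi)|)
    {m : ℤ} (h0 : freeRot bc k ∈ Set.Ioo (m : ℝ) (m + 1)) :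
    rot bc (shift V ((k ^ 2 : ℝ) : ℂ)) ∈ Set.Ioo (m : ℝ) (m + 1) := by
  have hk0 : (k : ℂ) ≠ 0 := by exact_mod_cast hk.ne'
  have hkn : ‖(k : ℂ)‖ = k := by rw [Complex.norm_real, Real.norm_of_nonneg hk.le]
  have hreal (t : ℝ) : IsRealCoeff (shift ((t : ℂ) • V) ((k ^ 2 : ℝ) : ℂ)) :=
    isRealCoeff_shift (fun x => by simp [hV x]) _
  have hc : Continuous fun t : ℝ => rot bc (shift ((t : ℂ) • V) ((k ^ 2 : ℝ) : ℂ)) :=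
    continuous_rot bc
      ((Complex.continuous_ofReal.smul continuous_const).sub continuous_const) hreal
  have hne (t : ℝ) (ht : t ∈ Set.Icc (0 : ℝ) 1) (j : ℤ) :
      rot bc (shift ((t : ℂ) • V) ((k ^ 2 : ℝ) : ℂ)) ≠ j := by
    intro hj
    have hzero := ((hreal t).charFn_eq_zero_iff bc).2 ⟨j, hj⟩
    rw [Complex.ofReal_pow, shift_eq_modelCoeff, ← normChar_eq_zero_iff bc hk0] at hzero
    have hnorm : ‖(-((t : ℂ) • V))‖ ≤ ‖V‖ := by
      rw [norm_neg, norm_smul, Complex.norm_real, Real.norm_of_nonneg ht.1]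
      exact mul_le_of_le_one_left (norm_nonneg _) ht.2
    have hclose := norm_normChar_sub_sin_le bc (k := k) (R := -((t : ℂ) • V)) (by simp) hk0
      (by rw [hkn]; exact le_trans (by gcongr) hkV)
    rw [hzero, zero_sub, norm_neg, hkn, ← Complex.ofReal_mul, ← Complex.ofReal_sin,
      Complex.norm_real, Real.norm_eq_abs] at hclose
    exact absurd (hclose.trans (by gcongr)) (not_le.2 hsin)
  have hV0 : ((0 : ℝ) : ℂ) • V = 0 := by ext x; simp
  have hV1 : ((1 : ℝ) : ℂ) • V = V := by ext x; simp
  have h := mem_Ioo_of_forall_ne_int hc hne (m := m) (by rwa [hV0])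
  rwa [hV1] at h

lemma abs_sin_of_abs_eq_quarter (n : ℕ) {s : ℝ} (hs : |s| = 1 / 4) :
    1 / 2 < |Real.sin ((n + s) * Real.pi)| := by
  have habs : |Real.sin ((n + s) * Real.pi)| = √2 / 2 :=
    calc |Real.sin ((n + s) * Real.pi)| = |Real.sin (s * Real.pi)| := by
          rw [add_mul, add_comm, Real.sin_add_nat_mul_pi, abs_mul, abs_pow, abs_neg, abs_one,
            one_pow, one_mul]
      _ = |Real.sin (|s * Real.pi|)| := by
          rcases abs_choice (s * Real.pi) with h | h <;> rw [h]
          rw [Real.sin_neg, abs_neg]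
      _ = √2 / 2 := by
          rw [abs_mul, hs, abs_of_pos Real.pi_pos, one_div_mul_eq_div, Real.sin_pi_div_four,
            abs_of_pos (by positivity)]
  have hsqrt : (1 : ℝ) < √2 := Real.lt_sqrt_of_sq_lt (by norm_num)
  linarith

lemma IsRealCoeff.eventually_rot_shift_mem {V : Coeff Real.pi} (hV : IsRealCoeff V)
    (bc : BoundaryCondition) : ∀ᶠ n : ℕ in atTop, ∀ s : ℝ, |s| = 1 / 4 → ∀ m : ℕ,
      (n : ℝ) + s ∈ Set.Ioo ((m : ℝ) + 1) (m + 2) →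
        rot bc (shift V (((n + s) ^ 2 : ℝ) : ℂ)) ∈ Set.Ioo ((m : ℝ) + 1) (m + 2) := by
  have hlarge (c : ℝ) : ∀ᶠ n : ℕ in atTop, c ≤ n :=
    tendsto_natCast_atTop_atTop.eventually_ge_atTop c
  set A := 2 * Real.pi * ‖V‖ * Real.cosh Real.pi
  set B := 2 * Real.pi * ‖V‖ * Real.cosh Real.pi ^ 2
  filter_upwards [hlarge (A + 1), hlarge (2 * B + 1), hlarge 1] with n hA hB hn s hs m hm
  have hs' : -(1 / 4) ≤ s := (abs_le.1 hs.le).1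
  have hsin : B / (n + s) < |Real.sin ((n + s) * Real.pi)| := by
    refine lt_of_le_of_lt ?_ (abs_sin_of_abs_eq_quarter n hs)
    rw [div_le_iff₀ (by linarith)]
    linarith
  have hfree := freeRot_mem_Ioo bc m hm
  have h := hV.rot_shift_mem_of_freeRot_mem bc (by linarith) (by linarith) hsin
    (m := m + 1) (by push_cast; rwa [add_assoc, one_add_one_eq_two])
  push_cast at h ⊢
  rwa [add_assoc, one_add_one_eq_two] at h

lemma IsRealCoeff.eventually_rot_shift {V : Coeff Real.pi} (hV : IsRealCoeff V)
    (bc : BoundaryCondition) : ∀ᶠ n : ℕ in atTop,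
      rot bc (shift V (((n - 1 / 4) ^ 2 : ℝ) : ℂ)) < n ∧
      n < rot bc (shift V (((n + 1 / 4) ^ 2 : ℝ) : ℂ)) := by
  filter_upwards [hV.eventually_rot_shift_mem bc, eventually_ge_atTop 2] with n hrot hn
  obtain ⟨m, rfl⟩ := Nat.exists_eq_add_of_le' hn
  constructor
  · have h := hrot (-(1 / 4)) (by norm_num [abs_of_pos]) m (by
      push_cast; constructor <;> linarith)
    rw [← sub_eq_add_neg] at h
    exact_mod_cast h.2
  · have h := hrot (1 / 4) (by norm_num [abs_of_pos]) (m + 1) (by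
      push_cast; constructor <;> linarith)
    refine lt_of_eq_of_lt ?_ h.1
    push_cast
    ring

lemma IsRealCoeff.exists_rot_shift_eq {V : Coeff Real.pi} (hV : IsRealCoeff V)
    (bc : BoundaryCondition) {n : ℕ} (hn : bc.firstIndex ≤ n) :
    ∃ lam : ℝ, rot bc (shift V lam) = n := by
  obtain ⟨N, hN, hnN⟩ := ((hV.eventually_rot_shift bc).and (eventually_ge_atTop n)).exists
  have hlow := (hV.rot_shift_of_lt bc (lam := -‖V‖ - 1) (by linarith)).2
  have hle : -‖V‖ - 1 ≤ ((N : ℝ) + 1 / 4) ^ 2 := by nlinarith [norm_nonneg V]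
  have hn' : (bc.firstIndex : ℝ) ≤ n := by exact_mod_cast hn
  have hN' : (n : ℝ) ≤ N := by exact_mod_cast hnN
  obtain ⟨lam, -, h⟩ := intermediate_value_Icc hle (hV.continuous_rot_shift bc).continuousOn
    ⟨hlow.le.trans hn', hN'.trans hN.2.le⟩
  exact ⟨lam, h⟩

lemma isRealCoeff_basePot (γ₁ γ₂ : ℝ) : IsRealCoeff (basePot γ₁ γ₂) := fun _ =>
  Complex.ofReal_im _

lemma hillCoeff_zero (γ₁ γ₂ : ℝ) (lam : ℂ) :
    hillCoeff γ₁ γ₂ 0 lam = shift (basePot γ₁ γ₂) lam := by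
  ext x
  simp [hillCoeff, shift]

lemma isEigenvalue_zero_iff (bc : BoundaryCondition) (γ₁ γ₂ : ℝ) (lam : ℝ) :
    IsEigenvalue bc γ₁ γ₂ 0 lam ↔ ∃ j : ℤ, rot bc (shift (basePot γ₁ γ₂) lam) = j := by
  rw [isEigenvalue_iff, hillCoeff_zero,
    (isRealCoeff_shift (isRealCoeff_basePot γ₁ γ₂) lam).charFn_eq_zero_iff]

lemma encard_eigenvalues_lt (bc : BoundaryCondition) (γ₁ γ₂ : ℝ) {n : ℕ}
    (hn : bc.firstIndex ≤ n) {lam : ℝ} (h : rot bc (shift (basePot γ₁ γ₂) lam) = n) :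
    {ν : ℝ | ν < lam ∧ IsEigenvalue bc γ₁ γ₂ 0 (ν : ℂ)}.encard + (bc.firstIndex : ℕ∞) = n := by
  have hV := isRealCoeff_basePot γ₁ γ₂
  simp only [isEigenvalue_zero_iff]
  exact encard_int_values_lt (hV.strictMono_rot bc) (hV.lt_rot_shift bc)
    (fun _ => hV.exists_rot_shift_eq bc) hn h

lemma isNthEigenvalue_iff (bc : BoundaryCondition) (γ₁ γ₂ : ℝ) {n : ℕ} {lam : ℝ} :
    IsNthEigenvalue bc γ₁ γ₂ n lam ↔
      bc.firstIndex ≤ n ∧ rot bc (shift (basePot γ₁ γ₂) lam) = n := by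
  constructor
  · rintro ⟨heig, hcard⟩
    obtain ⟨j, hj⟩ := (isEigenvalue_zero_iff bc γ₁ γ₂ lam).1 heig
    have hlow := (isRealCoeff_basePot γ₁ γ₂).lt_rot_shift bc lam
    rw [hj] at hlow
    have hlow' : (bc.firstIndex : ℤ) - 1 < j := by exact_mod_cast hlow
    lift j to ℕ using by omega
    rw [Int.cast_natCast] at hj
    obtain rfl : n = j := by
      exact_mod_cast hcard.symm.trans (encard_eigenvalues_lt bc γ₁ γ₂ (by omega) hj)
    exact ⟨by omega, hj⟩
  · rintro ⟨hn, hrot⟩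
    exact ⟨(isEigenvalue_zero_iff bc γ₁ γ₂ lam).2 ⟨n, by rw [hrot, Int.cast_natCast]⟩,
      encard_eigenvalues_lt bc γ₁ γ₂ hn hrot⟩

lemma eventually_nthEigenvalue_close (bc : BoundaryCondition) (γ₁ γ₂ : ℝ) :
    ∀ᶠ n : ℕ in atTop, ∀ lam : ℝ, IsNthEigenvalue bc γ₁ γ₂ n lam →
      ((n : ℝ) - 1 / 4) ^ 2 < lam ∧ lam < ((n : ℝ) + 1 / 4) ^ 2 := by
  have hV := isRealCoeff_basePot γ₁ γ₂
  filter_upwards [hV.eventually_rot_shift bc] with n hn lam hlam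
  have hmono := hV.strictMono_rot bc
  have hrot := ((isNthEigenvalue_iff bc γ₁ γ₂).1 hlam).2
  exact ⟨hmono.lt_iff_lt.1 (hn.1.trans_eq hrot.symm), hmono.lt_iff_lt.1 (hrot.trans_lt hn.2)⟩

/-! ### The complex phase -/

section SquareRoot

lemma complex_sqrt_sq (z : ℂ) : z.sqrt ^ 2 = z := by
  simp [Complex.sqrt]

lemma re_complex_sqrt_nonneg (z : ℂ) : 0 ≤ z.sqrt.re := by
  rw [Complex.sqrt, Complex.cpow_inv_two_re]
  exact Real.sqrt_nonneg _

lemma differentiableAt_complex_sqrt {z : ℂ} (hz : z ∈ Complex.slitPlane) :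
    DifferentiableAt ℂ Complex.sqrt z :=
  differentiableAt_id.cpow_const hz

variable {z : ℂ} {σ : ℝ}

lemma le_re_sqrt_one_sub (h : ‖z‖ + σ ^ 2 ≤ 1) : σ ≤ (1 - z).sqrt.re := by
  set s := (1 - z).sqrt
  have hre : s.re ^ 2 - s.im ^ 2 = 1 - z.re := by
    simpa [sq] using congrArg Complex.re (complex_sqrt_sq (1 - z))
  exact (le_abs_self σ).trans (abs_le_of_sq_le_sq
    (by linarith [sq_nonneg s.im, Complex.re_le_norm z]) (re_complex_sqrt_nonneg _))

lemma norm_one_sub_sqrt_one_sub_le (hσ : 0 ≤ σ) (h : ‖z‖ + σ ^ 2 ≤ 1) :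
    ‖1 - (1 - z).sqrt‖ ≤ ‖z‖ / (1 + σ) := by
  set s := (1 - z).sqrt
  have hs : 1 + σ ≤ ‖1 + s‖ := by
    have hre := Complex.re_le_norm (1 + s)
    rw [Complex.add_re, Complex.one_re] at hre
    linarith [le_re_sqrt_one_sub h]
  rw [le_div_iff₀ (by linarith)]
  calc ‖1 - s‖ * (1 + σ) ≤ ‖1 - s‖ * ‖1 + s‖ := by gcongr
    _ = ‖z‖ := by
      rw [← norm_mul]
      congr 1
      linear_combination -complex_sqrt_sq (1 - z)

lemma norm_sqrt_one_sub_sub_le (hσ : 0 ≤ σ) (h : ‖z‖ + σ ^ 2 ≤ 1) :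
    ‖(1 - z).sqrt - 1 + z / 2‖ ≤ (‖z‖ / (1 + σ)) ^ 2 / 2 := by
  have hsq : (1 - z).sqrt - 1 + z / 2 = -((1 - (1 - z).sqrt) ^ 2 / 2) := by
    linear_combination (1 / 2) * complex_sqrt_sq (1 - z)
  rw [hsq, norm_neg, norm_div, norm_pow, Complex.norm_two]
  gcongr
  exact norm_one_sub_sqrt_one_sub_le hσ h

end SquareRoot

/-- The disc of parameters `e`. Its radius exceeds `1 / 2`, and is small enough for the estimates
of the phase below. -/
abbrev paramDisc : Set ℂ := Metric.ball 0 (51 / 100)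

/-- The strip around the real axis in which the phase is considered. -/
def strip : Set ℂ := {η | |η.im| < 35 / 100}

lemma isOpen_strip : IsOpen strip :=
  isOpen_lt Complex.continuous_im.abs continuous_const

lemma convex_strip : Convex ℝ strip := by
  have hpre : strip = Complex.imLm ⁻¹' Set.Ioo (-(35 / 100)) (35 / 100) := by
    ext η
    simp [strip, abs_lt]
  rw [hpre]
  exact (convex_Ioo _ _).linear_preimage _

lemma ofReal_mem_strip (x : ℝ) : (x : ℂ) ∈ strip := by
  simp only [strip, Set.mem_ofPred_eq, Complex.ofReal_im, abs_zero]
  norm_num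

lemma ofReal_add_mem_strip (x : ℝ) {ξ : ℂ} (hξ : ‖ξ‖ ≤ 1 / 3) : (x : ℂ) + ξ ∈ strip := by
  simp only [strip, Set.mem_ofPred_eq, Complex.add_im, Complex.ofReal_im, zero_add]
  linarith [Complex.abs_im_le_norm ξ]

lemma mul_mem_strip {η : ℂ} (hη : η ∈ strip) (x : Set.Icc (0 : ℝ) 1) : η * (x : ℝ) ∈ strip := by
  simp only [strip, Set.mem_ofPred_eq, Complex.im_mul_ofReal, abs_mul, abs_of_nonneg x.2.1] at hη ⊢
  exact (mul_le_of_le_one_right (abs_nonneg _) x.2.2).trans_lt hη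

lemma cosh_seven_tenths_le : Real.cosh (7 / 10) ≤ 129 / 100 :=
  calc Real.cosh (7 / 10) ≤ Real.exp ((7 / 10) ^ 2 / 2) := Real.cosh_le_exp_half_sq _
    _ = Real.exp (49 / 800) ^ 4 := by
      rw [← Real.exp_nat_mul]
      norm_num
    _ ≤ (1 / (1 - 49 / 800)) ^ 4 := by
      gcongr
      exact Real.exp_bound_div_one_sub_of_interval (by norm_num) (by norm_num)
    _ ≤ 129 / 100 := by norm_num

lemma abs_im_two_mul_le {η : ℂ} (hη : η ∈ strip) : |(2 * η).im| ≤ 7 / 10 := by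
  have him : |η.im| < 35 / 100 := hη
  rw [show (2 * η).im = 2 * η.im by simp, abs_mul, abs_two]
  linarith

lemma norm_cos_two_mul_le {η : ℂ} (hη : η ∈ strip) : ‖Complex.cos (2 * η)‖ ≤ 129 / 100 :=
  (norm_cos_le_cosh (abs_im_two_mul_le hη)).trans cosh_seven_tenths_le

lemma norm_sin_two_mul_le {η : ℂ} (hη : η ∈ strip) : ‖Complex.sin (2 * η)‖ ≤ 129 / 100 :=
  (norm_sin_le_cosh (abs_im_two_mul_le hη)).trans cosh_seven_tenths_le

lemma norm_mul_cos_le {e η : ℂ} (he : e ∈ paramDisc) (hη : η ∈ strip) :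
    ‖e * Complex.cos (2 * η)‖ ≤ 658 / 1000 :=
  calc ‖e * Complex.cos (2 * η)‖ ≤ 51 / 100 * (129 / 100) :=
        norm_mul_le_of_le (mem_ball_zero_iff.1 he).le (norm_cos_two_mul_le hη)
    _ ≤ 658 / 1000 := by norm_num

lemma norm_mul_cos_ofReal_le {e : ℂ} (he : e ∈ paramDisc) (x : ℝ) :
    ‖e * Complex.cos (2 * x)‖ ≤ 51 / 100 := by
  have hcos : ‖Complex.cos (2 * x)‖ ≤ 1 := by
    simpa using norm_cos_le_cosh (z := 2 * x) (c := 0) (by simp)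
  simpa using norm_mul_le_of_le (mem_ball_zero_iff.1 he).le hcos

/-- The radicand `1 - e cos 2η` of the phase integral. -/
noncomputable def radicand (e η : ℂ) : ℂ := 1 - e * Complex.cos (2 * η)

/-- The integrand `√(1 - e cos 2η)` of the phase integral. -/
noncomputable def root (e η : ℂ) : ℂ := (radicand e η).sqrt

section PhaseIntegrand

variable {e η : ℂ}

lemma le_re_radicand (he : e ∈ paramDisc) (hη : η ∈ strip) :
    342 / 1000 ≤ (radicand e η).re := by
  rw [radicand, Complex.sub_re, Complex.one_re]
  linarith [norm_mul_cos_le he hη, Complex.re_le_norm (e * Complex.cos (2 * η))]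

lemma radicand_mem_slitPlane (he : e ∈ paramDisc) (hη : η ∈ strip) :
    radicand e η ∈ Complex.slitPlane :=
  Or.inl (by linarith [le_re_radicand he hη])

lemma radicand_ne_zero (he : e ∈ paramDisc) (hη : η ∈ strip) : radicand e η ≠ 0 :=
  Complex.slitPlane_ne_zero (radicand_mem_slitPlane he hη)

lemma continuousOn_root : ContinuousOn (Function.uncurry root) (paramDisc ×ˢ strip) := by
  have hrad : Continuous (Function.uncurry radicand) := by
    unfold Function.uncurry radicand
    fun_prop
  exact fun p hp => (ContinuousAt.comp (f := Function.uncurry radicand)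
    (differentiableAt_complex_sqrt (radicand_mem_slitPlane hp.1 hp.2)).continuousAt
    hrad.continuousAt).continuousWithinAt

lemma differentiableOn_root_comp {f g : ℂ → ℂ} {V : Set ℂ} (hf : DifferentiableOn ℂ f V)
    (hg : DifferentiableOn ℂ g V) (hfV : Set.MapsTo f V paramDisc) (hgV : Set.MapsTo g V strip) :
    DifferentiableOn ℂ (fun w => root (f w) (g w)) V := by
  have hrad : DifferentiableOn ℂ (fun w => radicand (f w) (g w)) V := by
    unfold radicand
    fun_prop
  exact fun w hw => (differentiableAt_complex_sqrt
    (radicand_mem_slitPlane (hfV hw) (hgV hw))).comp_differentiableWithinAt w (hrad w hw)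

lemma norm_one_sub_root_le (he : e ∈ paramDisc) (hη : η ∈ strip) :
    ‖1 - root e η‖ ≤ 4152 / 10000 := by
  have h := norm_mul_cos_le he hη
  refine (norm_one_sub_sqrt_one_sub_le (σ := 5848 / 10000) (by norm_num) (by linarith)).trans ?_
  rw [div_le_iff₀ (by norm_num)]
  linarith

lemma norm_root_sub_le (he : e ∈ paramDisc) (hη : η ∈ strip) :
    ‖root e η - 1 + e * Complex.cos (2 * η) / 2‖ ≤ 862 / 10000 := by
  have h := norm_mul_cos_le he hη
  calc ‖root e η - 1 + e * Complex.cos (2 * η) / 2‖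
      ≤ (‖e * Complex.cos (2 * η)‖ / (1 + 5848 / 10000)) ^ 2 / 2 :=
        norm_sqrt_one_sub_sub_le (by norm_num) (by linarith)
    _ ≤ (658 / 1000 / (1 + 5848 / 10000)) ^ 2 / 2 := by gcongr
    _ ≤ 862 / 10000 := by norm_num

lemma norm_root_ofReal_sub_le (he : e ∈ paramDisc) (x : ℝ) :
    ‖root e x - 1 + e * Complex.cos (2 * x) / 2‖ ≤ 45 / 1000 := by
  have h := norm_mul_cos_ofReal_le he x
  calc ‖root e x - 1 + e * Complex.cos (2 * x) / 2‖
      ≤ (‖e * Complex.cos (2 * x)‖ / (1 + 7 / 10)) ^ 2 / 2 :=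
        norm_sqrt_one_sub_sub_le (by norm_num) (by linarith)
    _ ≤ (51 / 100 / (1 + 7 / 10)) ^ 2 / 2 := by gcongr
    _ ≤ 45 / 1000 := by norm_num

lemma le_re_root_ofReal (he : e ∈ paramDisc) (x : ℝ) : 7 / 10 ≤ (root e x).re :=
  le_re_sqrt_one_sub (by linarith [norm_mul_cos_ofReal_le he x])

end PhaseIntegrand

/-- The phase integral `∫₀^η √(1 - e cos 2u) du` along the segment from `0` to `η`. -/
noncomputable def action (e η : ℂ) : ℂ :=
  η * primitiveL (subst root e (η • (coord : Coeff 1))) ⊤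

lemma action_zero_right (e : ℂ) : action e 0 = 0 := zero_mul _

lemma smul_coord_mem_strip {η : ℂ} (hη : η ∈ strip) (x : Set.Icc (0 : ℝ) 1) :
    (η • (coord : Coeff 1)) x ∈ strip :=
  mul_mem_strip hη x

lemma continuousOn_action : ContinuousOn (Function.uncurry action) (paramDisc ×ˢ strip) := by
  have hsubst : ContinuousOn (fun p : ℂ × ℂ => subst root p.1 (p.2 • (coord : Coeff 1)))
      (paramDisc ×ˢ strip) :=
    continuousOn_subst continuousOn_root continuousOn_fst (by fun_prop) (fun _ hp => hp.1)
      fun _ hp => smul_coord_mem_strip hp.2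
  exact continuousOn_snd.mul
    (((ContinuousMap.evalCLM ℂ ⊤).comp primitiveL).continuous.comp_continuousOn hsubst)

lemma differentiableOn_action_comp {f g : ℂ → ℂ} {V : Set ℂ} (hV : IsOpen V)
    (hf : DifferentiableOn ℂ f V) (hg : DifferentiableOn ℂ g V)
    (hfV : Set.MapsTo f V paramDisc) (hgV : Set.MapsTo g V strip) :
    DifferentiableOn ℂ (fun w => action (f w) (g w)) V := by
  have hsubst : DifferentiableOn ℂ (fun w => subst root (f w) (g w • (coord : Coeff 1))) V :=
    differentiableOn_subst hV continuousOn_root hf.continuousOn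
      (hg.continuousOn.smul continuousOn_const) hfV
      (fun w hw => smul_coord_mem_strip (hgV hw))
      fun x => differentiableOn_root_comp hf (hg.mul_const _) hfV
        fun w hw => smul_coord_mem_strip (hgV hw) x
  exact hg.mul (((ContinuousMap.evalCLM ℂ ⊤).comp primitiveL).differentiable.comp_differentiableOn
    hsubst)

lemma hasDerivAt_action {e η : ℂ} (he : e ∈ paramDisc) (hη : η ∈ strip) :
    HasDerivAt (action e) (root e η) η := by
  obtain ⟨G, hG⟩ := convex_strip.exists_forall_hasDerivWithinAt
    (differentiableOn_root_comp (differentiableOn_const e) differentiableOn_id (fun _ _ => he)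
      fun _ => id)
  replace hG : ∀ w ∈ strip, HasDerivAt G (root e w) w := fun w hw =>
    (hG w hw).hasDerivAt (isOpen_strip.mem_nhds hw)
  have hseg : ∀ w ∈ strip, action e w = G w - G 0 := by
    intro w hw
    have hpath : ∀ x ∈ Set.Icc (0 : ℝ) 1, HasDerivWithinAt (fun x : ℝ => G (w * x))
        (w * root e (w * x)) (Set.Icc 0 1) x := by
      intro x hx
      have hlin : HasDerivAt (fun z : ℂ => w * z) w x := by
        simpa using (hasDerivAt_id (x : ℂ)).const_mul w
      exact (((hG _ (mul_mem_strip hw ⟨x, hx⟩)).comp (x : ℂ) hlin).comp_ofReal.congr_deriv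
        (mul_comm _ _)).hasDerivWithinAt
    have hintegral := eq_add_primitiveL_of_hasDerivWithinAt hpath
      (w • subst root e (w • (coord : Coeff 1)))
      (fun x => congrArg (w * ·) (subst_apply continuousOn_root he (smul_coord_mem_strip hw) x)) ⊤
    rw [map_smul] at hintegral
    rw [eq_sub_iff_add_eq']
    simpa [action] using hintegral.symm
  exact ((hG η hη).sub_const (G 0)).congr_of_eventuallyEq
    (Filter.eventually_of_mem (isOpen_strip.mem_nhds hη) hseg)

/-- The mean of `root e` over the half period. -/
noncomputable def meanRoot (e : ℂ) : ℂ := action e Real.pi / Real.pi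

lemma action_pi (e : ℂ) : action e Real.pi = meanRoot e * Real.pi := by
  rw [meanRoot, div_mul_cancel₀ _ (Complex.ofReal_ne_zero.2 Real.pi_ne_zero)]

lemma differentiableOn_meanRoot : DifferentiableOn ℂ meanRoot paramDisc :=
  (differentiableOn_action_comp Metric.isOpen_ball differentiableOn_id (differentiableOn_const _)
    (Set.mapsTo_id _) fun _ _ => ofReal_mem_strip _).div_const _

lemma hasDerivAt_sin_two_mul (η : ℂ) :
    HasDerivAt (fun η : ℂ => Complex.sin (2 * η)) (2 * Complex.cos (2 * η)) η := by
  simpa [mul_comm] using ((hasDerivAt_id η).const_mul 2).csin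

lemma norm_meanRoot_sub_one_le {e : ℂ} (he : e ∈ paramDisc) : ‖meanRoot e - 1‖ ≤ 45 / 1000 := by
  have hderiv : ∀ x ∈ Set.Icc (0 : ℝ) Real.pi, HasDerivWithinAt
      (fun x : ℝ => action e x - x + e / 4 * Complex.sin (2 * x))
      (root e x - 1 + e * Complex.cos (2 * x) / 2) (Set.Icc 0 Real.pi) x := by
    intro x _
    refine (((((hasDerivAt_action he (ofReal_mem_strip x)).sub (hasDerivAt_id (x : ℂ))).add
      ((hasDerivAt_sin_two_mul x).const_mul (e / 4))).comp_ofReal).congr_deriv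
      ?_).hasDerivWithinAt
    ring
  have h := (convex_Icc (0 : ℝ) Real.pi).norm_image_sub_le_of_norm_hasDerivWithin_le hderiv
    (fun x _ => norm_root_ofReal_sub_le he x) (Set.left_mem_Icc.2 Real.pi_pos.le)
    (Set.right_mem_Icc.2 Real.pi_pos.le)
  simp only [Complex.ofReal_zero, action_zero_right, mul_zero, Complex.sin_zero, sub_zero,
    add_zero, Complex.sin_two_pi, action_pi] at h
  rw [← sub_one_mul, norm_mul, Complex.norm_real] at h
  exact le_of_mul_le_mul_right h (norm_pos_iff.2 Real.pi_ne_zero)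

lemma le_norm_meanRoot {e : ℂ} (he : e ∈ paramDisc) : 955 / 1000 ≤ ‖meanRoot e‖ := by
  have h := norm_sub_norm_le (1 : ℂ) (1 - meanRoot e)
  rw [norm_one, norm_sub_rev, sub_sub_cancel] at h
  linarith [norm_meanRoot_sub_one_le he]

lemma norm_meanRoot_le {e : ℂ} (he : e ∈ paramDisc) : ‖meanRoot e‖ ≤ 1045 / 1000 := by
  have h := norm_add_le (1 : ℂ) (meanRoot e - 1)
  rw [norm_one, add_sub_cancel] at h
  linarith [norm_meanRoot_sub_one_le he]

lemma meanRoot_ne_zero {e : ℂ} (he : e ∈ paramDisc) : meanRoot e ≠ 0 :=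
  norm_pos_iff.1 (by linarith [le_norm_meanRoot he])

/-- The deviation of the normalized phase `π * action e η / action e π` from the identity. -/
noncomputable def phaseDev (e η : ℂ) : ℂ := action e η / meanRoot e - η

lemma continuousOn_phaseDev : ContinuousOn (Function.uncurry phaseDev) (paramDisc ×ˢ strip) :=
  (continuousOn_action.div (differentiableOn_meanRoot.continuousOn.comp continuousOn_fst
    fun _ hp => hp.1) fun _ hp => meanRoot_ne_zero hp.1).sub continuousOn_snd

lemma differentiableOn_phaseDev_comp {f g : ℂ → ℂ} {V : Set ℂ} (hV : IsOpen V)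
    (hf : DifferentiableOn ℂ f V) (hg : DifferentiableOn ℂ g V)
    (hfV : Set.MapsTo f V paramDisc) (hgV : Set.MapsTo g V strip) :
    DifferentiableOn ℂ (fun w => phaseDev (f w) (g w)) V :=
  ((differentiableOn_action_comp hV hf hg hfV hgV).div (differentiableOn_meanRoot.comp hf hfV)
    fun _ hw => meanRoot_ne_zero (hfV hw)).sub hg

lemma hasDerivAt_phaseDev {e η : ℂ} (he : e ∈ paramDisc) (hη : η ∈ strip) :
    HasDerivAt (phaseDev e) (root e η / meanRoot e - 1) η :=
  ((hasDerivAt_action he hη).div_const _).sub (hasDerivAt_id η)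

lemma norm_root_div_meanRoot_sub_one_le {e η : ℂ} (he : e ∈ paramDisc) (hη : η ∈ strip) :
    ‖root e η / meanRoot e - 1‖ ≤ 1 / 2 := by
  have hmean := le_norm_meanRoot he
  rw [div_sub_one (meanRoot_ne_zero he), norm_div, div_le_iff₀ (by linarith)]
  have htri := norm_sub_le_norm_sub_add_norm_sub (root e η) 1 (meanRoot e)
  rw [norm_sub_rev _ 1, norm_sub_rev 1 (meanRoot e)] at htri
  linarith [norm_one_sub_root_le he hη, norm_meanRoot_sub_one_le he]

lemma norm_phaseDev_sub_le {e : ℂ} (he : e ∈ paramDisc) {η η' : ℂ} (hη : η ∈ strip)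
    (hη' : η' ∈ strip) : ‖phaseDev e η - phaseDev e η'‖ ≤ 1 / 2 * ‖η - η'‖ :=
  convex_strip.norm_image_sub_le_of_norm_hasDerivWithin_le
    (fun _ hw => (hasDerivAt_phaseDev he hw).hasDerivWithinAt)
    (fun _ hw => norm_root_div_meanRoot_sub_one_le he hw) hη' hη

/-- The part of the phase `action e` of second order in `e`. -/
noncomputable def phaseRem (e η : ℂ) : ℂ :=
  action e η - meanRoot e * η + e / 4 * Complex.sin (2 * η)

lemma hasDerivAt_phaseRem {e η : ℂ} (he : e ∈ paramDisc) (hη : η ∈ strip) :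
    HasDerivAt (phaseRem e) (root e η - meanRoot e + e * Complex.cos (2 * η) / 2) η := by
  refine (((hasDerivAt_action he hη).sub ((hasDerivAt_id η).const_mul (meanRoot e))).add
    ((hasDerivAt_sin_two_mul η).const_mul (e / 4))).congr_deriv ?_
  ring

lemma phaseRem_zero (e : ℂ) : phaseRem e 0 = 0 := by simp [phaseRem, action_zero_right]

lemma phaseRem_pi (e : ℂ) : phaseRem e Real.pi = 0 := by simp [phaseRem, action_pi]

lemma phaseRem_pi_sub {e : ℂ} (he : e ∈ paramDisc) (x : ℝ) :
    phaseRem e (Real.pi - x) = -phaseRem e x := by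
  have hderiv : ∀ x : ℝ,
      HasDerivAt (fun x : ℝ => phaseRem e x + phaseRem e (Real.pi - x)) 0 x := by
    intro x
    have hmem : (Real.pi : ℂ) - x ∈ strip := by simpa using ofReal_mem_strip (Real.pi - x)
    have hcos : Complex.cos (2 * (Real.pi - x)) = Complex.cos (2 * x) := by
      rw [mul_sub, Complex.cos_two_pi_sub]
    have hrefl : HasDerivAt (fun w : ℂ => phaseRem e (Real.pi - w)) _ x :=
      (hasDerivAt_phaseRem he hmem).comp (x : ℂ) ((hasDerivAt_id (x : ℂ)).const_sub _)
    refine (((hasDerivAt_phaseRem he (ofReal_mem_strip x)).add hrefl).comp_ofReal).congr_deriv ?_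
    rw [root, root, radicand, radicand, hcos]
    ring
  have hconst := is_const_of_deriv_eq_zero (fun x => (hderiv x).differentiableAt)
    (fun x => (hderiv x).deriv) x 0
  simp only [Complex.ofReal_zero, sub_zero, phaseRem_zero, phaseRem_pi, add_zero] at hconst
  exact eq_neg_of_add_eq_zero_right hconst

lemma phaseRem_half_pi {e : ℂ} (he : e ∈ paramDisc) : phaseRem e ((Real.pi / 2 : ℝ) : ℂ) = 0 := by
  have h := phaseRem_pi_sub he (Real.pi / 2)
  rw [← Complex.ofReal_sub, sub_half] at h
  exact self_eq_neg.1 h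

lemma norm_phaseRem_sub_le {e : ℂ} (he : e ∈ paramDisc) {η η' : ℂ} (hη : η ∈ strip)
    (hη' : η' ∈ strip) : ‖phaseRem e η - phaseRem e η'‖ ≤ 1312 / 10000 * ‖η - η'‖ := by
  refine convex_strip.norm_image_sub_le_of_norm_hasDerivWithin_le
    (fun _ hw => (hasDerivAt_phaseRem he hw).hasDerivWithinAt) (fun w hw => ?_) hη' hη
  have htri := norm_sub_le (root e w - 1 + e * Complex.cos (2 * w) / 2) (meanRoot e - 1)
  rw [show root e w - 1 + e * Complex.cos (2 * w) / 2 - (meanRoot e - 1)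
    = root e w - meanRoot e + e * Complex.cos (2 * w) / 2 by ring] at htri
  linarith [norm_root_sub_le he hw, norm_meanRoot_sub_one_le he]

lemma exists_phaseRem_eq_zero {e : ℂ} (he : e ∈ paramDisc) {t : ℝ} (ht : t ∈ Set.Icc 0 Real.pi) :
    ∃ c : ℝ, phaseRem e c = 0 ∧ |t - c| ≤ Real.pi / 4 := by
  rcases le_total t (Real.pi / 4) with h1 | h1
  · exact ⟨0, phaseRem_zero e, abs_le.2 ⟨by linarith [ht.1], by linarith⟩⟩
  rcases le_total t (3 * Real.pi / 4) with h2 | h2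
  · exact ⟨Real.pi / 2, phaseRem_half_pi he, abs_le.2 ⟨by linarith, by linarith⟩⟩
  · exact ⟨Real.pi, phaseRem_pi e, abs_le.2 ⟨by linarith, by linarith [ht.2]⟩⟩

lemma norm_phaseDev_le {e : ℂ} (he : e ∈ paramDisc) {t : ℝ} (ht : t ∈ Set.Icc 0 Real.pi) {ξ : ℂ}
    (hξ : ‖ξ‖ ≤ 1 / 3) : ‖phaseDev e (t + ξ)‖ ≤ 1 / 3 := by
  have hmem := ofReal_add_mem_strip t hξ
  obtain ⟨c, hc, htc⟩ := exists_phaseRem_eq_zero he ht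
  have hdist : ‖(t : ℂ) + ξ - c‖ ≤ Real.pi / 4 + 1 / 3 := by
    rw [add_sub_right_comm, ← Complex.ofReal_sub]
    exact norm_add_le_of_le ((Complex.norm_real _).trans_le htc) hξ
  have hrem := norm_phaseRem_sub_le he hmem (ofReal_mem_strip c)
  rw [hc, sub_zero] at hrem
  have hsin : ‖e / 4 * Complex.sin (2 * (t + ξ))‖ ≤ 51 / 400 * (129 / 100) := by
    refine norm_mul_le_of_le ?_ (norm_sin_two_mul_le hmem)
    rw [norm_div, Complex.norm_ofNat]
    linarith [mem_ball_zero_iff.1 he]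
  have hdev : phaseDev e (t + ξ)
      = (phaseRem e (t + ξ) - e / 4 * Complex.sin (2 * (t + ξ))) / meanRoot e := by
    rw [phaseDev, phaseRem]
    field_simp [meanRoot_ne_zero he]
    ring
  have hmean := le_norm_meanRoot he
  rw [hdev, norm_div, div_le_iff₀ (by linarith)]
  linarith [norm_sub_le (phaseRem e (t + ξ)) (e / 4 * Complex.sin (2 * (t + ξ))), Real.pi_lt_d4]

/-! ### Inversion of the phase -/

/-- The map on displacements whose fixed points `ξ` are those for which `t + ξ t` is the inverse
image of `t` under the normalized phase. -/
noncomputable def displacementMap (e : ℂ) (ξ : Coeff Real.pi) : Coeff Real.pi :=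
  -subst phaseDev e (coord + ξ)

section DisplacementMap

variable {ξ : Coeff Real.pi}

lemma norm_apply_le_of_mem_closedBall (hξ : ξ ∈ Metric.closedBall 0 (1 / 3))
    (t : Set.Icc 0 Real.pi) : ‖ξ t‖ ≤ 1 / 3 :=
  (ξ.norm_coe_le_norm t).trans (mem_closedBall_zero_iff.1 hξ)

lemma coord_add_mem_strip (hξ : ξ ∈ Metric.closedBall 0 (1 / 3)) (t : Set.Icc 0 Real.pi) :
    (coord + ξ : Coeff Real.pi) t ∈ strip :=
  ofReal_add_mem_strip t (norm_apply_le_of_mem_closedBall hξ t)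

lemma displacementMap_apply {e : ℂ} (he : e ∈ paramDisc) (hξ : ξ ∈ Metric.closedBall 0 (1 / 3))
    (t : Set.Icc 0 Real.pi) : displacementMap e ξ t = -phaseDev e ((t : ℝ) + ξ t) :=
  congrArg Neg.neg (subst_apply continuousOn_phaseDev he (coord_add_mem_strip hξ) t)

lemma mapsTo_displacementMap {e : ℂ} (he : e ∈ paramDisc) :
    Set.MapsTo (displacementMap e) (Metric.closedBall 0 (1 / 3)) (Metric.closedBall 0 (1 / 3)) := by
  intro ξ hξ
  rw [mem_closedBall_zero_iff, ContinuousMap.norm_le _ (by norm_num)]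
  intro t
  rw [displacementMap_apply he hξ, norm_neg]
  exact norm_phaseDev_le he t.2 (norm_apply_le_of_mem_closedBall hξ t)

lemma lipschitzOnWith_displacementMap {e : ℂ} (he : e ∈ paramDisc) :
    LipschitzOnWith (1 / 2) (displacementMap e) (Metric.closedBall 0 (1 / 3)) := by
  refine LipschitzOnWith.of_dist_le_mul fun ξ hξ ξ' hξ' => ?_
  rw [dist_eq_norm, dist_eq_norm, ContinuousMap.norm_le _ (by positivity)]
  intro t
  rw [ContinuousMap.sub_apply, displacementMap_apply he hξ, displacementMap_apply he hξ',
    neg_sub_neg, norm_sub_rev]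
  calc ‖phaseDev e ((t : ℝ) + ξ t) - phaseDev e ((t : ℝ) + ξ' t)‖
      ≤ 1 / 2 * ‖(ξ - ξ') t‖ := by
        refine (norm_phaseDev_sub_le he (coord_add_mem_strip hξ t)
          (coord_add_mem_strip hξ' t)).trans_eq ?_
        simp
    _ ≤ ((1 / 2 : NNReal) : ℝ) * ‖ξ - ξ'‖ := by
        push_cast
        gcongr
        exact (ξ - ξ').norm_coe_le_norm t

lemma differentiableOn_displacementMap_comp {g : ℂ → Coeff Real.pi}
    (hg : DifferentiableOn ℂ g paramDisc)
    (hmaps : Set.MapsTo g paramDisc (Metric.closedBall 0 (1 / 3))) :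
    DifferentiableOn ℂ (fun e => displacementMap e (g e)) paramDisc := by
  have hgt : ∀ t, DifferentiableOn ℂ (fun e => (coord + g e : Coeff Real.pi) t)
      paramDisc := fun t =>
    (ContinuousMap.evalCLM ℂ t).differentiable.comp_differentiableOn (hg.const_add coord)
  exact (differentiableOn_subst Metric.isOpen_ball continuousOn_phaseDev continuousOn_id
    (hg.const_add coord).continuousOn (Set.mapsTo_id _) (fun e he => coord_add_mem_strip (hmaps he))
    fun t => differentiableOn_phaseDev_comp Metric.isOpen_ball differentiableOn_id (hgt t)
      (Set.mapsTo_id _) fun e he => coord_add_mem_strip (hmaps he) t).neg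

end DisplacementMap

lemma exists_displacement : ∃ ξ : ℂ → Coeff Real.pi, DifferentiableOn ℂ ξ paramDisc ∧
    Set.MapsTo ξ paramDisc (Metric.closedBall 0 (1 / 3)) ∧
    ∀ e ∈ paramDisc, displacementMap e (ξ e) = ξ e := by
  obtain ⟨ξ, hdiff, hmaps, hfix⟩ := exists_differentiableOn_fixedPoint (U := paramDisc)
    (T := displacementMap) (K := 1 / 2) Metric.isOpen_ball (half_lt_self one_pos)
    Metric.isClosed_closedBall Metric.isBounded_closedBall
    (Metric.nonempty_closedBall.2 (by norm_num)) (fun _ => mapsTo_displacementMap)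
    (fun _ => lipschitzOnWith_displacementMap) fun _ => differentiableOn_displacementMap_comp
  exact ⟨ξ, hdiff, hmaps, fun e he => (hfix e he _ (hmaps he)).2 rfl⟩

/-- The displacement `X t - t`, where `X` is the inverse of the normalized phase. -/
noncomputable def displacement : ℂ → Coeff Real.pi := exists_displacement.choose

lemma differentiableOn_displacement : DifferentiableOn ℂ displacement paramDisc :=
  exists_displacement.choose_spec.1

lemma displacement_mem_closedBall {e : ℂ} (he : e ∈ paramDisc) :
    displacement e ∈ Metric.closedBall 0 (1 / 3) :=
  exists_displacement.choose_spec.2.1 he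

lemma phaseDev_displacement {e : ℂ} (he : e ∈ paramDisc) (t : Set.Icc 0 Real.pi) :
    phaseDev e ((t : ℝ) + displacement e t) = -displacement e t := by
  rw [← neg_eq_iff_eq_neg, ← displacementMap_apply he (displacement_mem_closedBall he)]
  exact DFunLike.congr_fun (exists_displacement.choose_spec.2.2 e he) t

lemma displacement_eq {e : ℂ} (he : e ∈ paramDisc) (t : Set.Icc 0 Real.pi) {ξ : ℂ}
    (hξ : ‖ξ‖ ≤ 1 / 3) (h : phaseDev e ((t : ℝ) + ξ) = -ξ) : displacement e t = ξ := by
  have hcontr := norm_phaseDev_sub_le he (coord_add_mem_strip (displacement_mem_closedBall he) t)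
    (ofReal_add_mem_strip t hξ)
  change ‖phaseDev e ((t : ℝ) + displacement e t) - _‖ ≤ 1 / 2 * ‖(t : ℝ) + displacement e t - _‖
    at hcontr
  rw [phaseDev_displacement he, h, neg_sub_neg, add_sub_add_left_eq_sub, norm_sub_rev] at hcontr
  exact sub_eq_zero.1 (norm_le_zero_iff.1 (by linarith))

/-! ### The Liouville transformation -/

/-- The coefficient produced by the Liouville transformation, in the original variable. -/
noncomputable def liouville (γ₁ γ₂ : ℝ) (e η : ℂ) : ℂ :=
  meanRoot e ^ 2 * (-(γ₁ * Complex.cos η + γ₂ * Complex.cos (2 * η)) / radicand e η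
    - e * Complex.cos (2 * η) / radicand e η ^ 2
    + 5 / 4 * (e * Complex.sin (2 * η)) ^ 2 / radicand e η ^ 3)

/-- The coefficient produced by the Liouville transformation, in the phase variable. -/
noncomputable def liouvilleCoeff (γ₁ γ₂ : ℝ) (e : ℂ) : Coeff Real.pi :=
  subst (liouville γ₁ γ₂) e (coord + displacement e)

lemma continuousOn_liouville (γ₁ γ₂ : ℝ) :
    ContinuousOn (Function.uncurry (liouville γ₁ γ₂)) (paramDisc ×ˢ strip) := by
  have hmean : ContinuousOn (fun p : ℂ × ℂ => meanRoot p.1) (paramDisc ×ˢ strip) :=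
    differentiableOn_meanRoot.continuousOn.comp continuousOn_fst fun p hp => hp.1
  have hrad0 : ∀ p ∈ paramDisc ×ˢ strip, radicand p.1 p.2 ≠ 0 := fun p hp =>
    radicand_ne_zero hp.1 hp.2
  unfold Function.uncurry liouville
  unfold radicand at hrad0 ⊢
  refine (hmean.pow 2).mul (((ContinuousOn.div ?_ ?_ hrad0).sub (ContinuousOn.div ?_ ?_
    fun p hp => pow_ne_zero _ (hrad0 p hp))).add
      (ContinuousOn.div ?_ ?_ fun p hp => pow_ne_zero _ (hrad0 p hp))) <;> fun_prop

lemma differentiableOn_liouville_comp (γ₁ γ₂ : ℝ) {g : ℂ → ℂ}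
    (hg : DifferentiableOn ℂ g paramDisc) (hgS : Set.MapsTo g paramDisc strip) :
    DifferentiableOn ℂ (fun e => liouville γ₁ γ₂ e (g e)) paramDisc := by
  have hrad0 : ∀ e ∈ paramDisc, radicand e (g e) ≠ 0 := fun e he => radicand_ne_zero he (hgS he)
  unfold liouville
  unfold radicand at hrad0 ⊢
  refine (differentiableOn_meanRoot.pow 2).mul (((DifferentiableOn.div ?_ ?_ hrad0).sub
    (DifferentiableOn.div ?_ ?_ fun e he => pow_ne_zero _ (hrad0 e he))).add
      (DifferentiableOn.div ?_ ?_ fun e he => pow_ne_zero _ (hrad0 e he))) <;> fun_prop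

lemma liouvilleCoeff_apply (γ₁ γ₂ : ℝ) {e : ℂ} (he : e ∈ paramDisc) (t : Set.Icc 0 Real.pi) :
    liouvilleCoeff γ₁ γ₂ e t = liouville γ₁ γ₂ e ((t : ℝ) + displacement e t) :=
  subst_apply (continuousOn_liouville γ₁ γ₂) he
    (coord_add_mem_strip (displacement_mem_closedBall he)) t

lemma differentiableOn_liouvilleCoeff (γ₁ γ₂ : ℝ) :
    DifferentiableOn ℂ (liouvilleCoeff γ₁ γ₂) paramDisc := by
  have hpath := differentiableOn_displacement.const_add (coord : Coeff Real.pi)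
  have hmem : ∀ e ∈ paramDisc, ∀ t, (coord + displacement e : Coeff Real.pi) t ∈ strip :=
    fun e he => coord_add_mem_strip (displacement_mem_closedBall he)
  exact differentiableOn_subst Metric.isOpen_ball (continuousOn_liouville γ₁ γ₂) continuousOn_id
    hpath.continuousOn (Set.mapsTo_id _) hmem fun t => differentiableOn_liouville_comp γ₁ γ₂
      ((ContinuousMap.evalCLM ℂ t).differentiable.comp_differentiableOn hpath)
      fun e he => hmem e he t

lemma exists_norm_liouville_le (γ₁ γ₂ : ℝ) :
    ∃ B : ℝ, ∀ e ∈ paramDisc, ∀ η ∈ strip, ‖liouville γ₁ γ₂ e η‖ ≤ B := by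
  have hpow {z : ℂ} {c : ℝ} (h : ‖z‖ ≤ c) (n : ℕ) : ‖z ^ n‖ ≤ c ^ n :=
    (norm_pow z n).trans_le (pow_le_pow_left₀ (norm_nonneg z) h n)
  refine ⟨(1045 / 1000) ^ 2 * ((‖(γ₁ : ℂ)‖ * Real.cosh (35 / 100) + ‖(γ₂ : ℂ)‖ * (129 / 100))
    * (342 / 1000)⁻¹ + 658 / 1000 * (342 / 1000)⁻¹ ^ 2
    + ‖(5 / 4 : ℂ)‖ * (51 / 100 * (129 / 100)) ^ 2 * (342 / 1000)⁻¹ ^ 3), fun e he η hη => ?_⟩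
  have hcos : ‖Complex.cos η‖ ≤ Real.cosh (35 / 100) :=
    norm_cos_le_cosh (le_of_lt (show |η.im| < 35 / 100 from hη))
  have hinv : ‖(radicand e η)⁻¹‖ ≤ (342 / 1000)⁻¹ := by
    rw [norm_inv]
    exact inv_anti₀ (by norm_num) ((le_re_radicand he hη).trans (Complex.re_le_norm _))
  have hsin : ‖e * Complex.sin (2 * η)‖ ≤ 51 / 100 * (129 / 100) :=
    norm_mul_le_of_le (mem_ball_zero_iff.1 he).le (norm_sin_two_mul_le hη)
  simp only [liouville, div_eq_mul_inv _ (radicand e η ^ _), div_eq_mul_inv _ (radicand e η),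
    ← inv_pow]
  exact norm_mul_le_of_le (hpow (norm_meanRoot_le he) 2) <| norm_add_le_of_le
    (norm_sub_le_of_le
      (norm_mul_le_of_le ((norm_neg _).trans_le (norm_add_le_of_le (norm_mul_le_of_le le_rfl hcos)
        (norm_mul_le_of_le le_rfl (norm_cos_two_mul_le hη)))) hinv)
      (norm_mul_le_of_le (norm_mul_cos_le he hη) (hpow hinv 2)))
    (norm_mul_le_of_le (norm_mul_le_of_le le_rfl (hpow hsin 2)) (hpow hinv 3))

lemma exists_norm_liouvilleCoeff_le (γ₁ γ₂ : ℝ) :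
    ∃ B : ℝ, ∀ e ∈ paramDisc, ‖liouvilleCoeff γ₁ γ₂ e‖ ≤ B := by
  obtain ⟨B, hB⟩ := exists_norm_liouville_le γ₁ γ₂
  refine ⟨B, fun e he => (ContinuousMap.norm_le_of_nonempty _).2 fun t => ?_⟩
  rw [liouvilleCoeff_apply γ₁ γ₂ he]
  exact hB e he _ (coord_add_mem_strip (displacement_mem_closedBall he) t)

lemma zero_mem_paramDisc : (0 : ℂ) ∈ paramDisc := Metric.mem_ball_self (by norm_num)

lemma action_zero_left {η : ℂ} (hη : η ∈ strip) : action 0 η = η := by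
  have hroot : subst root 0 (η • (coord : Coeff 1)) = (1 : ℂ) • 1 := by
    ext x
    rw [subst_apply continuousOn_root zero_mem_paramDisc (smul_coord_mem_strip hη)]
    simp [root, radicand]
  rw [action, hroot, primitiveL_smul_one]
  simp [coord]

lemma meanRoot_zero : meanRoot 0 = 1 := by
  rw [meanRoot, action_zero_left (ofReal_mem_strip _),
    div_self (Complex.ofReal_ne_zero.2 Real.pi_ne_zero)]

lemma liouvilleCoeff_zero (γ₁ γ₂ : ℝ) : liouvilleCoeff γ₁ γ₂ 0 = -basePot γ₁ γ₂ := by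
  ext t
  have hdisp : displacement 0 t = 0 := by
    refine displacement_eq zero_mem_paramDisc t (by norm_num) ?_
    rw [phaseDev, meanRoot_zero, add_zero, action_zero_left (ofReal_mem_strip _)]
    simp
  rw [liouvilleCoeff_apply γ₁ γ₂ zero_mem_paramDisc, hdisp, liouville, meanRoot_zero]
  simp [radicand, basePot]

section RealParameter

variable {e : ℝ}

lemma ofReal_re_root (he : (e : ℂ) ∈ paramDisc) (x : ℝ) : ((root e x).re : ℂ) = root e x := by
  have hrad : radicand e x = ((1 - e * Real.cos (2 * x) : ℝ) : ℂ) := by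
    rw [radicand]
    push_cast
    rfl
  have hpos := le_re_radicand he (ofReal_mem_strip x)
  rw [hrad, Complex.ofReal_re] at hpos
  rw [root, hrad, Complex.sqrt_of_nonneg (Complex.zero_le_real.2 (by linarith)), Complex.ofReal_re]

lemma ofReal_re_action (he : (e : ℂ) ∈ paramDisc) (x : ℝ) :
    ((action e x).re : ℂ) = action e x := by
  have hderiv : ∀ x : ℝ, HasDerivAt (fun x : ℝ => ((action e x).re : ℂ) - action e x) 0 x := by
    intro x
    have h := hasDerivAt_action he (ofReal_mem_strip x)
    refine (h.real_of_complex.ofReal_comp.sub h.comp_ofReal).congr_deriv ?_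
    rw [ofReal_re_root he, sub_self]
  have hconst := is_const_of_deriv_eq_zero (fun x => (hderiv x).differentiableAt)
    (fun x => (hderiv x).deriv) x 0
  simpa [action_zero_right, sub_eq_zero] using hconst

/-- The normalized phase `π * action e x / action e π` for real `e`. -/
noncomputable def phase (e x : ℝ) : ℝ := (action e x / meanRoot e).re

lemma ofReal_phase (he : (e : ℂ) ∈ paramDisc) (x : ℝ) :
    (phase e x : ℂ) = action e x / meanRoot e := by
  have hratio : action e x / meanRoot e
      = (((action e x).re / ((action e Real.pi).re / Real.pi) : ℝ) : ℂ) := by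
    push_cast
    rw [ofReal_re_action he, ofReal_re_action he, meanRoot]
  rw [phase, hratio, Complex.ofReal_re]

lemma phaseDev_ofReal (he : (e : ℂ) ∈ paramDisc) (x : ℝ) : phaseDev e x = phase e x - x := by
  rw [phaseDev, ofReal_phase he]

lemma phase_zero (e : ℝ) : phase e 0 = 0 := by simp [phase, action_zero_right]

lemma phase_pi (he : (e : ℂ) ∈ paramDisc) : phase e Real.pi = Real.pi := by
  rw [phase, action_pi, mul_div_cancel_left₀ _ (meanRoot_ne_zero he), Complex.ofReal_re]

lemma hasDerivAt_phase (he : (e : ℂ) ∈ paramDisc) (x : ℝ) :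
    HasDerivAt (phase e) (root e x / meanRoot e).re x :=
  ((hasDerivAt_action he (ofReal_mem_strip x)).div_const _).real_of_complex

lemma ofReal_deriv_phase (he : (e : ℂ) ∈ paramDisc) (x : ℝ) :
    ((root e x / meanRoot e).re : ℂ) = root e x / meanRoot e :=
  (((hasDerivAt_phase he x).ofReal_comp.congr_of_eventuallyEq
    (.of_forall fun y => (ofReal_phase he y).symm)).unique
      ((hasDerivAt_action he (ofReal_mem_strip x)).div_const (meanRoot e)).comp_ofReal)

lemma monotone_phase (he : (e : ℂ) ∈ paramDisc) : Monotone (phase e) := by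
  refine monotone_of_deriv_nonneg (fun x => (hasDerivAt_phase he x).differentiableAt) fun x => ?_
  have hdev := (Complex.abs_re_le_norm _).trans
    (norm_root_div_meanRoot_sub_one_le he (ofReal_mem_strip x))
  rw [Complex.sub_re, Complex.one_re] at hdev
  rw [(hasDerivAt_phase he x).deriv]
  linarith [(abs_le.1 hdev).1]

lemma mapsTo_phase (he : (e : ℂ) ∈ paramDisc) :
    Set.MapsTo (phase e) (Set.Icc 0 Real.pi) (Set.Icc 0 Real.pi) := fun _ hx =>
  ⟨(phase_zero e).symm.trans_le (monotone_phase he hx.1),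
    (monotone_phase he hx.2).trans_eq (phase_pi he)⟩

lemma surjOn_phase (he : (e : ℂ) ∈ paramDisc) :
    Set.SurjOn (phase e) (Set.Icc 0 Real.pi) (Set.Icc 0 Real.pi) := by
  have h := intermediate_value_Icc (f := phase e) Real.pi_pos.le fun x _ =>
    (hasDerivAt_phase he x).continuousAt.continuousWithinAt
  rwa [phase_zero, phase_pi he] at h

lemma IccExtendCM_modelCoeff_phase (γ₁ γ₂ : ℝ) (he : (e : ℂ) ∈ paramDisc) (k : ℂ) {x : ℝ}
    (hx : x ∈ Set.Icc 0 Real.pi) :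
    IccExtendCM (modelCoeff k (liouvilleCoeff γ₁ γ₂ e)) (phase e x)
      = -(k ^ 2 + liouville γ₁ γ₂ e x) := by
  have hdisp : displacement e ⟨phase e x, mapsTo_phase he hx⟩ = x - phase e x := by
    refine displacement_eq he _ ?_ ?_
    · rw [← norm_neg, neg_sub, ← phaseDev_ofReal he]
      simpa using norm_phaseDev_le he hx (ξ := 0) (by norm_num)
    · rw [add_sub_cancel, neg_sub, phaseDev_ofReal he]
  rw [IccExtendCM_of_mem (mapsTo_phase he hx), modelCoeff_apply, liouvilleCoeff_apply γ₁ γ₂ he,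
    hdisp, add_sub_cancel]

end RealParameter

lemma hasDerivAt_liouville_green {G dG Y dY : ℝ → ℂ} {d2G Q m : ℂ} {x : ℝ} (hm : m ≠ 0)
    (hG0 : G x ≠ 0) (hG : HasDerivAt G (dG x) x) (hdG : HasDerivAt dG d2G x)
    (hY : HasDerivAt Y (1 / (m * G x ^ 2) * dY x) x)
    (hdY : HasDerivAt dY (1 / (m * G x ^ 2) * (Q * Y x)) x) :
    HasDerivAt (fun y => G y * Y y) (dG x * Y x + dY x / (m * G x)) x ∧
    HasDerivAt (fun y => dG y * Y y + dY y / (m * G y))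
      ((d2G / G x + Q / (m ^ 2 * G x ^ 4)) * (G x * Y x)) x := by
  constructor
  · refine (hG.mul hY).congr_deriv ?_
    field_simp
  · refine ((hdG.mul hY).add (hdY.div (hG.const_mul m) (mul_ne_zero hm hG0))).congr_deriv ?_
    field_simp
    ring

/-- The amplitude `(1 - e cos 2η) ^ (-1/4)` of the Liouville transformation. -/
noncomputable def amplitude (e η : ℂ) : ℂ := radicand e η ^ (-4⁻¹ : ℂ)

/-- The logarithmic derivative of the amplitude. -/
noncomputable def amplitudeLogDeriv (e η : ℂ) : ℂ :=
  -(e * Complex.sin (2 * η)) / (2 * radicand e η)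

section Amplitude

variable {e η : ℂ}

lemma amplitude_ne_zero (he : e ∈ paramDisc) (hη : η ∈ strip) : amplitude e η ≠ 0 :=
  (Complex.cpow_ne_zero_iff_of_exponent_ne_zero (by norm_num)).2 (radicand_ne_zero he hη)

lemma amplitude_sq (e η : ℂ) : amplitude e η ^ 2 = (root e η)⁻¹ := by
  rw [amplitude, root, Complex.sqrt, ← Complex.cpow_nat_mul, ← Complex.cpow_neg]
  norm_num

lemma amplitude_pow_four (e η : ℂ) : amplitude e η ^ 4 = (radicand e η)⁻¹ := by
  rw [show 4 = 2 * 2 from rfl, pow_mul, amplitude_sq, inv_pow, root, complex_sqrt_sq]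

lemma hasDerivAt_radicand (e η : ℂ) :
    HasDerivAt (radicand e) (2 * (e * Complex.sin (2 * η))) η := by
  refine ((((hasDerivAt_id η).const_mul 2).ccos.const_mul e).const_sub 1).congr_deriv ?_
  simp
  ring

lemma hasDerivAt_amplitude (he : e ∈ paramDisc) (hη : η ∈ strip) :
    HasDerivAt (amplitude e) (amplitudeLogDeriv e η * amplitude e η) η := by
  have hrad := radicand_ne_zero he hη
  refine ((hasDerivAt_radicand e η).cpow_const (radicand_mem_slitPlane he hη)).congr_deriv ?_
  rw [Complex.cpow_sub _ _ hrad, Complex.cpow_one, amplitudeLogDeriv, amplitude]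
  field_simp
  ring

lemma hasDerivAt_amplitudeLogDeriv (he : e ∈ paramDisc) (hη : η ∈ strip) :
    HasDerivAt (amplitudeLogDeriv e) (-(e * Complex.cos (2 * η)) / radicand e η
      + (e * Complex.sin (2 * η)) ^ 2 / radicand e η ^ 2) η := by
  have hrad := radicand_ne_zero he hη
  refine ((((hasDerivAt_sin_two_mul η).const_mul e).neg).div
    ((hasDerivAt_radicand e η).const_mul 2) (mul_ne_zero two_ne_zero hrad)).congr_deriv ?_
  simp only [Pi.neg_apply]
  field_simp
  ring

lemma hasDerivAt_amplitudeLogDeriv_mul_amplitude (he : e ∈ paramDisc) (hη : η ∈ strip) :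
    HasDerivAt (fun η => amplitudeLogDeriv e η * amplitude e η)
      ((-(e * Complex.cos (2 * η)) / radicand e η
        + 5 / 4 * (e * Complex.sin (2 * η)) ^ 2 / radicand e η ^ 2) * amplitude e η) η := by
  refine ((hasDerivAt_amplitudeLogDeriv he hη).mul (hasDerivAt_amplitude he hη)).congr_deriv ?_
  rw [amplitudeLogDeriv]
  field_simp [radicand_ne_zero he hη]
  ring

end Amplitude

section RealParameter

variable {e : ℝ}

lemma potential_sub_eq_liouville (γ₁ γ₂ : ℝ) (he : (e : ℂ) ∈ paramDisc) (k : ℂ) (x : ℝ) :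
    potential γ₁ γ₂ (k ^ 2 * e / meanRoot e ^ 2) x
        - (k ^ 2 * e / meanRoot e ^ 2 + k ^ 2 / meanRoot e ^ 2)
      = (-(e * Complex.cos (2 * x)) / radicand e x
          + 5 / 4 * (e * Complex.sin (2 * x)) ^ 2 / radicand e x ^ 2)
        + -(k ^ 2 + liouville γ₁ γ₂ e x) * radicand e x / meanRoot e ^ 2 := by
  have hrad : radicand e x ≠ 0 := radicand_ne_zero he (ofReal_mem_strip x)
  have hmean := meanRoot_ne_zero he
  have hcos : e * Complex.cos (2 * x) = 1 - radicand e x := by rw [radicand, sub_sub_cancel]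
  rw [potential, liouville, hcos]
  push_cast
  field_simp
  linear_combination 4 * radicand e x ^ 2 * k ^ 2 * hcos

lemma holds_amplitude_mul_comp_phase {bc : BoundaryCondition} {Y dY : ℝ → ℂ}
    (he : (e : ℂ) ∈ paramDisc) (h : bc.Holds Y dY) (m : ℂ) :
    bc.Holds (fun x => amplitude e x * Y (phase e x)) fun x =>
      amplitudeLogDeriv e x * amplitude e x * Y (phase e x)
        + dY (phase e x) / (m * amplitude e x) := by
  cases bc <;>
    simp_all [BoundaryCondition.Holds, phase_zero, phase_pi he, amplitudeLogDeriv]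

lemma isEigenvalue_of_charFn_liouville {bc : BoundaryCondition} {γ₁ γ₂ : ℝ}
    (he : (e : ℂ) ∈ paramDisc) {k : ℂ}
    (h : charFn bc (modelCoeff k (liouvilleCoeff γ₁ γ₂ e)) = 0) :
    IsEigenvalue bc γ₁ γ₂ (k ^ 2 * e / meanRoot e ^ 2)
      (k ^ 2 * e / meanRoot e ^ 2 + k ^ 2 / meanRoot e ^ 2) := by
  set q := modelCoeff k (liouvilleCoeff γ₁ γ₂ e)
  have hmean := meanRoot_ne_zero he
  have hpull : ∀ {f : ℝ → ℂ} {f' : ℂ} {x : ℝ}, HasDerivAt f f' (phase e x) →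
      HasDerivAt (fun x => f (phase e x)) (1 / (meanRoot e * amplitude e x ^ 2) * f') x := by
    intro f f' x hf
    refine (hf.scomp x (hasDerivAt_phase he x)).congr_deriv ?_
    rw [← Complex.coe_smul, ofReal_deriv_phase he, amplitude_sq, smul_eq_mul]
    field_simp
  have hODE := fun x (hx : x ∈ Set.Icc 0 Real.pi) =>
    hasDerivAt_liouville_green (G := fun x => amplitude e x)
      (dG := fun x => amplitudeLogDeriv e x * amplitude e x)
      (Y := fun x => bsol bc q (phase e x)) (dY := fun x => dbsol bc q (phase e x)) hmean
      (amplitude_ne_zero he (ofReal_mem_strip x))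
      (hasDerivAt_amplitude he (ofReal_mem_strip x)).comp_ofReal
      (hasDerivAt_amplitudeLogDeriv_mul_amplitude he (ofReal_mem_strip x)).comp_ofReal
      (hpull (hasDerivAt_sol _ _ q (mapsTo_phase he hx)))
      (hpull (hasDerivAt_dsol _ _ q (mapsTo_phase he hx)))
  refine ⟨_, _, fun x hx => (hODE x hx).1.hasDerivWithinAt, fun x hx => ?_,
    holds_amplitude_mul_comp_phase he (holds_bsol_iff.2 h) (meanRoot e), ?_⟩
  · refine (hODE x hx).2.hasDerivWithinAt.congr_deriv ?_
    rw [IccExtendCM_modelCoeff_phase γ₁ γ₂ he k hx, amplitude_pow_four,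
      potential_sub_eq_liouville γ₁ γ₂ he, mul_div_cancel_right₀ _
        (amplitude_ne_zero he (ofReal_mem_strip x)), div_mul_eq_div_div, div_inv_eq_mul]
    ring
  · obtain ⟨t, ht, hne⟩ := exists_bsol_ne_zero bc q
    obtain ⟨x, hx, rfl⟩ := surjOn_phase he ht
    exact ⟨x, hx, mul_ne_zero (amplitude_ne_zero he (ofReal_mem_strip x)) hne⟩

end RealParameter

/-! ### The perturbation series -/

lemma contDiff_charFn_hillCoeff (bc : BoundaryCondition) (γ₁ γ₂ : ℝ) :
    ContDiff ℂ 1 fun p : ℂ × ℂ => charFn bc (hillCoeff γ₁ γ₂ p.1 p.2) := by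
  refine (contDiff_charFn bc).comp ?_
  unfold hillCoeff
  exact (contDiff_const.add (contDiff_fst.smul contDiff_const)).sub
    (contDiff_snd.smul contDiff_const)

lemma exists_analyticAt_implicit {D : ℂ × ℂ → ℂ} {u x d : ℂ} (hD : ContDiffAt ℂ 1 D (u, x))
    (hd : HasDerivAt (fun y => D (u, y)) d x) (hd0 : d ≠ 0) :
    ∃ Λ : ℂ → ℂ, AnalyticAt ℂ Λ u ∧ Λ u = x ∧ ∀ᶠ p in 𝓝 (u, x), D p = D (u, x) ↔ Λ p.1 = p.2 := by
  have hinr : fderiv ℂ D (u, x) ∘L .inr ℂ ℂ ℂ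
      = ContinuousLinearEquiv.unitsEquivAut ℂ (Units.mk0 d hd0) := by
    ext
    have hcomp := (hD.differentiableAt one_ne_zero).hasFDerivAt.comp_hasDerivAt x
      ((hasDerivAt_const x u).prodMk (hasDerivAt_id x))
    simpa using hcomp.unique hd
  have hinv : (fderiv ℂ D (u, x) ∘L .inr ℂ ℂ ℂ).IsInvertible := ⟨_, hinr.symm⟩
  refine ⟨hD.implicitFunction one_ne_zero hinv, ?_, hD.implicitFunction_apply_self _ hinv,
    hD.eventually_apply_eq_iff_implicitFunction _ hinv⟩
  refine Complex.analyticAt_iff_eventually_differentiableAt.2 ?_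
  filter_upwards [(hD.contDiffAt_implicitFunction one_ne_zero hinv).eventually (by simp)]
    with β hβ using hβ.differentiableAt one_ne_zero

lemma exists_analyticAt_branch {bc : BoundaryCondition} {γ₁ γ₂ lam : ℝ}
    (hlam : IsEigenvalue bc γ₁ γ₂ 0 lam) :
    ∃ Λ : ℂ → ℂ, AnalyticAt ℂ Λ 0 ∧ Λ 0 = lam ∧
      ∀ᶠ p : ℂ × ℂ in 𝓝 (0, (lam : ℂ)), IsEigenvalue bc γ₁ γ₂ p.1 p.2 ↔ Λ p.1 = p.2 := by
  rw [isEigenvalue_iff] at hlam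
  obtain ⟨d, hd0, hd⟩ := (isRealCoeff_basePot γ₁ γ₂).exists_hasDerivAt_charFn bc
    (hillCoeff_zero γ₁ γ₂ lam ▸ hlam)
  simp only [← hillCoeff_zero] at hd
  simpa only [isEigenvalue_iff, hlam] using
    exists_analyticAt_implicit (contDiff_charFn_hillCoeff bc γ₁ γ₂).contDiffAt hd hd0

lemma existsUnique_perturbationSeries {bc : BoundaryCondition} (γ₁ γ₂ : ℝ) {n : ℕ}
    (hn : bc.firstIndex ≤ n) :
    ∃! p : FormalMultilinearSeries ℂ ℂ ℂ, IsPerturbationSeries bc γ₁ γ₂ n p := by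
  have hV := isRealCoeff_basePot γ₁ γ₂
  obtain ⟨lam, hlam⟩ := hV.exists_rot_shift_eq bc hn
  have hnth := (isNthEigenvalue_iff bc γ₁ γ₂).2 ⟨hn, hlam⟩
  obtain ⟨Λ, hΛ, hΛ0, hbranch⟩ := exists_analyticAt_branch hnth.1
  have along {f : ℂ → ℂ} (hf : ContinuousAt f 0) (hf0 : f 0 = lam) :
      ∀ᶠ β in 𝓝 (0 : ℂ), IsEigenvalue bc γ₁ γ₂ β (f β) ↔ Λ β = f β := by
    have hpair : Tendsto (fun β => (β, f β)) (𝓝 0) (𝓝 (0, (lam : ℂ))) :=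
      hf0 ▸ (continuousAt_id.prodMk hf).tendsto
    exact hpair.eventually hbranch
  obtain ⟨p, hp⟩ := hΛ
  refine ⟨p, ⟨Λ, hp, ⟨lam, hnth, hΛ0⟩, (along hp.continuousAt hΛ0).mono fun β h => h.2 rfl⟩, ?_⟩
  rintro p' ⟨Λ', hp', ⟨lam', hnth', hΛ'0⟩, hev⟩
  obtain rfl : lam' = lam := (hV.strictMono_rot bc).injective <| by
    rw [hlam, ((isNthEigenvalue_iff bc γ₁ γ₂).1 hnth').2]
  refine hp'.eq_formalMultilinearSeries_of_eventually hp ?_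
  filter_upwards [along hp'.continuousAt hΛ'0, hev] with β hiff hβ using (hiff.1 hβ).symm

lemma ofReal_le_convergenceRadius {bc : BoundaryCondition} {γ₁ γ₂ : ℝ} {n : ℕ} {lam ρ : ℝ}
    (hnth : IsNthEigenvalue bc γ₁ γ₂ n lam) {Λ : ℂ → ℂ}
    (hΛ : DifferentiableOn ℂ Λ (Metric.ball 0 ρ)) (hΛ0 : Λ 0 = lam)
    (hev : ∀ᶠ β in 𝓝 (0 : ℂ), IsEigenvalue bc γ₁ γ₂ β (Λ β)) :
    ENNReal.ofReal ρ ≤ convergenceRadius bc γ₁ γ₂ n := by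
  refine ENNReal.le_of_forall_nnreal_lt fun r hr => ?_
  rcases eq_or_ne r 0 with rfl | hr0
  · simp
  have hrρ : (r : ℝ) < ρ := Real.lt_toNNReal_iff_coe_lt.1 (ENNReal.coe_lt_coe.1 hr)
  have hseries := (hΛ.mono (Metric.closedBall_subset_ball hrρ)).hasFPowerSeriesOnBall
    (pos_iff_ne_zero.2 hr0)
  exact hseries.r_le.trans <| le_iSup₂_of_le (cauchyPowerSeries Λ 0 r)
    ⟨Λ, hseries.hasFPowerSeriesAt, ⟨lam, hnth, hΛ0⟩, hev⟩ le_rfl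

/-! ### The quantization condition -/

lemma norm_cos_sub_one_le {w : ℂ} (hw : ‖w‖ ≤ 1) : ‖Complex.cos w - 1‖ ≤ ‖w‖ ^ 2 := by
  have hpos := Complex.norm_exp_sub_one_sub_id_le (x := w * Complex.I) (by simpa using hw)
  have hneg := Complex.norm_exp_sub_one_sub_id_le (x := -w * Complex.I) (by simpa using hw)
  rw [norm_mul, Complex.norm_I, mul_one] at hpos hneg
  rw [norm_neg] at hneg
  have heq : Complex.cos w - 1 = ((Complex.exp (w * Complex.I) - 1 - w * Complex.I)
      + (Complex.exp (-w * Complex.I) - 1 - -w * Complex.I)) / 2 := by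
    rw [Complex.cos]; ring
  rw [heq, norm_div, Complex.norm_two]
  linarith [norm_add_le (Complex.exp (w * Complex.I) - 1 - w * Complex.I)
    (Complex.exp (-w * Complex.I) - 1 - -w * Complex.I)]

lemma norm_sub_sin_div_pi_sub_le {x y : ℂ} (hx : ‖x‖ ≤ 1 / 4) (hy : ‖y‖ ≤ 1 / 4) :
    ‖(x - Complex.sin (Real.pi * x) / Real.pi) - (y - Complex.sin (Real.pi * y) / Real.pi)‖
      ≤ 618 / 1000 * ‖x - y‖ := by
  have hpi : (Real.pi : ℂ) ≠ 0 := Complex.ofReal_ne_zero.2 Real.pi_ne_zero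
  have hderiv (t : ℂ) : HasDerivAt (fun t : ℂ => t - Complex.sin (Real.pi * t) / Real.pi)
      (1 - Complex.cos (Real.pi * t)) t := by
    refine ((hasDerivAt_id t).sub
      (((hasDerivAt_id t).const_mul (Real.pi : ℂ)).csin.div_const _)).congr_deriv ?_
    rw [mul_one, id, mul_div_cancel_right₀ _ hpi]
  refine (convex_closedBall (0 : ℂ) (1 / 4)).norm_image_sub_le_of_norm_hasDerivWithin_le (𝕜 := ℂ)
    (fun t _ => (hderiv t).hasDerivWithinAt) (fun t ht => ?_) (mem_closedBall_zero_iff.2 hy)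
    (mem_closedBall_zero_iff.2 hx)
  rw [mem_closedBall_zero_iff] at ht
  have harg : ‖(Real.pi : ℂ) * t‖ ≤ 786 / 1000 := by
    rw [norm_mul, Complex.norm_real, Real.norm_of_nonneg Real.pi_pos.le]
    nlinarith [norm_nonneg t, Real.pi_pos, Real.pi_lt_d4]
  rw [norm_sub_rev]
  refine (norm_cos_sub_one_le (harg.trans (by norm_num))).trans ?_
  nlinarith [norm_nonneg ((Real.pi : ℂ) * t)]

lemma neg_one_pow_mul_sin_natCast_add_mul_pi (n : ℕ) (t : ℂ) :
    (-1 : ℂ) ^ n * Complex.sin ((n + t) * Real.pi) = Complex.sin (Real.pi * t) := by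
  rw [add_mul, add_comm, mul_comm t, Complex.sin_antiperiodic.add_nat_mul_eq, ← mul_assoc,
    ← mul_pow]
  norm_num

lemma natCast_sub_norm_le_norm_add (n : ℕ) (t : ℂ) : (n : ℝ) - ‖t‖ ≤ ‖(n : ℂ) + t‖ := by
  simpa using norm_sub_norm_le (n : ℂ) (-t)

lemma natCast_add_ne_zero {n : ℕ} {t : ℂ} (ht : ‖t‖ < n) : (n : ℂ) + t ≠ 0 :=
  norm_pos_iff.1 (by linarith [natCast_sub_norm_le_norm_add n t])

lemma differentiableOn_normChar {ℓ : ℝ} [Fact (0 ≤ ℓ)] (bc : BoundaryCondition) {k : ℂ → ℂ}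
    {R : ℂ → Coeff ℓ} {U : Set ℂ} (hk : DifferentiableOn ℂ k U) (hR : DifferentiableOn ℂ R U)
    (hk0 : ∀ u ∈ U, k u ≠ 0) : DifferentiableOn ℂ (fun u => normChar bc (k u) (R u)) U := by
  have hmodel : DifferentiableOn ℂ (fun u => modelCoeff (k u) (R u)) U :=
    (((hk.pow 2).smul (differentiableOn_const (1 : Coeff ℓ))).add hR).neg
  cases bc with
  | dirichlet => exact hk.mul ((differentiable_charFn .dirichlet).comp_differentiableOn hmodel)
  | neumann =>
    exact ((differentiable_charFn .neumann).comp_differentiableOn hmodel).neg.div hk hk0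

/-- The wave number `n` is large compared with the remainder coefficients of norm at most `B`. -/
def IsLargeFor (B : ℝ) (n : ℕ) : Prop := 200 * Real.pi * B * Real.cosh Real.pi ^ 2 + 1 ≤ n

lemma eventually_isLargeFor (B : ℝ) : ∀ᶠ n : ℕ in atTop, IsLargeFor B n :=
  tendsto_natCast_atTop_atTop.eventually_ge_atTop _

/-- Newton's map, with the derivative frozen at that of `sin`, for the equation
`normChar bc (n + t) R = 0` in the phase shift `t`. -/
noncomputable def phaseShiftMap (bc : BoundaryCondition) (n : ℕ) (R : Coeff Real.pi) (t : ℂ) : ℂ :=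
  t - (-1) ^ n / Real.pi * normChar bc (n + t) R

lemma phaseShiftMap_eq_self_iff {bc : BoundaryCondition} {n : ℕ} {R : Coeff Real.pi} {t : ℂ} :
    phaseShiftMap bc n R t = t ↔ normChar bc (n + t) R = 0 := by
  simp [phaseShiftMap, Real.pi_ne_zero]

lemma phaseShiftMap_eq (bc : BoundaryCondition) (n : ℕ) (R : Coeff Real.pi) (t : ℂ) :
    phaseShiftMap bc n R t = (t - Complex.sin (Real.pi * t) / Real.pi)
      - (-1) ^ n / Real.pi * (normChar bc (n + t) R - Complex.sin ((n + t) * Real.pi)) := by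
  rw [phaseShiftMap, ← neg_one_pow_mul_sin_natCast_add_mul_pi n t]
  ring

lemma norm_neg_one_pow_div_pi_mul_le (n : ℕ) (z : ℂ) : ‖(-1 : ℂ) ^ n / Real.pi * z‖ ≤ ‖z‖ := by
  rw [norm_mul, norm_div, norm_pow, norm_neg, norm_one, one_pow, Complex.norm_real,
    Real.norm_of_nonneg Real.pi_pos.le]
  refine mul_le_of_le_one_left (norm_nonneg z) ((div_le_one Real.pi_pos).2 ?_)
  linarith [Real.pi_gt_three]

section LargeWaveNumber

variable {n : ℕ} {R : Coeff Real.pi}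

lemma IsLargeFor.norm_normChar_sub_sin_le (hn : IsLargeFor ‖R‖ n) (bc : BoundaryCondition) {t : ℂ}
    (ht : ‖t‖ ≤ 1 / 2) :
    ‖normChar bc (n + t) R - Complex.sin ((n + t) * Real.pi)‖ ≤ 1 / 100 := by
  have hlarge : 200 * Real.pi * ‖R‖ * Real.cosh Real.pi ^ 2 + 1 ≤ n := hn
  have hnorm := natCast_sub_norm_le_norm_add n t
  have hcosh : 2 * Real.pi * ‖R‖ * Real.cosh Real.pi
      ≤ 2 * Real.pi * ‖R‖ * Real.cosh Real.pi ^ 2 := by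
    gcongr
    exact le_self_pow₀ (Real.one_le_cosh _) two_ne_zero
  have hC : 0 ≤ 2 * Real.pi * ‖R‖ * Real.cosh Real.pi ^ 2 := by positivity
  have him : |((n : ℂ) + t).im| ≤ 1 := by
    rw [Complex.add_im, Complex.natCast_im, zero_add]
    exact (Complex.abs_im_le_norm t).trans (by linarith)
  refine (AngularHill.norm_normChar_sub_sin_le bc him (natCast_add_ne_zero (by linarith))
    (by linarith)).trans ?_
  rw [div_le_iff₀ (by linarith)]
  linarith

lemma IsLargeFor.lipschitzOnWith_normChar_sub_sin (hn : IsLargeFor ‖R‖ n)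
    (bc : BoundaryCondition) :
    LipschitzOnWith (8 / 100) (fun t => normChar bc (n + t) R - Complex.sin ((n + t) * Real.pi))
      (Metric.closedBall 0 (1 / 4)) := by
  have hn1 : (1 : ℝ) ≤ n := le_trans (le_add_of_nonneg_left (by positivity)) hn
  refine lipschitzOnWith_closedBall (R := 1 / 2) (C := 1 / 100) (by norm_num) ?_
    (fun t ht => hn.norm_normChar_sub_sin_le bc (mem_ball_zero_iff.1 ht).le) (by norm_num)
  refine (differentiableOn_normChar bc (by fun_prop) (differentiableOn_const R) fun t ht => ?_).sub
    (by fun_prop)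
  exact natCast_add_ne_zero (by linarith [mem_ball_zero_iff.1 ht])

lemma IsLargeFor.lipschitzOnWith_phaseShiftMap (hn : IsLargeFor ‖R‖ n) (bc : BoundaryCondition) :
    LipschitzOnWith (7 / 10) (phaseShiftMap bc n R) (Metric.closedBall 0 (1 / 4)) := by
  refine LipschitzOnWith.of_dist_le_mul fun x hx y hy => ?_
  have herr := (hn.lipschitzOnWith_normChar_sub_sin bc).dist_le_mul x hx y hy
  have hmain := norm_sub_sin_div_pi_sub_le (mem_closedBall_zero_iff.1 hx)
    (mem_closedBall_zero_iff.1 hy)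
  rw [dist_eq_norm, dist_eq_norm] at herr ⊢
  rw [phaseShiftMap_eq, phaseShiftMap_eq, sub_sub_sub_comm, ← mul_sub]
  refine (norm_sub_le _ _).trans ((add_le_add hmain
    ((norm_neg_one_pow_div_pi_mul_le n _).trans herr)).trans ?_)
  push_cast
  linarith [norm_nonneg (x - y)]

lemma IsLargeFor.mapsTo_phaseShiftMap (hn : IsLargeFor ‖R‖ n) (bc : BoundaryCondition) :
    Set.MapsTo (phaseShiftMap bc n R) (Metric.closedBall 0 (1 / 4))
      (Metric.closedBall 0 (1 / 4)) := by
  intro t ht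
  rw [mem_closedBall_zero_iff] at ht ⊢
  have hmain := norm_sub_sin_div_pi_sub_le ht (y := 0) (by norm_num)
  simp only [mul_zero, Complex.sin_zero, zero_div, sub_zero] at hmain
  rw [phaseShiftMap_eq]
  refine (norm_sub_le _ _).trans ((add_le_add hmain ((norm_neg_one_pow_div_pi_mul_le n _).trans
    (hn.norm_normChar_sub_sin_le bc (ht.trans (by norm_num))))).trans ?_)
  linarith

end LargeWaveNumber

lemma eventually_exists_phaseShift (bc : BoundaryCondition) (γ₁ γ₂ : ℝ) :
    ∀ᶠ n : ℕ in atTop, ∃ τ : ℂ → ℂ, DifferentiableOn ℂ τ paramDisc ∧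
      Set.MapsTo τ paramDisc (Metric.closedBall 0 (1 / 4)) ∧
      ∀ e ∈ paramDisc, ∀ t ∈ Metric.closedBall (0 : ℂ) (1 / 4),
        normChar bc (n + t) (liouvilleCoeff γ₁ γ₂ e) = 0 ↔ t = τ e := by
  obtain ⟨B, hB⟩ := exists_norm_liouvilleCoeff_le γ₁ γ₂
  filter_upwards [eventually_isLargeFor B, eventually_ge_atTop 1] with n hn hn1
  have hlarge (e : ℂ) (he : e ∈ paramDisc) : IsLargeFor ‖liouvilleCoeff γ₁ γ₂ e‖ n := by
    refine le_trans ?_ hn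
    gcongr
    exact hB e he
  have hne (t : ℂ) (ht : t ∈ Metric.closedBall 0 (1 / 4)) : (n : ℂ) + t ≠ 0 := by
    have hn1' : (1 : ℝ) ≤ n := by exact_mod_cast hn1
    exact natCast_add_ne_zero (by linarith [mem_closedBall_zero_iff.1 ht])
  obtain ⟨τ, hτ, hmaps, hfix⟩ := exists_differentiableOn_fixedPoint (U := paramDisc)
    (T := fun e => phaseShiftMap bc n (liouvilleCoeff γ₁ γ₂ e)) (K := 7 / 10) Metric.isOpen_ball
    (by norm_num [← NNReal.coe_lt_coe]) Metric.isClosed_closedBall Metric.isBounded_closedBall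
    (Metric.nonempty_closedBall.2 (by norm_num))
    (fun e he => (hlarge e he).mapsTo_phaseShiftMap bc)
    (fun e he => (hlarge e he).lipschitzOnWith_phaseShiftMap bc)
    fun t ht hmaps => ht.sub <| (differentiableOn_normChar bc (ht.const_add _)
      (differentiableOn_liouvilleCoeff γ₁ γ₂) fun e he => hne _ (hmaps he)).const_mul _
  exact ⟨τ, hτ, hmaps, fun e he t ht => phaseShiftMap_eq_self_iff.symm.trans (hfix e he t ht)⟩

/-! ### Solving for the spectral parameter -/

lemma norm_root_sub_root_le {e e' : ℂ} (he : e ∈ paramDisc) (he' : e' ∈ paramDisc) (x : ℝ) :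
    ‖root e x - root e' x‖ ≤ 5 / 7 * ‖e - e'‖ := by
  have hmul : (root e x - root e' x) * (root e x + root e' x)
      = -((e - e') * Complex.cos (2 * x)) := by
    have hsq (e : ℂ) : root e x ^ 2 = 1 - e * Complex.cos (2 * x) := complex_sqrt_sq _
    linear_combination hsq e - hsq e'
  have hsum : 7 / 5 ≤ ‖root e x + root e' x‖ := by
    refine le_trans ?_ (Complex.re_le_norm _)
    rw [Complex.add_re]
    linarith [le_re_root_ofReal he x, le_re_root_ofReal he' x]
  have hcos : ‖Complex.cos (2 * x)‖ ≤ 1 := by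
    simpa using norm_cos_le_cosh (z := 2 * x) (c := 0) (by simp)
  have hnorm := congrArg norm hmul
  rw [norm_mul, norm_neg, norm_mul] at hnorm
  nlinarith [norm_nonneg (root e x - root e' x), norm_nonneg (e - e')]

lemma norm_meanRoot_sub_le {e e' : ℂ} (he : e ∈ paramDisc) (he' : e' ∈ paramDisc) :
    ‖meanRoot e - meanRoot e'‖ ≤ 5 / 7 * ‖e - e'‖ := by
  have hderiv : ∀ x ∈ Set.Icc (0 : ℝ) Real.pi, HasDerivWithinAt
      (fun x : ℝ => action e x - action e' x) (root e x - root e' x) (Set.Icc 0 Real.pi) x :=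
    fun x _ => ((hasDerivAt_action he (ofReal_mem_strip x)).sub
      (hasDerivAt_action he' (ofReal_mem_strip x))).comp_ofReal.hasDerivWithinAt
  have hpi := norm_image_sub_le_of_norm_deriv_le_segment' hderiv
    (fun x _ => norm_root_sub_root_le he he' x) Real.pi (Set.right_mem_Icc.2 Real.pi_pos.le)
  simp only [Complex.ofReal_zero, action_zero_right, action_pi, sub_self, sub_zero, ← sub_mul,
    norm_mul, Complex.norm_real, Real.norm_of_nonneg Real.pi_pos.le] at hpi
  exact le_of_mul_le_mul_right hpi Real.pi_pos

lemma norm_meanRoot_sq_sub_le {e e' : ℂ} (he : e ∈ paramDisc) (he' : e' ∈ paramDisc) :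
    ‖meanRoot e ^ 2 - meanRoot e' ^ 2‖ ≤ 1494 / 1000 * ‖e - e'‖ := by
  have hsum : ‖meanRoot e + meanRoot e'‖ ≤ 2090 / 1000 :=
    (norm_add_le _ _).trans (by linarith [norm_meanRoot_le he, norm_meanRoot_le he'])
  rw [sq_sub_sq]
  refine (norm_mul_le_of_le hsum (norm_meanRoot_sub_le he he')).trans ?_
  linarith [norm_nonneg (e - e')]

lemma norm_meanRoot_sq_le {e : ℂ} (he : e ∈ paramDisc) : ‖meanRoot e ^ 2‖ ≤ 10921 / 10000 := by
  rw [norm_pow]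
  nlinarith [norm_nonneg (meanRoot e), norm_meanRoot_le he]

lemma norm_sq_ratio_sub_one_le {n : ℕ} (hn : 10000 ≤ n) {t : ℂ} (ht : ‖t‖ ≤ 1 / 4) :
    ‖((n : ℂ) / (n + t)) ^ 2 - 1‖ ≤ 1 / 10000 := by
  have hn' : (10000 : ℝ) ≤ n := by exact_mod_cast hn
  have hden := natCast_sub_norm_le_norm_add n t
  have hne : (n : ℂ) + t ≠ 0 := natCast_add_ne_zero (by linarith)
  have heq : ((n : ℂ) / (n + t)) ^ 2 - 1 = -(t * (2 * n + t)) / (n + t) ^ 2 := by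
    field_simp
    ring
  have hnum : ‖t * (2 * n + t)‖ ≤ 1 / 4 * (2 * n + 1 / 4) := by
    refine norm_mul_le_of_le ht (norm_add_le_of_le ?_ ht)
    rw [norm_mul, Complex.norm_two, Complex.norm_natCast]
  have hsq : ((n : ℝ) - 1 / 4) ^ 2 ≤ ‖(n : ℂ) + t‖ ^ 2 := by
    gcongr <;> linarith
  rw [heq, norm_div, norm_neg, norm_pow, div_le_iff₀ (pow_pos (norm_pos_iff.2 hne) 2)]
  nlinarith

lemma norm_div_sq_le_of_mem_ball {n : ℕ} {β : ℂ} {r : ℝ} (hr : 0 ≤ r)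
    (hβ : β ∈ Metric.ball 0 (r * n ^ 2)) : ‖β / (n : ℂ) ^ 2‖ ≤ r := by
  rw [norm_div, norm_pow, Complex.norm_natCast]
  exact div_le_of_le_mul₀ (sq_nonneg _) hr (mem_ball_zero_iff.1 hβ).le

/-- The factor by which `e` exceeds its leading approximation `β / n²`, when the wave number is
`n + τ e`. -/
noncomputable def paramFactor (n : ℕ) (τ : ℂ → ℂ) (e : ℂ) : ℂ :=
  meanRoot e ^ 2 * ((n : ℂ) / (n + τ e)) ^ 2

section PhaseShift

variable {n : ℕ} {τ : ℂ → ℂ}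

lemma differentiableOn_paramFactor (hn : 1 ≤ n) (hτ : DifferentiableOn ℂ τ paramDisc)
    (hmaps : Set.MapsTo τ paramDisc (Metric.closedBall 0 (1 / 4))) :
    DifferentiableOn ℂ (paramFactor n τ) paramDisc := by
  have hn' : (1 : ℝ) ≤ n := by exact_mod_cast hn
  refine (differentiableOn_meanRoot.pow 2).mul
    (((differentiableOn_const _).div (hτ.const_add _) fun e he => natCast_add_ne_zero ?_).pow 2)
  linarith [mem_closedBall_zero_iff.1 (hmaps he)]

lemma norm_paramFactor_le (hn : 10000 ≤ n)
    (hmaps : Set.MapsTo τ paramDisc (Metric.closedBall 0 (1 / 4))) {e : ℂ} (he : e ∈ paramDisc) :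
    ‖paramFactor n τ e‖ ≤ 1093 / 1000 := by
  have hratio := norm_sq_ratio_sub_one_le hn (mem_closedBall_zero_iff.1 (hmaps he))
  have hratio' : ‖((n : ℂ) / (n + τ e)) ^ 2‖ ≤ 1 + 1 / 10000 := by
    rw [← add_sub_cancel 1 (((n : ℂ) / (n + τ e)) ^ 2)]
    exact norm_add_le_of_le norm_one.le hratio
  exact (norm_mul_le_of_le (norm_meanRoot_sq_le he) hratio').trans (by norm_num)

lemma norm_paramFactor_sub_le (hn : 10000 ≤ n) (hτ : DifferentiableOn ℂ τ paramDisc)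
    (hmaps : Set.MapsTo τ paramDisc (Metric.closedBall 0 (1 / 4))) {e e' : ℂ}
    (he : e ∈ Metric.closedBall 0 (505 / 1000)) (he' : e' ∈ Metric.closedBall 0 (505 / 1000)) :
    ‖paramFactor n τ e - paramFactor n τ e'‖ ≤ 16 / 10 * ‖e - e'‖ := by
  have hsub : Metric.closedBall (0 : ℂ) (505 / 1000) ⊆ paramDisc :=
    Metric.closedBall_subset_ball (by norm_num)
  have hratio (e : ℂ) (he : e ∈ paramDisc) := norm_sq_ratio_sub_one_le hn
    (mem_closedBall_zero_iff.1 (hmaps he))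
  have hratio_diff : DifferentiableOn ℂ (fun e => ((n : ℂ) / (n + τ e)) ^ 2 - 1) paramDisc := by
    have hn' : (10000 : ℝ) ≤ n := by exact_mod_cast hn
    refine (((differentiableOn_const _).div (hτ.const_add _) fun e he =>
      natCast_add_ne_zero ?_).pow 2).sub_const _
    linarith [mem_closedBall_zero_iff.1 (hmaps he)]
  have hratio_lip := (lipschitzOnWith_closedBall (K := 4 / 100) (C := 1 / 10000) (by norm_num)
    hratio_diff hratio (by norm_num)).dist_le_mul e he e' he'
  rw [dist_eq_norm, dist_eq_norm] at hratio_lip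
  have hsplit : paramFactor n τ e - paramFactor n τ e'
      = (meanRoot e ^ 2 - meanRoot e' ^ 2)
        + (meanRoot e ^ 2 - meanRoot e' ^ 2) * (((n : ℂ) / (n + τ e)) ^ 2 - 1)
        + meanRoot e' ^ 2 * ((((n : ℂ) / (n + τ e)) ^ 2 - 1)
          - (((n : ℂ) / (n + τ e')) ^ 2 - 1)) := by
    rw [paramFactor, paramFactor]; ring
  have hmean := norm_meanRoot_sq_sub_le (hsub he) (hsub he')
  rw [hsplit]
  refine (norm_add_le_of_le (norm_add_le_of_le hmean (norm_mul_le_of_le hmean (hratio e (hsub he))))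
    (norm_mul_le_of_le (norm_meanRoot_sq_le (hsub he')) hratio_lip)).trans ?_
  push_cast
  linarith [norm_nonneg (e - e')]

lemma exists_param (hn : 10000 ≤ n) (hτ : DifferentiableOn ℂ τ paramDisc)
    (hmaps : Set.MapsTo τ paramDisc (Metric.closedBall 0 (1 / 4))) :
    ∃ g : ℂ → ℂ, DifferentiableOn ℂ g (Metric.ball 0 (6 / 13 * n ^ 2)) ∧
      Set.MapsTo g (Metric.ball 0 (6 / 13 * n ^ 2)) paramDisc ∧
      ∀ β ∈ Metric.ball (0 : ℂ) (6 / 13 * n ^ 2), β / n ^ 2 * paramFactor n τ (g β) = g β := by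
  have hsub : Metric.closedBall (0 : ℂ) (505 / 1000) ⊆ paramDisc :=
    Metric.closedBall_subset_ball (by norm_num)
  have hself : ∀ β ∈ Metric.ball (0 : ℂ) (6 / 13 * n ^ 2),
      Set.MapsTo (fun e => β / n ^ 2 * paramFactor n τ e) (Metric.closedBall 0 (505 / 1000))
        (Metric.closedBall 0 (505 / 1000)) := fun β hβ e he => by
    rw [mem_closedBall_zero_iff]
    exact (norm_mul_le_of_le (norm_div_sq_le_of_mem_ball (by norm_num) hβ)
      (norm_paramFactor_le hn hmaps (hsub he))).trans (by norm_num)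
  have hlip : ∀ β ∈ Metric.ball (0 : ℂ) (6 / 13 * n ^ 2), LipschitzOnWith (3 / 4)
      (fun e => β / n ^ 2 * paramFactor n τ e) (Metric.closedBall 0 (505 / 1000)) :=
    fun β hβ => LipschitzOnWith.of_dist_le_mul fun e he e' he' => by
      rw [dist_eq_norm, dist_eq_norm, ← mul_sub]
      refine (norm_mul_le_of_le (norm_div_sq_le_of_mem_ball (by norm_num) hβ)
        (norm_paramFactor_sub_le hn hτ hmaps he he')).trans ?_
      push_cast
      linarith [norm_nonneg (e - e')]
  obtain ⟨g, hg, hgmaps, hfix⟩ := exists_differentiableOn_fixedPoint Metric.isOpen_ball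
    (by norm_num [← NNReal.coe_lt_coe]) Metric.isClosed_closedBall Metric.isBounded_closedBall
    (Metric.nonempty_closedBall.2 (by norm_num)) hself hlip fun g hg hgmaps =>
      (differentiableOn_id.div_const _).mul
        ((differentiableOn_paramFactor (by lia) hτ hmaps).comp hg (hgmaps.mono_right hsub))
  exact ⟨g, hg, hgmaps.mono_right hsub, fun β hβ => (hfix β hβ _ (hgmaps hβ)).2 rfl⟩

end PhaseShift

/-! ### The eigenvalue branch on the large disc -/

lemma eqOn_zero_of_eq_zero_on_reals {f : ℂ → ℂ} {U : Set ℂ} (hU : IsOpen U)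
    (hconn : IsPreconnected U) (hf : DifferentiableOn ℂ f U) {x₀ : ℝ} (hx₀ : (x₀ : ℂ) ∈ U)
    (hreal : ∀ x : ℝ, (x : ℂ) ∈ U → f x = 0) : Set.EqOn f 0 U := by
  refine (hf.analyticOnNhd hU).eqOn_zero_of_preconnected_of_frequently_eq_zero hconn hx₀ ?_
  have hofReal : Tendsto ((↑) : ℝ → ℂ) (𝓝[≠] x₀) (𝓝[≠] (x₀ : ℂ)) :=
    Complex.continuous_ofReal.continuousWithinAt.tendsto_nhdsWithin fun x hx => by simpa using hx
  refine hofReal.frequently (Eventually.frequently ?_)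
  filter_upwards [hofReal.mono_right nhdsWithin_le_nhds (hU.mem_nhds hx₀)] with x hx
    using hreal x hx

lemma isEigenvalue_of_forall_charFn_liouville {bc : BoundaryCondition} {γ₁ γ₂ : ℝ} {k : ℂ → ℂ}
    (hk : DifferentiableOn ℂ k paramDisc)
    (hchar : ∀ e ∈ paramDisc, charFn bc (modelCoeff (k e) (liouvilleCoeff γ₁ γ₂ e)) = 0)
    {e : ℂ} (he : e ∈ paramDisc) :
    IsEigenvalue bc γ₁ γ₂ (k e ^ 2 * e / meanRoot e ^ 2)
      (k e ^ 2 * e / meanRoot e ^ 2 + k e ^ 2 / meanRoot e ^ 2) := by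
  have hmean0 : ∀ e ∈ paramDisc, meanRoot e ^ 2 ≠ 0 := fun e he =>
    pow_ne_zero 2 (meanRoot_ne_zero he)
  have hβ : DifferentiableOn ℂ (fun e => k e ^ 2 * e / meanRoot e ^ 2) paramDisc :=
    ((hk.pow 2).mul differentiableOn_id).div (differentiableOn_meanRoot.pow 2) hmean0
  have hdiff := ((contDiff_charFn_hillCoeff bc γ₁ γ₂).differentiable
    one_ne_zero).comp_differentiableOn
      (hβ.prodMk (hβ.add ((hk.pow 2).div (differentiableOn_meanRoot.pow 2) hmean0)))
  rw [isEigenvalue_iff]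
  exact eqOn_zero_of_eq_zero_on_reals Metric.isOpen_ball (convex_ball _ _).isPreconnected hdiff
    (x₀ := 0) (by simp)
    (fun x hx => (isEigenvalue_iff bc γ₁ γ₂ _ _).1
      (isEigenvalue_of_charFn_liouville hx (hchar x hx))) he

lemma exists_phaseShift_of_isEigenvalue {bc : BoundaryCondition} {γ₁ γ₂ : ℝ} {n : ℕ} (hn : 1 ≤ n)
    {lam : ℝ} (hlam : IsEigenvalue bc γ₁ γ₂ 0 lam) (hlower : ((n : ℝ) - 1 / 4) ^ 2 < lam)
    (hupper : lam < ((n : ℝ) + 1 / 4) ^ 2) :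
    ∃ t ∈ Metric.closedBall (0 : ℂ) (1 / 4), (n + t) ^ 2 = lam ∧
      normChar bc (n + t) (liouvilleCoeff γ₁ γ₂ 0) = 0 := by
  have hn' : (1 : ℝ) ≤ n := by exact_mod_cast hn
  have hadd : (n : ℂ) + ((√lam - n : ℝ) : ℂ) = (√lam : ℝ) := by push_cast; ring
  have hsq : (n + ((√lam - n : ℝ) : ℂ)) ^ 2 = lam := by
    rw [hadd, ← Complex.ofReal_pow, Real.sq_sqrt ((sq_nonneg _).trans hlower.le)]
  have hnorm : ‖((√lam - n : ℝ) : ℂ)‖ ≤ 1 / 4 := by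
    rw [Complex.norm_real, Real.norm_eq_abs, abs_le]
    have hle : (n : ℝ) - 1 / 4 ≤ √lam := Real.le_sqrt_of_sq_le hlower.le
    have hge : √lam ≤ n + 1 / 4 := Real.sqrt_le_iff.2 ⟨by linarith, hupper.le⟩
    constructor <;> linarith
  refine ⟨_, mem_closedBall_zero_iff.2 hnorm, hsq, ?_⟩
  rw [normChar_eq_zero_iff bc (natCast_add_ne_zero (by linarith)), liouvilleCoeff_zero,
    ← shift_eq_modelCoeff, hsq, ← hillCoeff_zero]
  exact (isEigenvalue_iff bc γ₁ γ₂ 0 lam).1 hlam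

lemma eventually_exists_branch (bc : BoundaryCondition) (γ₁ γ₂ : ℝ) :
    ∀ᶠ n : ℕ in atTop, ∃ (lam : ℝ) (Λ : ℂ → ℂ), IsNthEigenvalue bc γ₁ γ₂ n lam ∧ Λ 0 = lam ∧
      DifferentiableOn ℂ Λ (Metric.ball 0 (6 / 13 * n ^ 2)) ∧
      ∀ β ∈ Metric.ball (0 : ℂ) (6 / 13 * n ^ 2), IsEigenvalue bc γ₁ γ₂ β (Λ β) := by
  filter_upwards [eventually_exists_phaseShift bc γ₁ γ₂, eventually_nthEigenvalue_close bc γ₁ γ₂,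
    eventually_ge_atTop 10000, eventually_ge_atTop bc.firstIndex]
    with n ⟨τ, hτ, hτmaps, hroot⟩ hclose hn hfirst
  obtain ⟨g, hg, hgmaps, hparam⟩ := exists_param hn hτ hτmaps
  obtain ⟨lam, hlam⟩ := (isRealCoeff_basePot γ₁ γ₂).exists_rot_shift_eq bc hfirst
  have hnth := (isNthEigenvalue_iff bc γ₁ γ₂).2 ⟨hfirst, hlam⟩
  have hn' : (10000 : ℝ) ≤ n := by exact_mod_cast hn
  have hn0 : (n : ℂ) ≠ 0 := Nat.cast_ne_zero.2 (by lia)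
  have hk0 : ∀ e ∈ paramDisc, (n : ℂ) + τ e ≠ 0 := fun e he =>
    natCast_add_ne_zero (by linarith [mem_closedBall_zero_iff.1 (hτmaps he)])
  have hchar : ∀ e ∈ paramDisc,
      charFn bc (modelCoeff (n + τ e) (liouvilleCoeff γ₁ γ₂ e)) = 0 := fun e he =>
    (normChar_eq_zero_iff bc (hk0 e he) _).1 ((hroot e he _ (hτmaps he)).2 rfl)
  have hL : DifferentiableOn ℂ (fun e => (n + τ e) ^ 2 / meanRoot e ^ 2) paramDisc :=
    ((hτ.const_add _).pow 2).div (differentiableOn_meanRoot.pow 2)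
      fun e he => pow_ne_zero 2 (meanRoot_ne_zero he)
  refine ⟨lam, fun β => β + (n + τ (g β)) ^ 2 / meanRoot (g β) ^ 2, hnth, ?_,
    differentiableOn_id.add (hL.comp hg hgmaps), fun β hβ => ?_⟩
  · obtain ⟨t, ht, hsq, hzero⟩ := exists_phaseShift_of_isEigenvalue (by lia) hnth.1
      (hclose lam hnth).1 (hclose lam hnth).2
    have hg0 : g 0 = 0 := by
      rw [← hparam 0 (Metric.mem_ball_self (by positivity)), zero_div, zero_mul]
    simp only [hg0, ← (hroot 0 zero_mem_paramDisc t ht).1 hzero, hsq, meanRoot_zero, one_pow,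
      div_one, zero_add]
  · have hβ_eq : (n + τ (g β)) ^ 2 * g β / meanRoot (g β) ^ 2 = β := by
      have hmean := meanRoot_ne_zero (hgmaps hβ)
      have hk := hk0 _ (hgmaps hβ)
      have hfix := hparam β hβ
      rw [paramFactor] at hfix
      rw [div_eq_iff (pow_ne_zero 2 hmean)]
      nth_rewrite 2 [← hfix]
      field_simp
    have heig := isEigenvalue_of_forall_charFn_liouville (hτ.const_add (n : ℂ)) hchar (hgmaps hβ)
    rwa [hβ_eq] at heig

lemma eventually_ofReal_le_convergenceRadius (bc : BoundaryCondition) (γ₁ γ₂ : ℝ) :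
    ∀ᶠ n : ℕ in atTop, ENNReal.ofReal (6 / 13 * n ^ 2) ≤ convergenceRadius bc γ₁ γ₂ n := by
  filter_upwards [eventually_exists_branch bc γ₁ γ₂, eventually_gt_atTop 0]
    with n ⟨lam, Λ, hnth, hΛ0, hΛ, hev⟩ hn
  have hball := Metric.ball_mem_nhds (0 : ℂ) (by positivity : 0 < 6 / 13 * (n : ℝ) ^ 2)
  exact ofReal_le_convergenceRadius hnth hΛ hΛ0 (eventually_of_mem hball hev)

end AngularHill

theorem theorem3p1_general (γ₁ γ₂ : ℝ) (bc : AngularHill.BoundaryCondition) :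
    (∀ n : ℕ, bc.firstIndex ≤ n →
      ∃! p : FormalMultilinearSeries ℂ ℂ ℂ, AngularHill.IsPerturbationSeries bc γ₁ γ₂ n p) ∧
    (6 / 13 : ℝ≥0∞) ≤
      liminf (fun n : ℕ => AngularHill.convergenceRadius bc γ₁ γ₂ n / (n : ℝ≥0∞) ^ 2) atTop := by
  refine ⟨fun n hn => AngularHill.existsUnique_perturbationSeries γ₁ γ₂ hn,
    le_liminf_of_le (by isBoundedDefault) ?_⟩
  filter_upwards [AngularHill.eventually_ofReal_le_convergenceRadius bc γ₁ γ₂,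
    eventually_gt_atTop 0] with n hradius hn
  have hcast : ENNReal.ofReal (6 / 13 * n ^ 2) = 6 / 13 * (n : ℝ≥0∞) ^ 2 := by
    rw [ENNReal.ofReal_mul (by norm_num), ENNReal.ofReal_pow n.cast_nonneg, ENNReal.ofReal_natCast,
      ENNReal.ofReal_div_of_pos (by norm_num)]
    simp
  rw [ENNReal.le_div_iff_mul_le (Or.inl (by simp [hn.ne'])) (Or.inl (by simp)), ← hcast]
  exact hradius

theorem theorem3p1 (E Z h : ℝ) (hh : 0 < h) (hE : 2 * |Z| < E)
    (bc : AngularHill.BoundaryCondition) :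
    (∀ n : ℕ, bc.firstIndex ≤ n →
      ∃! p : FormalMultilinearSeries ℂ ℂ ℂ,
        AngularHill.IsPerturbationSeries bc (Z / h ^ 2) (E / (2 * h ^ 2)) n p) ∧
    (6 / 13 : ℝ≥0∞) ≤
      liminf (fun n : ℕ =>
        AngularHill.convergenceRadius bc (Z / h ^ 2) (E / (2 * h ^ 2)) n / (n : ℝ≥0∞) ^ 2)
        atTop :=
  theorem3p1_general (Z / h ^ 2) (E / (2 * h ^ 2)) bc
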